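/- Let $M$ be a smooth $n$-dimensional manifold without boundary, $(N,\gamma)$ a smooth Riemannian manifold without boundary, $T\in\mathbb R$ and $J\subseteq(-\infty,T)$ an open set of times. Let $(g(t),\phi(t))_{t\in J}$ be a smooth solution of the harmonic Ricci flow with non-negative differentiable coupling function $\alpha(t)$, i.e. the $g(t)$ are Riemannian metrics on $M$ and the $\phi(t)\colon M\to N$ are maps, both smooth in $(t,x)$, with $$\partial_t g=-2\,\mathrm{Ric}_{g}+2\alpha\,\nabla\phi\otimes\nabla\phi,\qquad \partial_t\phi=\tau_{g}\phi,$$ where $\nabla\phi\otimes\nabla\phi=\phi^*\gamma$ and $\tau_g\phi$ is the tension field of $\phi$. Put $S_{ij}=R_{ij}-\alpha\nabla_i\phi\nabla_j\phi$, let $\hat S=g^{ij}S_{ij}=R-\alpha|\nabla\phi|^2$ be its trace ($R$ the scalar curvature), and let $\square^*=-\partial_t-\Delta+\hat S$, where $\Delta$, $\nabla$ and all norms are those of the evolving metric $g(t)$. Let $l\colon J\times M\to\mathbb R$ be smooth and suppose that $v=(4\pi(T-t))^{-n/2}e^{-l}$ solves the adjoint heat equation $\square^*v=0$ on $J\times M$.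 Define $$w=\big((T-t)(2\Delta l-|\nabla l|^2+\hat S)+l-n\big)v .$$ Then on $J\times M$ $$\square^*w=-2(T-t)\Big[\Big|S_{ij}+\nabla_i\nabla_jl-\frac{g_{ij}}{2(T-t)}\Big|^2+\alpha\,\big|\tau_g\phi-\langle\nabla\phi,\nabla l\rangle\big|^2-\tfrac12\,\dot\alpha\,|\nabla\phi|^2\Big]v .$$ -/

import Mathlib

open scoped Manifold ContDiff Bundle

noncomputable section

namespace HarmonicRicci

/-! ### Tensor calculus in coordinates on `ℝⁿ` -/

/-- The partial derivative `∂ᵢ f`. -/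
def pd {n : ℕ} (i : Fin n) (f : EuclideanSpace ℝ (Fin n) → ℝ) (u : EuclideanSpace ℝ (Fin n)) : ℝ :=
  fderiv ℝ f u (EuclideanSpace.single i 1)

/-- The Christoffel symbol `Γᵏᵢⱼ = ½ gᵏˡ (∂ᵢ gⱼₗ + ∂ⱼ gᵢₗ - ∂ₗ gᵢⱼ)` of the metric with components `G`. -/
def christoffel {n : ℕ} (G : EuclideanSpace ℝ (Fin n) → Matrix (Fin n) (Fin n) ℝ)
    (k i j : Fin n) (u : EuclideanSpace ℝ (Fin n)) : ℝ :=
  (1 / 2) * ∑ l, (G u)⁻¹ k l *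
    (pd i (fun z => G z j l) u + pd j (fun z => G z i l) u - pd l (fun z => G z i j) u)

/-- The components
`Rᵢⱼ = ∂ₖ Γᵏᵢⱼ - ∂ⱼ Γᵏᵢₖ + Γᵏₖₗ Γˡᵢⱼ - Γᵏⱼₗ Γˡᵢₖ` of the Ricci tensor. -/
def ricci {n : ℕ} (G : EuclideanSpace ℝ (Fin n) → Matrix (Fin n) (Fin n) ℝ)
    (u : EuclideanSpace ℝ (Fin n)) : Matrix (Fin n) (Fin n) ℝ :=
  Matrix.of fun i j =>
    ∑ k, (pd k (christoffel G k i j) u - pd j (christoffel G k i k) u)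
      + ∑ k, ∑ l, (christoffel G k k l u * christoffel G l i j u
          - christoffel G k j l u * christoffel G l i k u)

/-- The components `∇ᵢ∇ⱼ f = ∂ᵢ∂ⱼ f - Γᵏᵢⱼ ∂ₖ f` of the Hessian of a function. -/
def hessian {n : ℕ} (G : EuclideanSpace ℝ (Fin n) → Matrix (Fin n) (Fin n) ℝ)
    (f : EuclideanSpace ℝ (Fin n) → ℝ) (u : EuclideanSpace ℝ (Fin n)) :
    Matrix (Fin n) (Fin n) ℝ :=
  Matrix.of fun i j => pd i (pd j f) u - ∑ k, christoffel G k i j u * pd k f u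

/-- The trace `gⁱʲ Aᵢⱼ` of a covariant 2-tensor. -/
def traceWith {n : ℕ} (G A : Matrix (Fin n) (Fin n) ℝ) : ℝ :=
  ∑ i, ∑ j, G⁻¹ i j * A i j

/-- The squared norm `gⁱᵏ gʲˡ Aᵢⱼ Aₖₗ` of a covariant 2-tensor. -/
def tensorNormSq {n : ℕ} (G A : Matrix (Fin n) (Fin n) ℝ) : ℝ :=
  ∑ i, ∑ j, ∑ k, ∑ l, G⁻¹ i k * G⁻¹ j l * A i j * A k l

/-- The pairing `⟨∇f, ∇h⟩ = gⁱʲ ∂ᵢf ∂ⱼh`. -/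
def gradPairing {n : ℕ} (G : EuclideanSpace ℝ (Fin n) → Matrix (Fin n) (Fin n) ℝ)
    (f h : EuclideanSpace ℝ (Fin n) → ℝ) (u : EuclideanSpace ℝ (Fin n)) : ℝ :=
  traceWith (G u) (Matrix.of fun i j => pd i f u * pd j h u)

/-! ### Riemannian metrics, functions and maps on manifolds, in a smooth chart -/

/-- Smooth Riemannian metrics on an `n`-dimensional manifold. -/
abbrev RMetric (n : ℕ) (M : Type*) [TopologicalSpace M] [ChartedSpace (EuclideanSpace ℝ (Fin n)) M]
    [IsManifold (𝓡 n) ∞ M] :=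
  Bundle.ContMDiffRiemannianMetric (𝓡 n) ∞ (EuclideanSpace ℝ (Fin n))
    (fun x : M => TangentSpace (𝓡 n) x)

/-- The smooth charts of an `n`-dimensional manifold. -/
abbrev charts (n : ℕ) (M : Type*) [TopologicalSpace M] [ChartedSpace (EuclideanSpace ℝ (Fin n)) M] :
    Set (OpenPartialHomeomorph M (EuclideanSpace ℝ (Fin n))) :=
  IsManifold.maximalAtlas (𝓡 n) ∞ M

section Chart

variable {n k : ℕ}
  {M : Type*} [TopologicalSpace M] [ChartedSpace (EuclideanSpace ℝ (Fin n)) M]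
  [IsManifold (𝓡 n) ∞ M]
  {N : Type*} [TopologicalSpace N] [ChartedSpace (EuclideanSpace ℝ (Fin k)) N]
  [IsManifold (𝓡 k) ∞ N]

/-- The components `gᵢⱼ = g(∂ᵢ, ∂ⱼ)` of a metric in the chart `e`, as functions of the
coordinates; here `∂ᵢ = d(e⁻¹)(eᵢ)`. -/
def metricIn (g : RMetric n M) (e : OpenPartialHomeomorph M (EuclideanSpace ℝ (Fin n)))
    (u : EuclideanSpace ℝ (Fin n)) : Matrix (Fin n) (Fin n) ℝ :=
  Matrix.of fun i j => g.inner (e.symm u)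
    (mfderiv (𝓡 n) (𝓡 n) e.symm u (EuclideanSpace.single i (1 : ℝ)))
    (mfderiv (𝓡 n) (𝓡 n) e.symm u (EuclideanSpace.single j (1 : ℝ)))

/-- The components in the chart `e` of `∇φ ⊗ ∇φ`, that is, of the pullback `φ^*γ`:
`(∇φ ⊗ ∇φ)ᵢⱼ = γ(dφ(∂ᵢ), dφ(∂ⱼ))`. -/
def pullbackIn (γ : RMetric k N) (φ : M → N)
    (e : OpenPartialHomeomorph M (EuclideanSpace ℝ (Fin n)))
    (u : EuclideanSpace ℝ (Fin n)) : Matrix (Fin n) (Fin n) ℝ :=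
  Matrix.of fun i j => γ.inner (φ (e.symm u))
    (mfderiv (𝓡 n) (𝓡 k) (φ ∘ e.symm) u (EuclideanSpace.single i (1 : ℝ)))
    (mfderiv (𝓡 n) (𝓡 k) (φ ∘ e.symm) u (EuclideanSpace.single j (1 : ℝ)))

/-- The components of the tensor `S = Ric - α ∇φ ⊗ ∇φ` in the chart `e`. -/
def tensorSIn (g : RMetric n M) (γ : RMetric k N) (φ : M → N) (a : ℝ)
    (e : OpenPartialHomeomorph M (EuclideanSpace ℝ (Fin n)))
    (u : EuclideanSpace ℝ (Fin n)) : Matrix (Fin n) (Fin n) ℝ :=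
  ricci (metricIn g e) u - a • pullbackIn γ φ e u

/-- `|∇φ|² = gⁱʲ γ(∂ᵢφ, ∂ⱼφ)` at the point `x`, computed in the chart `e`. -/
def energyIn (g : RMetric n M) (γ : RMetric k N) (φ : M → N)
    (e : OpenPartialHomeomorph M (EuclideanSpace ℝ (Fin n))) (x : M) : ℝ :=
  traceWith (metricIn g e (e x)) (pullbackIn γ φ e (e x))

/-- The Laplace–Beltrami operator at the point `x`, computed in the chart `e`. -/
def laplacianIn (g : RMetric n M) (e : OpenPartialHomeomorph M (EuclideanSpace ℝ (Fin n)))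
    (f : M → ℝ) (x : M) : ℝ :=
  traceWith (metricIn g e (e x)) (hessian (metricIn g e) (f ∘ e.symm) (e x))

/-- The component `φᵃ` of a map, read in the charts `e` of `M` and `e'` of `N`. -/
def mapComp (φ : M → N) (e : OpenPartialHomeomorph M (EuclideanSpace ℝ (Fin n)))
    (e' : OpenPartialHomeomorph N (EuclideanSpace ℝ (Fin k))) (a : Fin k)
    (u : EuclideanSpace ℝ (Fin n)) : ℝ :=
  e' (φ (e.symm u)) a

/-- The components
`(τ_g φ)ᵃ = Δ φᵃ + gⁱʲ Γᵃ_{bc}(φ) ∂ᵢφᵇ ∂ⱼφᶜ` of the tension field at the point `x`,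
where `Γᵃ_{bc}` are the Christoffel symbols of the target. -/
def tensionIn (g : RMetric n M) (γ : RMetric k N) (φ : M → N)
    (e : OpenPartialHomeomorph M (EuclideanSpace ℝ (Fin n)))
    (e' : OpenPartialHomeomorph N (EuclideanSpace ℝ (Fin k))) (x : M) (a : Fin k) : ℝ :=
  traceWith (metricIn g e (e x)) (hessian (metricIn g e) (mapComp φ e e' a) (e x))
    + ∑ b, ∑ c, christoffel (metricIn γ e') a b c (e' (φ x)) *
        gradPairing (metricIn g e) (mapComp φ e e' b) (mapComp φ e e' c) (e x)

/-! ### Scalar functions on the manifold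

The following scalars do not depend on the chart; they are computed at `x` in the
preferred chart at `x`. -/

/-- The Laplacian `Δ f` as a function on `M`. -/
def laplacian (g : RMetric n M) (f : M → ℝ) (x : M) : ℝ :=
  laplacianIn g (chartAt (EuclideanSpace ℝ (Fin n)) x) f x

/-- `|∇f|²` as a function on `M`. -/
def gradSq (g : RMetric n M) (f : M → ℝ) (x : M) : ℝ :=
  gradPairing (metricIn g (chartAt (EuclideanSpace ℝ (Fin n)) x))
    (f ∘ (chartAt (EuclideanSpace ℝ (Fin n)) x).symm)
    (f ∘ (chartAt (EuclideanSpace ℝ (Fin n)) x).symm) (chartAt (EuclideanSpace ℝ (Fin n)) x x)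

/-- The trace of `S`, i.e. the scalar curvature minus `α |∇φ|²`, as a function on `M`. -/
def traceS (g : RMetric n M) (γ : RMetric k N) (φ : M → N) (a : ℝ) (x : M) : ℝ :=
  traceWith (metricIn g (chartAt (EuclideanSpace ℝ (Fin n)) x)
      (chartAt (EuclideanSpace ℝ (Fin n)) x x))
    (tensorSIn g γ φ a (chartAt (EuclideanSpace ℝ (Fin n)) x)
      (chartAt (EuclideanSpace ℝ (Fin n)) x x))

/-! ### The flow and the adjoint heat operator -/

/-- `(g(t), φ(t))`, `t ∈ J`, is a smooth solution of the harmonic Ricci flow with coupling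
function `α`:
`∂ₜ g = -2 Ric + 2 α ∇φ ⊗ ∇φ` and `∂ₜ φ = τ_g φ`, in all smooth charts. -/
structure IsHarmonicRicciFlow (J : Set ℝ) (g : ℝ → RMetric n M) (γ : RMetric k N)
    (φ : ℝ → M → N) (α : ℝ → ℝ) : Prop where
  metric_smooth : ∀ e ∈ charts n M, ∀ i j : Fin n,
    ContDiffOn ℝ ∞ (fun p : ℝ × EuclideanSpace ℝ (Fin n) => metricIn (g p.1) e p.2 i j)
      (J ×ˢ e.target)
  map_smooth : ContMDiffOn (𝓘(ℝ, ℝ).prod (𝓡 n)) (𝓡 k) ∞ (fun p : ℝ × M => φ p.1 p.2)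
    (J ×ˢ Set.univ)
  coupling_differentiable : DifferentiableOn ℝ α J
  coupling_nonneg : ∀ t ∈ J, 0 ≤ α t
  metric_eq : ∀ t ∈ J, ∀ e ∈ charts n M, ∀ u ∈ e.target, ∀ i j : Fin n,
    deriv (fun s => metricIn (g s) e u i j) t =
      -2 * ricci (metricIn (g t) e) u i j + 2 * α t * pullbackIn γ (φ t) e u i j
  map_eq : ∀ t ∈ J, ∀ e ∈ charts n M, ∀ e' ∈ charts k N, ∀ x ∈ e.source,
    φ t x ∈ e'.source → ∀ a : Fin k,
      deriv (fun s => e' (φ s x) a) t = tensionIn (g t) γ (φ t) e e' x a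

/-- The adjoint heat operator `□^* f = -∂ₜ f - Δ f + (tr S) f` along the flow, with the
Laplacian computed in the chart `e`. -/
def adjointHeatIn (g : ℝ → RMetric n M) (γ : RMetric k N) (φ : ℝ → M → N) (α : ℝ → ℝ)
    (e : OpenPartialHomeomorph M (EuclideanSpace ℝ (Fin n))) (f : ℝ → M → ℝ)
    (t : ℝ) (x : M) : ℝ :=
  -deriv (fun s => f s x) t - laplacianIn (g t) e (f t) x
    + traceS (g t) γ (φ t) (α t) x * f t x

/-- `|S + Hess l - g / (2 (T - t))|²` at `x`, computed in the chart `e`; `σ` stands for `T - t`. -/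
def solitonTensorSq (g : RMetric n M) (γ : RMetric k N) (φ : M → N) (a : ℝ) (l : M → ℝ) (σ : ℝ)
    (e : OpenPartialHomeomorph M (EuclideanSpace ℝ (Fin n))) (x : M) : ℝ :=
  tensorNormSq (metricIn g e (e x))
    (tensorSIn g γ φ a e (e x) + hessian (metricIn g e) (l ∘ e.symm) (e x)
      - (1 / (2 * σ)) • metricIn g e (e x))

/-- `|τ_g φ - ⟨∇φ, ∇l⟩|²` at `x`, the norm being that of `γ` at `φ(x)`, computed in the charts
`e` and `e'`. -/
def solitonMapSq (g : RMetric n M) (γ : RMetric k N) (φ : M → N) (l : M → ℝ)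
    (e : OpenPartialHomeomorph M (EuclideanSpace ℝ (Fin n)))
    (e' : OpenPartialHomeomorph N (EuclideanSpace ℝ (Fin k))) (x : M) : ℝ :=
  ∑ a, ∑ b, metricIn γ e' (e' (φ x)) a b *
    (tensionIn g γ φ e e' x a
      - gradPairing (metricIn g e) (mapComp φ e e' a) (l ∘ e.symm) (e x)) *
    (tensionIn g γ φ e e' x b
      - gradPairing (metricIn g e) (mapComp φ e e' b) (l ∘ e.symm) (e x))

/-- `v = (4π(T-t))^{-n/2} e^{-l}`; `n` is the dimension. -/
def kernelOf (n : ℕ) (T : ℝ) (l : ℝ → M → ℝ) (t : ℝ) (x : M) : ℝ :=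
  (4 * Real.pi * (T - t)) ^ (-(n : ℝ) / 2) * Real.exp (-l t x)

/-- `w = ((T-t)(2Δl - |∇l|² + tr S) + l - n) v`. -/
def harnackOf (T : ℝ) (g : ℝ → RMetric n M) (γ : RMetric k N) (φ : ℝ → M → N) (α : ℝ → ℝ)
    (l : ℝ → M → ℝ) (t : ℝ) (x : M) : ℝ :=
  ((T - t) * (2 * laplacian (g t) (l t) x - gradSq (g t) (l t) x + traceS (g t) γ (φ t) (α t) x)
    + l t x - n) * kernelOf n T l t x

end Chart

end HarmonicRicci

end

open HarmonicRicci

/-! Write `w = P v`. Because `□^* v = 0` and `∇v = -v ∇l`, one has `□^*(P v) = -(∂ₜP + ΔP - 2⟨∇P,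
∇l⟩) v`, so only the bracket has to be computed. The equation for `v` reads `∂ₜl = -Δl + |∇l|² - Ŝ +
n/(2(T-t))`. Along `∂ₜg = -2S` and `∂ₜφ = τ`, the standard variation formulas give the derivatives
of `Δl`, `|∇l|²` and `Ŝ`, in particular `∂ₜŜ = ΔŜ + 2|S|² + 2α|τ|² - α̇|∇φ|²` (`map_d_tr_tensS`).
The contracted Bianchi identity (`D_scal`) and the divergence of `φ^*γ` (`two_mul_div2_pb`) give `2
div S = ∇Ŝ - 2α⟨τ, ∇φ⟩`, from which the cross term `⟨τ, ⟨∇φ, ∇l⟩⟩` arises. The Bochner formula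
(`bochner`) removes `Δ|∇l|²`. All terms of higher order then cancel, and what is left is a sum of
squares (`map_d_harnack`); the multiple of `g` inside the square comes from the trace term and
`n/(2(T-t))` (`pair2_sub_mul_g`).

These computations use only the product rule, commuting partial derivatives and the two properties
defining the Levi-Civita connection. They are therefore done over an abstract commutative ring with
commuting derivations, where time is one more derivation `d`. The ring used in the end consists of
the smooth functions on an open set of times and coordinates on which `φ` maps into one chart of
`N`.

Two points are not algebra. The coupling `α` is only differentiable, hence is no element of that
ring. It is replaced by its first order Taylor polynomial at the time considered; the flow equations
then hold only on that time slice, so the identities are stated after a ring homomorphism `ρ`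
restricting to the slice, and `deriv_harnackOf_eq` shows that `∂ₜw` does not see the replacement.
Moreover, `w` is defined pointwise through preferred charts, so its ingredients must be chart
independent. For `S` this follows from `S = -½ ∂ₜg` (`tensorSIn_change`), and for `Δl` from the
validity of the equation for `v` in every chart (`laplacian_eq`); no general invariance of the Ricci
tensor or the Hessian is needed. -/

namespace HarmonicRicci

/-! ### Tensor calculus over a ring with commuting derivations -/

/-- A metric `g` with inverse `gi` and Levi-Civita connection `Γ` over a ring `A` with commuting
derivations `D i`; the Christoffel symbol `Γᵏᵢⱼ` is `Γ i k j`. -/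
structure MetricCalculus (ι A : Type*) [Fintype ι] [DecidableEq ι] [CommRing A] [Algebra ℝ A] where
  D : ι → Derivation ℝ A A
  g : Matrix ι ι A
  gi : Matrix ι ι A
  Γ : ι → Matrix ι ι A
  D_comm : ∀ i j a, D i (D j a) = D j (D i a)
  g_symm : g.transpose = g
  gi_symm : gi.transpose = gi
  gi_mul_g : gi * g = 1
  Γ_symm : ∀ i j k, Γ i k j = Γ j k i
  compat : ∀ m, g.map (D m) = (Γ m).transpose * g + g * Γ m

section MatrixDerivation

variable {ι A : Type*} [CommRing A] [Algebra ℝ A]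

theorem matrix_map_mul [Fintype ι] (d : Derivation ℝ A A) (M N : Matrix ι ι A) :
    (M * N).map d = M.map d * N + M * N.map d := by
  ext i j
  simp only [Matrix.map_apply, Matrix.mul_apply, map_sum, Derivation.leibniz, smul_eq_mul,
    Matrix.add_apply, ← Finset.sum_add_distrib]
  exact Finset.sum_congr rfl fun k _ => by ring

theorem matrix_map_add (d : Derivation ℝ A A) (M N : Matrix ι ι A) :
    (M + N).map d = M.map d + N.map d := by
  ext i j; simp

theorem matrix_map_transpose (d : Derivation ℝ A A) (M : Matrix ι ι A) :
    M.transpose.map d = (M.map d).transpose := rfl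

theorem matrix_map_sub (d : Derivation ℝ A A) (M N : Matrix ι ι A) :
    (M - N).map d = M.map d - N.map d := by
  ext i j; simp

theorem matrix_map_one [DecidableEq ι] (d : Derivation ℝ A A) : (1 : Matrix ι ι A).map d = 0 := by
  ext i j
  by_cases h : i = j <;> simp [h]

end MatrixDerivation

namespace MetricCalculus

variable {ι A : Type*} [Fintype ι] [DecidableEq ι] [CommRing A] [Algebra ℝ A]
  (X : MetricCalculus ι A)

/-- The trace `gⁱʲ Tᵢⱼ`. -/
def tr (T : ι → ι → A) : A := ∑ i, ∑ j, X.gi i j * T i j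

/-- The covariant derivative `∇ₘ aᵢ` of a one-form. -/
def cov1 (a : ι → A) (m i : ι) : A := X.D m (a i) - ∑ k, X.Γ m k i * a k

/-- The covariant derivative `∇ₘ Tᵢⱼ` of a covariant 2-tensor. -/
def cov2 (T : ι → ι → A) (m i j : ι) : A :=
  X.D m (T i j) - ∑ k, X.Γ m k i * T k j - ∑ k, X.Γ m k j * T i k

/-- The covariant derivative of a covariant 3-tensor. -/
def cov3 (T : ι → ι → ι → A) (m p i j : ι) : A :=
  X.D m (T p i j) - ∑ k, X.Γ m k p * T k i j - ∑ k, X.Γ m k i * T p k j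
    - ∑ k, X.Γ m k j * T p i k

/-- The covariant derivative of a covariant 4-tensor. -/
def cov4 (T : ι → ι → ι → ι → A) (m p i k j : ι) : A :=
  X.D m (T p i k j) - ∑ s, X.Γ m s p * T s i k j - ∑ s, X.Γ m s i * T p s k j
    - ∑ s, X.Γ m s k * T p i s j - ∑ s, X.Γ m s j * T p i k s

/-- The Hessian. -/
def hess (f : A) : ι → ι → A := X.cov1 fun i => X.D i f

/-- The Laplacian. -/
def lap (f : A) : A := X.tr (X.hess f)

/-- The pairing of two one-forms. -/
def pair (a b : ι → A) : A := X.tr fun i j => a i * b j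

/-- The pairing `⟨S, T⟩ = gⁱᵏ gʲˡ Sᵢⱼ Tₖₗ`. -/
def pair2 (S T : ι → ι → A) : A := X.tr fun i k => X.tr fun j l => S i j * T k l

/-- The divergence of a one-form. -/
def div1 (a : ι → A) : A := X.tr (X.cov1 a)

/-- The divergence of a covariant 2-tensor. -/
def div2 (T : ι → ι → A) (j : ι) : A := X.tr fun m i => X.cov2 T m i j

variable {X}

theorem gi_comm (i j : ι) : X.gi i j = X.gi j i := congrFun (congrFun X.gi_symm j) i

theorem g_comm (i j : ι) : X.g i j = X.g j i := congrFun (congrFun X.g_symm j) i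

theorem g_mul_gi : X.g * X.gi = 1 := mul_eq_one_comm.mp X.gi_mul_g

theorem tr_add (S T : ι → ι → A) :
    X.tr (fun i j => S i j + T i j) = X.tr S + X.tr T := by
  simp only [tr, mul_add, Finset.sum_add_distrib]

theorem tr_sub (S T : ι → ι → A) :
    X.tr (fun i j => S i j - T i j) = X.tr S - X.tr T := by
  simp only [tr, mul_sub, Finset.sum_sub_distrib]

theorem tr_neg (T : ι → ι → A) : X.tr (fun i j => -T i j) = -X.tr T := by
  simp only [tr, mul_neg, Finset.sum_neg_distrib]

theorem tr_mul_left (c : A) (T : ι → ι → A) : X.tr (fun i j => c * T i j) = c * X.tr T := by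
  simp only [tr, Finset.mul_sum]
  exact Finset.sum_congr rfl fun i _ => Finset.sum_congr rfl fun j _ => by ring

theorem tr_mul_right (c : A) (T : ι → ι → A) : X.tr (fun i j => T i j * c) = X.tr T * c := by
  simp only [tr, Finset.sum_mul]
  exact Finset.sum_congr rfl fun i _ => Finset.sum_congr rfl fun j _ => by ring

theorem tr_sum {κ : Type*} (s : Finset κ) (T : κ → ι → ι → A) :
    X.tr (fun i j => ∑ k ∈ s, T k i j) = ∑ k ∈ s, X.tr (T k) := by
  simp only [tr, Finset.mul_sum]
  refine Eq.trans (Finset.sum_congr rfl fun i _ => Finset.sum_comm) ?_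
  exact Finset.sum_comm

theorem sum_mul_tr {κ : Type*} (s : Finset κ) (c : κ → A) (T : κ → ι → ι → A) :
    ∑ k ∈ s, c k * X.tr (T k) = X.tr (fun i j => ∑ k ∈ s, c k * T k i j) := by
  rw [tr_sum]
  exact Finset.sum_congr rfl fun k _ => (tr_mul_left _ _).symm

theorem tr_symm (T : ι → ι → A) : X.tr (fun i j => T j i) = X.tr T := by
  unfold tr
  rw [Finset.sum_comm]
  exact Finset.sum_congr rfl fun i _ => Finset.sum_congr rfl fun j _ => by rw [gi_comm]

theorem tr_tr (T : ι → ι → ι → ι → A) :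
    X.tr (fun i j => X.tr fun k l => T i j k l) = X.tr (fun k l => X.tr fun i j => T i j k l) := by
  conv_lhs => rw [tr]
  simp only [← tr_mul_left]
  simp only [← tr_sum]
  rfl

theorem tr_congr {S T : ι → ι → A} (h : ∀ i j, S i j = T i j) : X.tr S = X.tr T := by
  rw [show S = T from funext fun i => funext fun j => h i j]

/-- Differentiate `gi * g = 1` and solve for the derivative of `gi`, using metric compatibility. -/
theorem D_gi (m : ι) : X.gi.map (X.D m) = -(X.gi * (X.Γ m).transpose) - X.Γ m * X.gi := by
  have h := matrix_map_mul (X.D m) X.gi X.g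
  rw [X.gi_mul_g, matrix_map_one, X.compat] at h
  have h2 : X.gi.map (X.D m) * (X.g * X.gi) =
      -(X.gi * (X.Γ m).transpose * (X.g * X.gi)) - (X.gi * X.g) * X.Γ m * X.gi := by
    have := congrArg (· * X.gi) h
    simp only [zero_mul] at this
    rw [← sub_eq_zero, ← neg_eq_zero, ← neg_eq_zero, this]
    noncomm_ring
  simpa [g_mul_gi, X.gi_mul_g] using h2

theorem D_gi_apply (m i j : ι) : X.D m (X.gi i j) =
    -(∑ k, X.gi i k * X.Γ m j k) - ∑ k, X.Γ m i k * X.gi k j := by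
  simpa [Matrix.mul_apply] using congrFun (congrFun (X.D_gi m) i) j

theorem D_g_apply (m i j : ι) : X.D m (X.g i j) =
    ∑ k, X.Γ m k i * X.g k j + ∑ k, X.Γ m k j * X.g i k := by
  have := congrFun (congrFun (X.compat m) i) j
  simp only [Matrix.map_apply, Matrix.add_apply, Matrix.mul_apply, Matrix.transpose_apply] at this
  rw [this]
  congr 1
  exact Finset.sum_congr rfl fun k _ => mul_comm _ _

/-- The inverse metric is parallel: the two connection terms in `D_gi_apply` become, after
relabelling the summed indices, those of `cov2`. -/
theorem D_tr (m : ι) (T : ι → ι → A) : X.D m (X.tr T) = X.tr (X.cov2 T m) := by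
  have h1 : ∑ i, ∑ j, X.gi i j * ∑ k, X.Γ m k i * T k j
      = ∑ i, ∑ j, (∑ k, X.Γ m i k * X.gi k j) * T i j := by
    simp only [Finset.mul_sum, Finset.sum_mul]
    refine Eq.trans (Finset.sum_congr rfl fun i _ => Finset.sum_comm) ?_
    refine Eq.trans Finset.sum_comm ?_
    refine Eq.trans (Finset.sum_congr rfl fun i _ => Finset.sum_comm) ?_
    exact Finset.sum_congr rfl fun i _ => Finset.sum_congr rfl fun j _ =>
      Finset.sum_congr rfl fun k _ => by ring
  have h2 : ∑ i, ∑ j, X.gi i j * ∑ k, X.Γ m k j * T i k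
      = ∑ i, ∑ j, (∑ k, X.gi i k * X.Γ m j k) * T i j := by
    simp only [Finset.mul_sum, Finset.sum_mul]
    refine Finset.sum_congr rfl fun i _ => ?_
    refine Eq.trans Finset.sum_comm ?_
    exact Finset.sum_congr rfl fun j _ => Finset.sum_congr rfl fun k _ => by ring
  simp only [tr, cov2, mul_sub, Finset.sum_sub_distrib]
  rw [h1, h2]
  simp only [map_sum, Derivation.leibniz, smul_eq_mul, D_gi_apply, ← Finset.sum_sub_distrib]
  exact Finset.sum_congr rfl fun i _ => Finset.sum_congr rfl fun j _ => by ring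

theorem cov2_mul (a b : ι → A) (m i j : ι) :
    X.cov2 (fun i j => a i * b j) m i j = X.cov1 a m i * b j + a i * X.cov1 b m j := by
  simp only [cov2, cov1, Derivation.leibniz, smul_eq_mul, sub_mul, mul_sub, Finset.sum_mul,
    Finset.mul_sum, mul_assoc, mul_left_comm]
  ring

theorem D_pair (m : ι) (a b : ι → A) :
    X.D m (X.pair a b) = X.pair (X.cov1 a m) b + X.pair a (X.cov1 b m) := by
  simp only [pair, D_tr, ← tr_add]
  exact tr_congr fun i j => cov2_mul a b m i j

theorem cov1_tr (T : ι → ι → ι → A) (m p : ι) :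
    X.cov1 (fun p => X.tr (T p)) m p = X.tr fun i j => X.cov3 T m p i j := by
  simp only [cov1, D_tr, sum_mul_tr, ← tr_sub]
  exact tr_congr fun i j => by simp only [cov2, cov3]; ring

theorem cov2_tr (T : ι → ι → ι → ι → A) (m i j : ι) :
    X.cov2 (fun i j => X.tr fun p k => T p i k j) m i j =
      X.tr fun p k => X.cov4 T m p i k j := by
  simp only [cov2, D_tr, sum_mul_tr, ← tr_sub]
  exact tr_congr fun p k => by simp only [cov4]; ring

theorem cov3_mul (T : ι → ι → A) (a : ι → A) (m p i j : ι) :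
    X.cov3 (fun p i j => T p i * a j) m p i j =
      X.cov2 T m p i * a j + T p i * X.cov1 a m j := by
  simp only [cov3, cov2, cov1, Derivation.leibniz, smul_eq_mul, sub_mul, mul_sub, Finset.sum_mul,
    Finset.mul_sum, mul_assoc, mul_left_comm]
  ring

theorem cov2_symm {T : ι → ι → A} (h : ∀ i j, T i j = T j i) (m i j : ι) :
    X.cov2 T m i j = X.cov2 T m j i := by
  simp only [cov2, h i]
  rw [sub_right_comm]
  simp only [h j]

theorem hess_symm (f : A) (i j : ι) : X.hess f i j = X.hess f j i := by
  simp only [hess, cov1, X.D_comm i j, X.Γ_symm i j]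

/-- Contraction with the metric cancels the inverse metric. -/
theorem tr_g_mul (a : ι → A) (p : ι) : (X.tr fun i j => X.g p i * a j) = a p := by
  have h : ∀ j, ∑ i, X.g p i * X.gi i j = (1 : Matrix ι ι A) p j := fun j => by
    rw [← g_mul_gi (X := X), Matrix.mul_apply]
  unfold tr
  rw [Finset.sum_comm]
  have : ∀ j, ∑ i, X.gi i j * (X.g p i * a j) = (1 : Matrix ι ι A) p j * a j := fun j => by
    rw [← h, Finset.sum_mul]
    exact Finset.sum_congr rfl fun i _ => by ring
  simp [this, Matrix.one_apply]

/-- A contraction of an upper with a lower index, by lowering the upper one. -/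
theorem sum_mul_eq_tr (c a : ι → A) :
    ∑ k, c k * a k = X.tr fun p k => (∑ s, X.g p s * c s) * a k := by
  have h : ∀ k, ∑ p, X.gi p k * ∑ s, X.g p s * c s = c k := fun k => by
    simp only [Finset.mul_sum]
    rw [Finset.sum_comm]
    have : ∀ s, ∑ p, X.gi p k * (X.g p s * c s) = (1 : Matrix ι ι A) k s * c s := fun s => by
      rw [← X.gi_mul_g, Matrix.mul_apply, Finset.sum_mul]
      exact Finset.sum_congr rfl fun i _ => by rw [gi_comm]; ring
    simp [this, Matrix.one_apply]
  unfold tr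
  rw [Finset.sum_comm]
  refine Finset.sum_congr rfl fun k _ => ?_
  conv_lhs => rw [← h k, Finset.sum_mul]
  exact Finset.sum_congr rfl fun i _ => by ring

/-! ### Curvature -/

variable (X) in
/-- The curvature endomorphism of the plane spanned by `∂ₖ, ∂ⱼ`. -/
def curv (k j : ι) : Matrix ι ι A :=
  (X.Γ j).map (X.D k) - (X.Γ k).map (X.D j) + X.Γ k * X.Γ j - X.Γ j * X.Γ k

variable (X) in
/-- The curvature tensor with all indices lowered. -/
def rm (p i k j : ι) : A := (X.g * X.curv k j) p i

variable (X) in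
/-- The Ricci tensor. -/
def ric (i j : ι) : A := ∑ k, X.curv k j k i

theorem matrix_D_comm (M : Matrix ι ι A) (i j : ι) :
    (M.map (X.D j)).map (X.D i) = (M.map (X.D i)).map (X.D j) := by
  ext a b; simp [X.D_comm i j]

theorem curv_swap (k j : ι) : X.curv k j = -X.curv j k := by
  simp only [curv]; noncomm_ring

theorem rm_swap_right (p i k j : ι) : X.rm p i k j = -X.rm p i j k := by
  simp only [rm]; rw [curv_swap]; simp

/-- Expand `Dₖ Dⱼ g = Dⱼ Dₖ g` by metric compatibility. The second derivatives commute, and what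
remains is the skew-adjointness of the curvature endomorphism. -/
theorem g_mul_curv_transpose (k j : ι) :
    (X.curv k j).transpose * X.g + X.g * X.curv k j = 0 := by
  have h := matrix_D_comm (X := X) X.g k j
  rw [X.compat, X.compat] at h
  simp only [matrix_map_add, matrix_map_mul, X.compat, matrix_map_transpose] at h
  rw [← sub_eq_zero] at h
  rw [← h]
  simp only [curv, Matrix.transpose_add, Matrix.transpose_sub, Matrix.transpose_mul]
  noncomm_ring

theorem rm_swap_left (p i k j : ι) : X.rm p i k j = -X.rm i p k j := by
  have h := congrFun (congrFun (X.g_mul_curv_transpose k j) p) i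
  have h2 : ((X.curv k j).transpose * X.g) p i = (X.g * X.curv k j) i p := by
    conv_lhs => rw [← X.g_symm, ← Matrix.transpose_mul, Matrix.transpose_apply]
  rw [Matrix.add_apply, h2] at h
  simp only [Matrix.zero_apply] at h
  simp only [rm]
  linear_combination h

/-- Turns the contraction of an upper with a lower index into a metric trace, so that covariant
differentiation can pass through it. -/
theorem ric_eq_tr (i j : ι) : X.ric i j = X.tr fun p k => X.rm p i k j := by
  have h : ∀ k, X.curv k j k i = ∑ p, X.gi p k * X.rm p i k j := fun k => by
    have : X.curv k j = X.gi * (X.g * X.curv k j) := by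
      rw [← Matrix.mul_assoc, X.gi_mul_g, Matrix.one_mul]
    conv_lhs => rw [this, Matrix.mul_apply]
    exact Finset.sum_congr rfl fun p _ => by rw [gi_comm]; rfl
  unfold ric tr
  rw [Finset.sum_comm]
  exact Finset.sum_congr rfl fun k _ => h k

/-- This is the Jacobi identity for the operators `Dᵢ + Γᵢ`. The derivative acts on the endomorphism
indices only, so the symmetry of `Γ` plays no role yet. -/
theorem curv_bianchi (m k j : ι) :
    ((X.curv k j).map (X.D m) + X.Γ m * X.curv k j - X.curv k j * X.Γ m)
    + ((X.curv j m).map (X.D k) + X.Γ k * X.curv j m - X.curv j m * X.Γ k)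
    + ((X.curv m k).map (X.D j) + X.Γ j * X.curv m k - X.curv m k * X.Γ j) = 0 := by
  simp only [curv, matrix_map_add, matrix_map_sub, matrix_map_mul]
  rw [matrix_D_comm (X.Γ j) m k, matrix_D_comm (X.Γ k) m j, matrix_D_comm (X.Γ m) k j]
  noncomm_ring

theorem g_mul_cov (M : Matrix ι ι A) (m : ι) :
    X.g * (M.map (X.D m) + X.Γ m * M - M * X.Γ m) =
      (X.g * M).map (X.D m) - (X.Γ m).transpose * (X.g * M) - (X.g * M) * X.Γ m := by
  rw [matrix_map_mul, X.compat]; noncomm_ring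

theorem cov4_rm (m p i k j : ι) : X.cov4 X.rm m p i k j =
    (X.g * ((X.curv k j).map (X.D m) + X.Γ m * X.curv k j - X.curv k j * X.Γ m)) p i
      - ∑ s, X.Γ m s k * X.rm p i s j - ∑ s, X.Γ m s j * X.rm p i k s := by
  rw [g_mul_cov]
  simp only [cov4, Matrix.sub_apply, Matrix.map_apply]
  rw [Matrix.mul_apply, Matrix.mul_apply (M := X.g * X.curv k j)]
  have : ∑ s, X.Γ m s i * X.rm p s k j = ∑ s, (X.g * X.curv k j) p s * X.Γ m s i :=
    Finset.sum_congr rfl fun s _ => mul_comm _ _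
  rw [this]
  rfl

/-- Compared with `curv_bianchi`, the full covariant derivative has extra connection terms on the
last two indices. In the cyclic sum they cancel in pairs, since `Γ` is symmetric and the curvature
is antisymmetric in these indices. -/
theorem rm_bianchi (m p i k j : ι) :
    X.cov4 X.rm m p i k j + X.cov4 X.rm k p i j m + X.cov4 X.rm j p i m k = 0 := by
  have h : (X.g * (((X.curv k j).map (X.D m) + X.Γ m * X.curv k j - X.curv k j * X.Γ m)
    + ((X.curv j m).map (X.D k) + X.Γ k * X.curv j m - X.curv j m * X.Γ k)
    + ((X.curv m k).map (X.D j) + X.Γ j * X.curv m k - X.curv m k * X.Γ j))) p i = 0 := by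
    rw [curv_bianchi, Matrix.mul_zero, Matrix.zero_apply]
  rw [cov4_rm, cov4_rm, cov4_rm]
  have e1 : ∀ s, X.rm p i j s = -X.rm p i s j := fun s => rm_swap_right p i j s
  have e2 : ∀ s, X.rm p i m s = -X.rm p i s m := fun s => rm_swap_right p i m s
  have e3 : ∀ s, X.rm p i k s = -X.rm p i s k := fun s => rm_swap_right p i k s
  have g1 : ∀ s, X.Γ k s m = X.Γ m s k := fun s => X.Γ_symm _ _ _
  have g2 : ∀ s, X.Γ j s m = X.Γ m s j := fun s => X.Γ_symm _ _ _
  have g3 : ∀ s, X.Γ j s k = X.Γ k s j := fun s => X.Γ_symm _ _ _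
  simp only [e1, e2, e3, g1, g2, g3, mul_neg, Finset.sum_neg_distrib, Matrix.mul_add,
    Matrix.mul_sub, Matrix.add_apply, Matrix.sub_apply] at h ⊢
  linear_combination h

theorem cov4_rm_swap_left (m p i k j : ι) : X.cov4 X.rm m p i k j = -X.cov4 X.rm m i p k j := by
  have e : X.rm = fun p i k j => -X.rm i p k j := by
    funext p i k j; exact rm_swap_left p i k j
  conv_lhs => rw [e]
  simp only [cov4, map_neg, mul_neg, Finset.sum_neg_distrib]
  ring

theorem cov4_rm_swap_right (m p i k j : ι) : X.cov4 X.rm m p i k j = -X.cov4 X.rm m p i j k := by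
  have e : X.rm = fun p i k j => -X.rm p i j k := by
    funext p i k j; exact rm_swap_right p i k j
  conv_lhs => rw [e]
  simp only [cov4, map_neg, mul_neg, Finset.sum_neg_distrib]
  ring

theorem cov2_ric (m i j : ι) : X.cov2 X.ric m i j = X.tr fun p k => X.cov4 X.rm m p i k j := by
  rw [← cov2_tr]
  congr 1
  funext i j; exact ric_eq_tr i j

/-- The contracted second Bianchi identity `∇_m R = 2 ∇ⁱ Rᵢₘ`. -/
theorem D_scal (m : ι) : X.D m (X.tr X.ric) = 2 * X.div2 X.ric m := by
  have h1 : X.D m (X.tr X.ric) = X.tr fun i j => X.tr fun p k => X.cov4 X.rm m p i k j := by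
    rw [D_tr]; exact tr_congr fun i j => cov2_ric m i j
  -- The other two terms of the Bianchi sum each contract to minus the divergence of Ricci: one by
  -- antisymmetry in the first pair of indices, the other by antisymmetry in the last pair.
  have h2 : X.div2 X.ric m = X.tr fun i j => X.tr fun p k => -X.cov4 X.rm k p i j m := by
    rw [tr_tr, div2, ← tr_symm]
    refine tr_congr fun p k => ?_
    rw [cov2_ric]
    exact tr_congr fun i j => by rw [cov4_rm_swap_left]
  have h3 : X.div2 X.ric m = X.tr fun i j => X.tr fun p k => -X.cov4 X.rm j p i m k := by
    rw [div2, ← tr_symm]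
    refine tr_congr fun i j => ?_
    rw [cov2_ric]
    exact tr_congr fun p k => by rw [cov4_rm_swap_right]
  rw [two_mul]
  nth_rewrite 1 [h2]
  rw [h3, h1, ← tr_add]
  refine tr_congr fun i j => ?_
  rw [← tr_add]
  exact tr_congr fun p k => by linear_combination X.rm_bianchi m p i k j

end MetricCalculus
namespace MetricCalculus

variable {ι A : Type*} [Fintype ι] [DecidableEq ι] [CommRing A] [Algebra ℝ A]
  {X : MetricCalculus ι A}

/-! ### The Bochner formula -/

/-- The Ricci identity for one-forms. The connection terms on the derivative index agree by symmetry
of `Γ`; the remaining ones assemble into the curvature. -/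
theorem cov1_comm (a : ι → A) (l i k : ι) :
    X.cov2 (X.cov1 a) l i k - X.cov2 (X.cov1 a) i l k = -∑ p, X.curv l i p k * a p := by
  have h1 : ∑ s, X.Γ l s i * X.cov1 a s k = ∑ s, X.Γ i s l * X.cov1 a s k :=
    Finset.sum_congr rfl fun s _ => by rw [X.Γ_symm]
  have h2 : ∀ l i, ∑ s, X.Γ l s k * X.cov1 a i s =
      ∑ s, X.Γ l s k * X.D i (a s) - ∑ p, (X.Γ i * X.Γ l) p k * a p := fun l i => by
    simp only [cov1, mul_sub, Finset.sum_sub_distrib, Finset.mul_sum, Matrix.mul_apply,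
      Finset.sum_mul]
    congr 1
    refine Eq.trans Finset.sum_comm ?_
    exact Finset.sum_congr rfl fun s _ => Finset.sum_congr rfl fun r _ => by ring
  have h3 : ∀ l i, X.D l (X.cov1 a i k) = X.D l (X.D i (a k)) -
      (∑ s, X.Γ i s k * X.D l (a s) + ∑ s, X.D l (X.Γ i s k) * a s) := fun l i => by
    simp only [cov1, map_sub, map_sum, Derivation.leibniz, smul_eq_mul, Finset.sum_add_distrib]
    congr 2
    exact Finset.sum_congr rfl fun s _ => mul_comm _ _
  simp only [cov2]
  rw [h1, h2, h2, h3, h3, X.D_comm l i]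
  simp only [curv, Matrix.add_apply, Matrix.sub_apply, Matrix.map_apply, add_mul, sub_mul,
    Finset.sum_add_distrib, Finset.sum_sub_distrib]
  ring

/-- Symmetry of the Hessian and the Ricci identity bring the free index to the outside, where the
trace gives the Laplacian; the commutator contracts to the Ricci tensor. -/
theorem tr_cov2_hess (f : A) (i : ι) : (X.tr fun l k => X.cov2 (X.hess f) l k i) =
    X.D i (X.lap f) + X.pair (fun p => X.ric p i) fun p => X.D p f := by
  have h1 : ∀ l k, X.cov2 (X.hess f) l k i = X.cov2 (X.hess f) i l k
      + X.tr fun p q => X.rm k p l i * X.D q f := fun l k => by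
    rw [cov2_symm (hess_symm f)]
    have h := X.cov1_comm (fun i => X.D i f) l i k
    rw [sum_mul_eq_tr (X := X), ← tr_neg] at h
    have h2 : ∀ p q, X.rm k p l i * X.D q f = -((∑ s, X.g p s * X.curv l i s k) * X.D q f) :=
      fun p q => by
        rw [rm_swap_left, rm, Matrix.mul_apply, neg_mul]
    simp only [h2]
    rw [← h]
    simp only [hess]
    ring
  simp only [h1]
  rw [tr_add, lap, D_tr, tr_tr]
  congr 1
  refine tr_congr fun p q => ?_
  rw [tr_mul_right, ← tr_symm]
  simp only [ric_eq_tr]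

/-- `∇|∇f|²` is twice the Hessian applied to `∇f`. Taking its divergence produces `|Hess f|²` and
the divergence of the Hessian paired with `∇f`, which `tr_cov2_hess` evaluates. -/
theorem bochner (f : A) : X.lap (X.pair (fun i => X.D i f) fun i => X.D i f) =
    2 * X.pair2 (X.hess f) (X.hess f) + 2 * X.pair (fun i => X.D i f) (fun i => X.D i (X.lap f))
      + 2 * X.tr fun i j => X.tr fun p q => X.ric p i * X.D q f * X.D j f := by
  set a : ι → A := fun i => X.D i f with ha
  set F := X.hess f with hF
  have hb : ∀ k, X.D k (X.pair a a) = 2 * X.tr fun i j => F k i * a j := fun k => by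
    rw [D_pair, two_mul]
    congr 1
    rw [pair, ← tr_symm]
    exact tr_congr fun i j => mul_comm _ _
  have h1 : X.lap (X.pair a a) =
      2 * X.tr fun l k => X.cov1 (fun k => X.tr fun i j => F k i * a j) l k := by
    rw [lap, ← tr_mul_left]
    refine tr_congr fun l k => ?_
    simp only [hess, hb, cov1, Derivation.leibniz, smul_eq_mul, mul_sub, Finset.mul_sum,
      mul_left_comm _ (2 : A)]
    have : X.D l 2 = 0 := by
      have := (X.D l).map_natCast 2
      simpa using this
    rw [this]; ring
  have h2 : ∀ l k, X.cov1 (fun k => X.tr fun i j => F k i * a j) l k =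
      (X.tr fun i j => X.cov2 F l k i * a j) + X.tr fun i j => F k i * F l j := fun l k => by
    rw [cov1_tr, ← tr_add]
    exact tr_congr fun i j => cov3_mul F a l k i j
  have h3 : (X.tr fun l k => X.tr fun i j => F k i * F l j) = X.pair2 F F := by
    rw [← tr_symm]
    rfl
  have h4 : (X.tr fun l k => X.tr fun i j => X.cov2 F l k i * a j) =
      X.pair a (fun i => X.D i (X.lap f))
        + X.tr fun i j => X.tr fun p q => X.ric p i * X.D q f * X.D j f := by
    rw [tr_tr, pair, ← tr_symm (fun i j => a i * _), ← tr_add]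
    refine tr_congr fun i j => ?_
    rw [tr_mul_right, tr_cov2_hess, tr_mul_right, pair]
    ring
  rw [h1]
  simp only [h2]
  rw [tr_add, h3, h4]
  ring

/-! ### Variation of the metric -/

section Variation

variable (X) in
/-- The variation of the Christoffel symbols along the derivation `d`, with the upper index
lowered. -/
def dΓ (d : Derivation ℝ A A) (p i j : ι) : A := (X.g * (X.Γ i).map d) p j

variable {d : Derivation ℝ A A}

theorem dΓ_symm (p i j : ι) : X.dΓ d p i j = X.dΓ d p j i := by
  simp only [dΓ, Matrix.mul_apply, Matrix.map_apply]
  exact Finset.sum_congr rfl fun k _ => by rw [X.Γ_symm]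

theorem d_gi : X.gi.map d = -(X.gi * X.g.map d * X.gi) := by
  have h := matrix_map_mul d X.gi X.g
  rw [X.gi_mul_g, matrix_map_one] at h
  have h2 : X.gi.map d * (X.g * X.gi) = -(X.gi * X.g.map d * X.gi) := by
    have := congrArg (· * X.gi) h
    simp only [zero_mul] at this
    rw [← sub_eq_zero, ← neg_eq_zero, ← neg_eq_zero, this]
    noncomm_ring
  simpa [g_mul_gi] using h2

/-- The correction term comes from the inverse metric, whose variation is `-g⁻¹ (dg) g⁻¹`. -/
theorem d_tr (T : ι → ι → A) : d (X.tr T) =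
    (X.tr fun i j => d (T i j)) - X.pair2 (fun i j => d (X.g i j)) T := by
  have h : ∀ k l, d (X.gi k l) = -∑ j, (∑ i, X.gi i k * d (X.g i j)) * X.gi j l := fun k l => by
    have := congrFun (congrFun (X.d_gi (d := d)) k) l
    simp only [Matrix.map_apply, Matrix.neg_apply, Matrix.mul_apply] at this
    rw [this]
    congr 1
    exact Finset.sum_congr rfl fun j _ => by
      congr 1
      exact Finset.sum_congr rfl fun i _ => by rw [gi_comm]
  have h2 : X.pair2 (fun i j => d (X.g i j)) T = ∑ k, ∑ l, -d (X.gi k l) * T k l := by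
    simp only [h, pair2, tr, neg_neg, Finset.mul_sum, Finset.sum_mul]
    rw [Finset.sum_comm]
    refine Finset.sum_congr rfl fun k _ => ?_
    refine Eq.trans (Finset.sum_congr rfl fun i _ => Finset.sum_comm) ?_
    refine Eq.trans Finset.sum_comm ?_
    refine Finset.sum_congr rfl fun l _ => ?_
    refine Eq.trans Finset.sum_comm ?_
    exact Finset.sum_congr rfl fun j _ => Finset.sum_congr rfl fun i _ => by ring
  rw [h2]
  simp only [tr, map_sum, Derivation.leibniz, smul_eq_mul, ← Finset.sum_sub_distrib]
  exact Finset.sum_congr rfl fun i _ => Finset.sum_congr rfl fun j _ => by ring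

theorem d_pair (a b : ι → A) : d (X.pair a b) =
    X.pair (fun i => d (a i)) b + X.pair a (fun i => d (b i))
      - X.pair2 (fun i j => d (X.g i j)) (fun i j => a i * b j) := by
  simp only [pair]
  rw [d_tr, ← tr_add]
  congr 1
  exact tr_congr fun i j => by simp only [Derivation.leibniz, smul_eq_mul]; ring


theorem matrix_d_comm (hd : ∀ i a, d (X.D i a) = X.D i (d a))
    (M : Matrix ι ι A) (m : ι) :
    (M.map (X.D m)).map d = (M.map d).map (X.D m) := by
  ext i j; simp [hd]

/-- Linearise metric compatibility: apply `d` to it and commute `d` past the spatial derivatives. -/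
theorem cov2_dg (hd : ∀ i a, d (X.D i a) = X.D i (d a))
    (m i j : ι) : X.cov2 (fun i j => d (X.g i j)) m i j =
    X.dΓ d j m i + X.dΓ d i m j := by
  have h := matrix_d_comm hd X.g m
  rw [X.compat, matrix_map_add, matrix_map_mul, matrix_map_mul, matrix_map_transpose] at h
  have h' := congrFun (congrFun h i) j
  have e : (((X.Γ m).map d).transpose * X.g) i j = X.dΓ d j m i := by
    conv_lhs => rw [← X.g_symm, ← Matrix.transpose_mul, Matrix.transpose_apply]
    rfl
  simp only [Matrix.add_apply] at h'
  rw [e] at h'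
  have e2 : ((X.Γ m).transpose * X.g.map d) i j = ∑ k, X.Γ m k i * d (X.g k j) := by
    rw [Matrix.mul_apply]; rfl
  have e3 : (X.g.map d * X.Γ m) i j = ∑ k, X.Γ m k j * d (X.g i k) := by
    rw [Matrix.mul_apply]
    exact Finset.sum_congr rfl fun k _ => mul_comm _ _
  rw [e2, e3] at h'
  simp only [cov2, dΓ]
  simp only [Matrix.map_apply, dΓ] at h'
  linear_combination -h'

/-- Koszul's permutation trick applied to `cov2_dg`: the variation of the connection is symmetric in
its two lower indices, so all but one of the terms cancel. -/
theorem two_mul_dΓ (hd : ∀ i a, d (X.D i a) = X.D i (d a))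
    (p i j : ι) : 2 * X.dΓ d p i j =
    X.cov2 (fun i j => d (X.g i j)) i j p + X.cov2 (fun i j => d (X.g i j)) j i p
      - X.cov2 (fun i j => d (X.g i j)) p i j := by
  rw [cov2_dg hd, cov2_dg hd, cov2_dg hd, X.dΓ_symm j p i, X.dΓ_symm i p j, X.dΓ_symm p j i]
  ring

theorem two_mul_tr_dΓ (hd : ∀ i a, d (X.D i a) = X.D i (d a))
    (p : ι) : 2 * (X.tr fun i j => X.dΓ d p i j) =
    2 * X.div2 (fun i j => d (X.g i j)) p - X.D p (X.tr fun i j => d (X.g i j)) := by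
  rw [D_tr, ← tr_mul_left, two_mul, div2]
  nth_rewrite 2 [← tr_symm]
  rw [← tr_add, ← tr_sub]
  exact tr_congr fun i j => by rw [two_mul_dΓ hd]; ring

theorem two_mul_tr_dΓ' (hd : ∀ i a, d (X.D i a) = X.D i (d a))
    (i : ι) : 2 * (X.tr fun p k => X.dΓ d p k i) =
    X.D i (X.tr fun i j => d (X.g i j)) := by
  rw [D_tr, two_mul]
  nth_rewrite 2 [← tr_symm]
  rw [← tr_add]
  refine tr_congr fun p k => ?_
  rw [cov2_dg hd, X.dΓ_symm p k, X.dΓ_symm k p]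
  ring

/-- The Laplacian depends on the metric in two ways: through the inverse metric in the trace and
through the Christoffel symbols in the Hessian. Each gives one correction. -/
theorem d_lap (hd : ∀ i a, d (X.D i a) = X.D i (d a))
    (f : A) : d (X.lap f) = X.lap (d f)
    - X.pair2 (fun i j => d (X.g i j)) (X.hess f)
    - X.pair (fun p => X.tr fun i j => X.dΓ d p i j) fun k => X.D k f := by
  have h : ∀ i j, d (X.hess f i j) =
      X.hess (d f) i j - X.tr fun p k => X.dΓ d p i j * X.D k f := fun i j => by
    have e : (X.tr fun p k => X.dΓ d p i j * X.D k f) = ∑ k, d (X.Γ i k j) * X.D k f := by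
      rw [sum_mul_eq_tr (X := X)]
      exact tr_congr fun p k => by rw [dΓ, Matrix.mul_apply]; rfl
    rw [e]
    simp only [hess, cov1, map_sub, map_sum, Derivation.leibniz, smul_eq_mul, hd,
      Finset.sum_add_distrib]
    simp only [mul_comm (X.D _ f)]
    ring
  rw [lap, d_tr]
  simp only [h]
  rw [tr_sub, tr_tr]
  simp only [tr_mul_right]
  rw [lap, pair]
  ring

/-- Palatini's identity: the variation of the connection is a tensor, and the curvature varies by
its antisymmetrised covariant derivative. -/
theorem d_curv (hd : ∀ i a, d (X.D i a) = X.D i (d a))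
    (p i k j : ι) : (X.g * (X.curv k j).map d) p i =
    X.cov3 (X.dΓ d) k p j i - X.cov3 (X.dΓ d) j p k i := by
  have h : (X.curv k j).map d =
      (((X.Γ j).map d).map (X.D k) + X.Γ k * (X.Γ j).map d - (X.Γ j).map d * X.Γ k)
      - (((X.Γ k).map d).map (X.D j) + X.Γ j * (X.Γ k).map d - (X.Γ k).map d * X.Γ j) := by
    simp only [curv, matrix_map_add, matrix_map_sub, matrix_map_mul, matrix_d_comm hd]
    noncomm_ring
  rw [h, Matrix.mul_sub, g_mul_cov, g_mul_cov]
  have e : ∀ (M : Matrix ι ι A) (m : ι),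
      ((X.g * M).map (X.D m) - (X.Γ m).transpose * (X.g * M) - (X.g * M) * X.Γ m) p i =
      X.D m ((X.g * M) p i) - ∑ s, X.Γ m s p * (X.g * M) s i - ∑ s, X.Γ m s i * (X.g * M) p s :=
    fun M m => by
      simp only [Matrix.sub_apply, Matrix.map_apply]
      rw [Matrix.mul_apply (M := (X.Γ m).transpose), Matrix.mul_apply (M := X.g * M)]
      congr 1
      exact Finset.sum_congr rfl fun k _ => mul_comm _ _
  rw [Matrix.sub_apply, e, e]
  -- The connection terms on the antisymmetrised indices, present in `cov3` but not in the
  -- endomorphism derivative, cancel by symmetry of `Γ`.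
  have e2 : ∑ s, X.Γ k s j * X.dΓ d p s i = ∑ s, X.Γ j s k * X.dΓ d p s i :=
    Finset.sum_congr rfl fun s _ => by rw [X.Γ_symm]
  simp only [cov3]
  rw [e2]
  simp only [dΓ]
  ring

theorem d_ric (hd : ∀ i a, d (X.D i a) = X.D i (d a))
    (i j : ι) : d (X.ric i j) = X.tr fun p k =>
    X.cov3 (X.dΓ d) k p j i - X.cov3 (X.dΓ d) j p k i := by
  have h : ∀ k, d (X.curv k j k i) = ∑ p, X.gi p k * (X.g * (X.curv k j).map d) p i := fun k => by
    have : (X.curv k j).map d = X.gi * (X.g * (X.curv k j).map d) := by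
      rw [← Matrix.mul_assoc, X.gi_mul_g, Matrix.one_mul]
    have h' := congrFun (congrFun this k) i
    rw [Matrix.mul_apply] at h'
    refine Eq.trans h' (Finset.sum_congr rfl fun p _ => by rw [gi_comm])
  simp only [← d_curv hd]
  unfold ric tr
  rw [map_sum, Finset.sum_comm]
  exact Finset.sum_congr rfl fun k _ => h k

/-- Contracting Palatini's identity leaves the divergences of the two traces of the varied
connection; the variation of the inverse metric adds the pairing with Ricci. The factor 2 avoids
halves in the ring. -/
theorem two_mul_d_scal (hd : ∀ i a, d (X.D i a) = X.D i (d a)) :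
    2 * d (X.tr X.ric) =
    2 * X.div1 (X.div2 fun i j => d (X.g i j)) - 2 * X.lap (X.tr fun i j => d (X.g i j))
      - 2 * X.pair2 (fun i j => d (X.g i j)) X.ric := by
  have two : ∀ m, X.D m 2 = 0 := fun m => by simpa using (X.D m).map_natCast 2
  have h1 : (X.tr fun i j => d (X.ric i j)) =
      (X.div1 fun p => X.tr fun i j => X.dΓ d p i j)
      - X.div1 fun i => X.tr fun p k => X.dΓ d p k i := by
    simp only [d_ric hd, tr_sub]
    congr 1
    · rw [tr_tr, div1, ← tr_symm]
      refine tr_congr fun k p => ?_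
      rw [cov1_tr, ← tr_symm]
    · rw [div1, ← tr_symm]
      refine tr_congr fun j i => ?_
      rw [cov1_tr]
      exact tr_congr fun p k => by simp only [cov3]; ring
  have hdiv : ∀ a : ι → A, 2 * X.div1 a = X.div1 fun i => 2 * a i := fun a => by
    rw [div1, ← tr_mul_left]
    refine tr_congr fun i j => ?_
    simp only [cov1, Derivation.leibniz, smul_eq_mul, two, mul_sub, Finset.mul_sum,
      mul_left_comm _ (2 : A)]
    ring
  have hdiv2 : ∀ a b : ι → A, (X.div1 fun i => a i - b i) = X.div1 a - X.div1 b := fun a b => by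
    simp only [div1, ← tr_sub]
    refine tr_congr fun i j => ?_
    simp only [cov1, map_sub, mul_sub, Finset.sum_sub_distrib]
    ring
  rw [d_tr, h1, mul_sub, mul_sub, hdiv, hdiv]
  simp only [two_mul_tr_dΓ hd, two_mul_tr_dΓ' hd, hdiv2, ← hdiv]
  rw [show (X.div1 fun i => X.D i (X.tr fun i j => d (X.g i j)))
    = X.lap (X.tr fun i j => d (X.g i j)) from rfl]
  ring

end Variation

end MetricCalculus
-- Vector fields along a map and the pulled back connection
/-- The data over `A` of a map into a Riemannian manifold: the components `φ` of the map, and the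
components `H` of the target metric and `ΓN a b c` of its Christoffel symbols along the map. -/
structure MapCalculus (κ A : Type*) [Fintype κ] [CommRing A] [Algebra ℝ A] where
  φ : κ → A
  H : κ → κ → A
  ΓN : κ → κ → κ → A
  H_symm : ∀ a b, H a b = H b a
  ΓN_symm : ∀ a b c, ΓN a b c = ΓN a c b

namespace MapCalculus

variable {κ A : Type*} [Fintype κ] [CommRing A] [Algebra ℝ A] (Y : MapCalculus κ A)

/-- The target metric is parallel along the derivation `d`. -/
def IsCompat (d : Derivation ℝ A A) : Prop := ∀ a b, d (Y.H a b) =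
  ∑ c, d (Y.φ c) * (∑ e, Y.ΓN e c a * Y.H e b + ∑ e, Y.ΓN e c b * Y.H a e)

/-- The inner product of two vector fields along the map. -/
def ip (V W : κ → A) : A := ∑ a, ∑ b, Y.H a b * V a * W b

/-- The pulled back covariant derivative of a vector field along the map. -/
def nab (d : Derivation ℝ A A) (V : κ → A) (a : κ) : A :=
  d (V a) + ∑ b, ∑ c, Y.ΓN a b c * (d (Y.φ b) * V c)

variable {Y}

theorem ip_comm (V W : κ → A) : Y.ip V W = Y.ip W V := by
  unfold ip
  rw [Finset.sum_comm]
  exact Finset.sum_congr rfl fun a _ => Finset.sum_congr rfl fun b _ => by rw [Y.H_symm]; ring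

theorem ip_add_left (V V' W : κ → A) :
    Y.ip (fun a => V a + V' a) W = Y.ip V W + Y.ip V' W := by
  simp only [ip, mul_add, add_mul, Finset.sum_add_distrib]

theorem ip_sub_left (V V' W : κ → A) :
    Y.ip (fun a => V a - V' a) W = Y.ip V W - Y.ip V' W := by
  simp only [ip, mul_sub, sub_mul, Finset.sum_sub_distrib]

theorem ip_sub_right (V W W' : κ → A) :
    Y.ip V (fun a => W a - W' a) = Y.ip V W - Y.ip V W' := by
  simp only [ip, mul_sub, Finset.sum_sub_distrib]

theorem ip_sum_left {ι : Type*} [Fintype ι] (c : ι → A) (V : ι → κ → A) (W : κ → A) :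
    Y.ip (fun a => ∑ i, c i * V i a) W = ∑ i, c i * Y.ip (V i) W := by
  simp only [ip, Finset.mul_sum, Finset.sum_mul]
  refine Eq.trans (Finset.sum_congr rfl fun a _ => Finset.sum_comm) ?_
  refine Eq.trans Finset.sum_comm ?_
  exact Finset.sum_congr rfl fun i _ => Finset.sum_congr rfl fun a _ =>
    Finset.sum_congr rfl fun b _ => by ring

/-- The pulled back connection is metric: its matrix `G` along `d` also governs the derivative of
the target metric, by `IsCompat`. -/
theorem d_ip {d : Derivation ℝ A A} (hd : Y.IsCompat d) (V W : κ → A) :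
    d (Y.ip V W) = Y.ip (Y.nab d V) W + Y.ip V (Y.nab d W) := by
  set G : κ → κ → A := fun a c => ∑ b, Y.ΓN a b c * d (Y.φ b) with hG
  have hnab : ∀ V : κ → A, Y.nab d V = fun a => d (V a) + ∑ c, G a c * V c := fun V => by
    funext a
    simp only [nab, hG, Finset.sum_mul]
    rw [Finset.sum_comm]
    simp only [mul_assoc]
  have hH : ∀ a b, d (Y.H a b) = ∑ e, G e a * Y.H e b + ∑ e, G e b * Y.H a e := fun a b => by
    rw [hd a b]
    simp only [hG, Finset.sum_mul, mul_add, Finset.mul_sum, Finset.sum_add_distrib]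
    congr 1 <;>
    · rw [Finset.sum_comm]
      exact Finset.sum_congr rfl fun e _ => Finset.sum_congr rfl fun c _ => by ring
  have h1 : ∀ V W : κ → A, ∑ a, ∑ b, (∑ e, G e a * Y.H e b) * V a * W b =
      ∑ a, ∑ b, Y.H a b * (∑ c, G a c * V c) * W b := fun V W => by
    simp only [Finset.mul_sum, Finset.sum_mul]
    refine Eq.trans (Finset.sum_congr rfl fun a _ => Finset.sum_comm) ?_
    refine Eq.trans Finset.sum_comm ?_
    refine Eq.trans (Finset.sum_congr rfl fun a _ => Finset.sum_comm) ?_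
    exact Finset.sum_congr rfl fun i _ => Finset.sum_congr rfl fun a _ =>
      Finset.sum_congr rfl fun b _ => by ring
  have h2 : ∑ a, ∑ b, (∑ e, G e b * Y.H a e) * V a * W b =
      ∑ a, ∑ b, Y.H a b * V a * (∑ c, G b c * W c) := by
    simp only [Finset.mul_sum, Finset.sum_mul]
    refine Finset.sum_congr rfl fun a _ => ?_
    rw [Finset.sum_comm]
    exact Finset.sum_congr rfl fun a _ => Finset.sum_congr rfl fun b _ => by ring
  simp only [hnab, ip, mul_add, add_mul, Finset.sum_add_distrib, map_sum, Derivation.leibniz,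
    smul_eq_mul]
  rw [← h1, ← h2]
  simp only [← Finset.sum_add_distrib]
  exact Finset.sum_congr rfl fun a _ => Finset.sum_congr rfl fun b _ => by rw [hH]; ring

end MapCalculus

/-! ### Pullback metric, second fundamental form and tension field -/

namespace MetricCalculus

variable {ι κ A : Type*} [Fintype ι] [DecidableEq ι] [Fintype κ] [CommRing A] [Algebra ℝ A]
  (X : MetricCalculus ι A) (Y : MapCalculus κ A)

/-- The pullback of the target metric. -/
def pb (i j : ι) : A := Y.ip (fun a => X.D i (Y.φ a)) fun a => X.D j (Y.φ a)

/-- The second fundamental form of the map. -/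
def sff (i j : ι) (a : κ) : A :=
  X.hess (Y.φ a) i j + ∑ b, ∑ c, Y.ΓN a b c * (X.D i (Y.φ b) * X.D j (Y.φ c))

/-- The tension field of the map. -/
def tens (a : κ) : A := X.lap (Y.φ a) +
  ∑ b, ∑ c, Y.ΓN a b c * X.pair (fun i => X.D i (Y.φ b)) fun i => X.D i (Y.φ c)

/-- The one-form `⟨V, ∇φ⟩`. -/
def along (V : κ → A) (i : ι) : A := Y.ip V fun a => X.D i (Y.φ a)

/-- The derivative `⟨∇φ, a⟩` of the map in the direction dual to a one-form. -/
def pushed (b : ι → A) (a : κ) : A := X.pair (fun i => X.D i (Y.φ a)) b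

variable {X Y}

theorem tens_eq_tr (a : κ) : X.tens Y a = X.tr fun i j => X.sff Y i j a := by
  simp only [sff, tr_add, tr_sum, tr_mul_left]
  rfl

theorem sff_symm (i j : ι) : X.sff Y i j = X.sff Y j i := by
  funext a
  simp only [sff]
  rw [hess_symm]
  congr 1
  rw [Finset.sum_comm]
  exact Finset.sum_congr rfl fun b _ => Finset.sum_congr rfl fun c _ => by
    rw [Y.ΓN_symm]; ring

/-- Separates the tensorial part from the connection of the domain; the latter cancels against the
connection terms in `cov1` and `cov2` below. -/
theorem nab_D_φ (m i : ι) : Y.nab (X.D m) (fun a => X.D i (Y.φ a)) =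
    fun a => X.sff Y m i a + ∑ k, X.Γ m k i * X.D k (Y.φ a) := by
  funext a
  simp only [MapCalculus.nab, sff, hess, cov1]
  ring

theorem tr_ip (V : ι → ι → κ → A) (W : κ → A) :
    (X.tr fun i j => Y.ip (V i j) W) = Y.ip (fun a => X.tr fun i j => V i j a) W := by
  simp only [MapCalculus.ip, tr_sum, tr_mul_left, tr_mul_right]

theorem cov1_along (hY : ∀ i, Y.IsCompat (X.D i)) (V : κ → A) (m i : ι) :
    X.cov1 (X.along Y V) m i = X.along Y (Y.nab (X.D m) V) i + Y.ip V (X.sff Y m i) := by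
  simp only [cov1, along]
  rw [MapCalculus.d_ip (hY m), nab_D_φ m i, Y.ip_comm V, Y.ip_add_left,
    MapCalculus.ip_sum_left, Y.ip_comm V]
  simp only [Y.ip_comm V]
  ring

theorem cov2_pb (hY : ∀ i, Y.IsCompat (X.D i)) (m i j : ι) : X.cov2 (X.pb Y) m i j =
    X.along Y (X.sff Y m i) j + X.along Y (X.sff Y m j) i := by
  simp only [cov2, pb, along]
  rw [MapCalculus.d_ip (hY m), nab_D_φ m i, nab_D_φ m j,
    Y.ip_comm (fun a => X.D i (Y.φ a)), Y.ip_add_left, Y.ip_add_left,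
    MapCalculus.ip_sum_left, MapCalculus.ip_sum_left]
  simp only [Y.ip_comm (fun a => X.D i (Y.φ a))]
  ring

/-- `2 div (φ^*γ) = 2 ⟨τ, ∇φ⟩ + ∇ |∇φ|²`. -/
theorem two_mul_div2_pb (hY : ∀ i, Y.IsCompat (X.D i)) (j : ι) :
    2 * X.div2 (X.pb Y) j = 2 * X.along Y (X.tens Y) j + X.D j (X.tr (X.pb Y)) := by
  have h1 : X.div2 (X.pb Y) j = X.along Y (X.tens Y) j
      + X.tr fun m i => X.along Y (X.sff Y m j) i := by
    simp only [div2, cov2_pb hY, tr_add]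
    congr 1
    simp only [along]
    rw [tr_ip]
    congr 1
    funext a
    rw [tens_eq_tr]
  -- By symmetry of the second fundamental form, the gradient of the energy density is twice the
  -- part of the divergence that is not the tension term.
  have h2 : X.D j (X.tr (X.pb Y)) = 2 * X.tr fun m i => X.along Y (X.sff Y m j) i := by
    rw [D_tr, two_mul]
    nth_rewrite 2 [← tr_symm]
    rw [← tr_add]
    exact tr_congr fun m i => by rw [cov2_pb hY, sff_symm j m, sff_symm j i, add_comm]
  rw [h1, h2]
  ring

theorem div1_along (hY : ∀ i, Y.IsCompat (X.D i)) (V : κ → A) : X.div1 (X.along Y V) =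
    (X.tr fun i j => X.along Y (Y.nab (X.D i) V) j) + Y.ip V (X.tens Y) := by
  have h : X.cov1 (X.along Y V) = fun i j =>
    X.along Y (Y.nab (X.D i) V) j + Y.ip (X.sff Y i j) V := by
    funext i j; rw [cov1_along hY, Y.ip_comm V]
  rw [div1, h, tr_add, tr_ip, Y.ip_comm V]
  congr 2
  funext a
  rw [tens_eq_tr]

/-- The connection of the target is torsion free, so `d` and `∇ᵢ` may be exchanged on `φ`. An
integration by parts, `div1_along`, then writes the result as a divergence and a tension term. -/
theorem d_energy (hY : ∀ i, Y.IsCompat (X.D i)) {d : Derivation ℝ A A} (hYd : Y.IsCompat d)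
    (hd : ∀ i a, d (X.D i a) = X.D i (d a)) :
    d (X.tr (X.pb Y)) = 2 * X.div1 (X.along Y fun a => d (Y.φ a))
      - 2 * Y.ip (fun a => d (Y.φ a)) (X.tens Y)
      - X.pair2 (fun i j => d (X.g i j)) (X.pb Y) := by
  have hn : ∀ i, Y.nab d (fun a => X.D i (Y.φ a)) = Y.nab (X.D i) fun a => d (Y.φ a) := fun i => by
    funext a
    simp only [MapCalculus.nab, hd]
    congr 1
    rw [Finset.sum_comm]
    exact Finset.sum_congr rfl fun b _ => Finset.sum_congr rfl fun c _ => by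
      rw [Y.ΓN_symm]; ring
  have h : ∀ i j, d (X.pb Y i j) = X.along Y (Y.nab (X.D i) fun a => d (Y.φ a)) j
      + X.along Y (Y.nab (X.D j) fun a => d (Y.φ a)) i := fun i j => by
    rw [pb, MapCalculus.d_ip hYd, hn, hn, Y.ip_comm (fun a => X.D i (Y.φ a))]
    rfl
  rw [d_tr, div1_along hY]
  simp only [h]
  rw [tr_add, tr_symm fun i j => X.along Y (Y.nab (X.D i) fun a => d (Y.φ a)) j]
  ring

/-- `along` and `pushed` are adjoint: one contracts in the target, the other in the domain, and the
two contractions commute. -/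
theorem pair_along (V : κ → A) (b : ι → A) : X.pair (X.along Y V) b = Y.ip V (X.pushed Y b) := by
  rw [Y.ip_comm]
  unfold pushed pair
  rw [← tr_ip]
  refine tr_congr fun i j => ?_
  rw [along, Y.ip_comm, MapCalculus.ip, MapCalculus.ip]
  simp only [Finset.sum_mul]
  exact Finset.sum_congr rfl fun a _ => Finset.sum_congr rfl fun c _ => by ring

theorem pair2_pb_mul (b : ι → A) :
    X.pair2 (X.pb Y) (fun i j => b i * b j) = Y.ip (X.pushed Y b) (X.pushed Y b) := by
  rw [← pair_along, pair2, pair]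
  refine tr_congr fun i k => ?_
  have h : X.along Y (X.pushed Y b) i = Y.ip (fun a => X.D i (Y.φ a)) (X.pushed Y b) :=
    Y.ip_comm _ _
  rw [h, ← pair_along, pair, ← tr_mul_right]
  refine tr_congr fun j l => ?_
  simp only [along, pb]
  ring

/-! ### Algebra of the pairings and the product rule for the Laplacian -/

theorem pair2_comm (S T : ι → ι → A) : X.pair2 S T = X.pair2 T S := by
  unfold pair2
  rw [← tr_symm]
  refine tr_congr fun i k => ?_
  rw [← tr_symm]
  exact tr_congr fun j l => mul_comm _ _

theorem pair_comm (a b : ι → A) : X.pair a b = X.pair b a := by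
  unfold pair
  rw [← tr_symm]
  exact tr_congr fun i j => mul_comm _ _

theorem pair2_add_left (S S' T : ι → ι → A) :
    X.pair2 (fun i j => S i j + S' i j) T = X.pair2 S T + X.pair2 S' T := by
  simp only [pair2, add_mul, tr_add]

theorem pair2_sub_left (S S' T : ι → ι → A) :
    X.pair2 (fun i j => S i j - S' i j) T = X.pair2 S T - X.pair2 S' T := by
  simp only [pair2, sub_mul, tr_sub]

theorem pair2_mul_left (c : A) (S T : ι → ι → A) :
    X.pair2 (fun i j => c * S i j) T = c * X.pair2 S T := by
  simp only [pair2, mul_assoc, tr_mul_left]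

theorem pair2_g (T : ι → ι → A) : X.pair2 (fun i j => X.g i j) T = X.tr T := by
  unfold pair2
  have : ∀ i k, (X.tr fun j l => X.g i j * T k l) = T k i := fun i k => tr_g_mul _ _
  simp only [this]
  exact tr_symm T

theorem tr_g : X.tr (fun i j => X.g i j) = Fintype.card ι := by
  have h := congrArg Matrix.trace X.gi_mul_g
  rw [Matrix.trace_one] at h
  rw [← h]
  simp only [Matrix.trace, Matrix.diag, Matrix.mul_apply, tr]
  exact Finset.sum_congr rfl fun i _ => Finset.sum_congr rfl fun j _ => by rw [g_comm]

/-- Expansion of the square, with `⟨g, T⟩ = tr T` and `|g|² = tr g = n`. It absorbs the trace term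
and the constant into the soliton tensor. -/
theorem pair2_sub_mul_g (T : ι → ι → A) (c : A) :
    X.pair2 (fun i j => T i j - c * X.g i j) (fun i j => T i j - c * X.g i j) =
      X.pair2 T T - 2 * c * X.tr T + c ^ 2 * Fintype.card ι := by
  have h : ∀ U, X.pair2 (fun i j => c * X.g i j) U = c * X.tr U := fun U => by
    rw [← pair2_g, ← pair2_mul_left]
  rw [pair2_sub_left, pair2_comm T, pair2_sub_left, h, h, tr_sub,
    tr_mul_left c fun i j => X.g i j, tr_g]
  ring

theorem lap_add (a b : A) : X.lap (a + b) = X.lap a + X.lap b := by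
  simp only [lap, ← tr_add]
  refine tr_congr fun i j => ?_
  simp only [hess, cov1, map_add, mul_add, Finset.sum_add_distrib]
  ring

theorem lap_mul (a b : A) : X.lap (a * b) = a * X.lap b + b * X.lap a
    + 2 * X.pair (fun i => X.D i a) fun i => X.D i b := by
  have h : X.pair (fun i => X.D i a) (fun i => X.D i b) = X.tr fun i j => X.D i b * X.D j a := by
    rw [pair_comm]; rfl
  rw [two_mul]
  nth_rewrite 2 [h]
  simp only [lap, pair, ← tr_mul_left, ← tr_add]
  refine tr_congr fun i j => ?_
  simp only [hess, cov1, Derivation.leibniz, smul_eq_mul, map_add, mul_add, mul_sub,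
    Finset.sum_add_distrib, Finset.mul_sum, mul_left_comm _ a, mul_left_comm _ b]
  ring

theorem pair_add_left (a a' b : ι → A) :
    X.pair (fun i => a i + a' i) b = X.pair a b + X.pair a' b := by
  simp only [pair, add_mul, tr_add]

theorem pair_mul_left (c : A) (a b : ι → A) :
    X.pair (fun i => c * a i) b = c * X.pair a b := by
  simp only [pair, mul_assoc, tr_mul_left]

end MetricCalculus
namespace MetricCalculus

variable {ι κ A B : Type*} [Fintype ι] [DecidableEq ι] [Fintype κ] [CommRing A] [Algebra ℝ A]
  [CommRing B] {X : MetricCalculus ι A} {Y : MapCalculus κ A}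

/-! ### Passing to a time slice

`ρ` is the restriction to a time slice: its kernel is stable under the spatial derivations. -/

section Congr

variable {ρ : A →+* B}

theorem map_tr_congr {S T : ι → ι → A} (h : ∀ i j, ρ (S i j) = ρ (T i j)) :
    ρ (X.tr S) = ρ (X.tr T) := by
  simp only [tr, map_sum, map_mul, h]

theorem map_pair2_congr {S S' : ι → ι → A} (T : ι → ι → A) (h : ∀ i j, ρ (S i j) = ρ (S' i j)) :
    ρ (X.pair2 S T) = ρ (X.pair2 S' T) := by
  refine map_tr_congr fun i k => map_tr_congr fun j l => ?_
  simp only [map_mul, h]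

theorem map_cov1_congr (hρ : ∀ i a b, ρ a = ρ b → ρ (X.D i a) = ρ (X.D i b))
    {a b : ι → A} (h : ∀ i, ρ (a i) = ρ (b i)) (m i : ι) :
    ρ (X.cov1 a m i) = ρ (X.cov1 b m i) := by
  simp only [cov1, map_sub, map_sum, map_mul, h, hρ m _ _ (h i)]

theorem map_cov2_congr (hρ : ∀ i a b, ρ a = ρ b → ρ (X.D i a) = ρ (X.D i b))
    {S T : ι → ι → A} (h : ∀ i j, ρ (S i j) = ρ (T i j)) (m i j : ι) :
    ρ (X.cov2 S m i j) = ρ (X.cov2 T m i j) := by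
  simp only [cov2, map_sub, map_sum, map_mul, h, hρ m _ _ (h i j)]

theorem map_div1_congr (hρ : ∀ i a b, ρ a = ρ b → ρ (X.D i a) = ρ (X.D i b))
    {a b : ι → A} (h : ∀ i, ρ (a i) = ρ (b i)) : ρ (X.div1 a) = ρ (X.div1 b) :=
  map_tr_congr fun i j => map_cov1_congr hρ h i j

theorem map_div2_congr (hρ : ∀ i a b, ρ a = ρ b → ρ (X.D i a) = ρ (X.D i b))
    {S T : ι → ι → A} (h : ∀ i j, ρ (S i j) = ρ (T i j)) (j : ι) :
    ρ (X.div2 S j) = ρ (X.div2 T j) :=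
  map_tr_congr fun m i => map_cov2_congr hρ h m i j

theorem map_lap_congr (hρ : ∀ i a b, ρ a = ρ b → ρ (X.D i a) = ρ (X.D i b))
    {a b : A} (h : ρ a = ρ b) : ρ (X.lap a) = ρ (X.lap b) :=
  map_div1_congr hρ fun i => hρ i _ _ h

theorem map_pair_congr {a a' : ι → A} (b : ι → A) (h : ∀ i, ρ (a i) = ρ (a' i)) :
    ρ (X.pair a b) = ρ (X.pair a' b) :=
  map_tr_congr fun i j => by simp only [map_mul, h]

end Congr

theorem D_ofNat_two (d : Derivation ℝ A A) : d 2 = 0 := by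
  simpa using d.map_natCast 2

theorem div1_mul (c : A) (hc : ∀ i, X.D i c = 0) (a : ι → A) :
    (X.div1 fun i => c * a i) = c * X.div1 a := by
  rw [div1, div1, ← tr_mul_left]
  refine tr_congr fun i j => ?_
  simp only [cov1, Derivation.leibniz, smul_eq_mul, hc, mul_sub, Finset.mul_sum,
    mul_left_comm _ c]
  ring

theorem lap_const_mul (c : A) (hc : ∀ i, X.D i c = 0) (a : A) : X.lap (c * a) = c * X.lap a := by
  rw [lap_mul]
  simp [lap, hess, cov1, pair, tr, hc]

/-- The hypothesis describes `v = c e^{-l}` with `c` independent of space, without an exponential in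
the ring. -/
theorem lap_of_D_eq {l v : A} (hv : ∀ i, X.D i v = -(v * X.D i l)) :
    X.lap v = v * (X.pair (fun i => X.D i l) (fun i => X.D i l) - X.lap l) := by
  rw [lap, pair, lap, ← tr_sub, ← tr_mul_left]
  refine tr_congr fun i j => ?_
  simp only [hess, cov1, hv, map_neg, Derivation.leibniz, smul_eq_mul, mul_sub,
    Finset.mul_sum, mul_neg, Finset.sum_neg_distrib, mul_left_comm _ v]
  ring

theorem div1_sub (a b : ι → A) : (X.div1 fun i => a i - b i) = X.div1 a - X.div1 b := by
  simp only [div1, ← tr_sub]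
  refine tr_congr fun i j => ?_
  simp only [cov1, map_sub, mul_sub, Finset.sum_sub_distrib]
  ring

theorem div2_mul (c : A) (hc : ∀ i, X.D i c = 0) (T : ι → ι → A) (j : ι) :
    X.div2 (fun i j => c * T i j) j = c * X.div2 T j := by
  rw [div2, div2, ← tr_mul_left]
  refine tr_congr fun m i => ?_
  simp only [cov2, Derivation.leibniz, smul_eq_mul, hc, mul_sub, Finset.mul_sum,
    mul_left_comm _ c]
  ring

theorem div2_sub (S T : ι → ι → A) (j : ι) :
    X.div2 (fun i j => S i j - T i j) j = X.div2 S j - X.div2 T j := by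
  rw [div2, div2, div2, ← tr_sub]
  refine tr_congr fun m i => ?_
  simp only [cov2, map_sub, mul_sub, Finset.sum_sub_distrib]
  ring

/-! ### The tensor `S` and the evolution equations along the flow -/

variable (X Y) in
/-- The tensor `S = Ric - β ∇φ ⊗ ∇φ`. -/
def tensS (β : A) (i j : ι) : A := X.ric i j - β * X.pb Y i j

theorem tr_tensS (β : A) : X.tr (X.tensS Y β) = X.tr X.ric - β * X.tr (X.pb Y) := by
  rw [← tr_mul_left, ← tr_sub]; rfl

/-- `2 div S = ∇ (tr S) - 2 β ⟨τ, ∇φ⟩`. -/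
theorem two_mul_div2_tensS {β : A} (hY : ∀ i, Y.IsCompat (X.D i)) (hβ : ∀ i, X.D i β = 0)
    (j : ι) : 2 * X.div2 (X.tensS Y β) j =
      X.D j (X.tr (X.tensS Y β)) - 2 * (β * X.along Y (X.tens Y) j) := by
  have h : X.div2 (X.tensS Y β) j = X.div2 X.ric j - β * X.div2 (X.pb Y) j := by
    rw [← div2_mul β hβ, ← div2_sub]; rfl
  rw [h, tr_tensS]
  simp only [map_sub, Derivation.leibniz, hβ, smul_eq_mul]
  linear_combination -X.D_scal j - β * two_mul_div2_pb hY j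

/-- The equations of the harmonic Ricci flow for the variation `d`, on a time slice. -/
structure IsFlow (X : MetricCalculus ι A) (Y : MapCalculus κ A) (β : A) (d : Derivation ℝ A A)
    (ρ : A →+* B) : Prop where
  congr : ∀ i a b, ρ a = ρ b → ρ (X.D i a) = ρ (X.D i b)
  compat : ∀ i, Y.IsCompat (X.D i)
  compat_d : Y.IsCompat d
  comm : ∀ i a, d (X.D i a) = X.D i (d a)
  D_coupling : ∀ i, X.D i β = 0
  metric_eq : ∀ i j, ρ (d (X.g i j)) = ρ (-2 * X.tensS Y β i j)
  map_eq : ∀ a, ρ (d (Y.φ a)) = ρ (X.tens Y a)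

variable {β : A} {d : Derivation ℝ A A} {ρ : A →+* B}

/-- `B` is not assumed to be a real algebra, but 2 is invertible in it because `ρ` carries over the
inverse from `A`. -/
theorem eq_of_two_mul (ρ : A →+* B) {x y : B} (h : 2 * x = 2 * y) : x = y := by
  have h2 : (2 : B) * ρ (algebraMap ℝ A (1 / 2)) = 1 := by
    have : (2 : A) * algebraMap ℝ A (1 / 2) = 1 := by
      rw [show (2 : A) = algebraMap ℝ A 2 from (map_ofNat _ 2).symm, ← map_mul]
      norm_num
    rw [show (2 : B) = ρ 2 from (map_ofNat ρ 2).symm, ← map_mul, this, map_one]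
  linear_combination ρ (algebraMap ℝ A (1 / 2)) * h - (x - y) * h2

namespace IsFlow

theorem map_tr_dg (hF : IsFlow X Y β d ρ) :
    ρ (X.tr fun i j => d (X.g i j)) = ρ (-2 * X.tr (X.tensS Y β)) := by
  rw [← tr_mul_left]
  exact map_tr_congr hF.metric_eq

theorem map_two_mul_div2_dg (hF : IsFlow X Y β d ρ) (j : ι) :
    ρ (X.div2 (fun i j => d (X.g i j)) j) =
      ρ (-1 * (X.D j (X.tr (X.tensS Y β)) - 2 * (β * X.along Y (X.tens Y) j))) := by
  rw [map_div2_congr hF.congr hF.metric_eq, div2_mul (-2) (fun i => by simp [D_ofNat_two])]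
  congr 1
  linear_combination -two_mul_div2_tensS hF.compat hF.D_coupling j

theorem map_pair2_dg (hF : IsFlow X Y β d ρ) (T : ι → ι → A) :
    ρ (X.pair2 (fun i j => d (X.g i j)) T) = ρ (-2 * X.pair2 (X.tensS Y β) T) := by
  rw [map_pair2_congr T hF.metric_eq, pair2_mul_left]

theorem map_ip_dφ (hF : IsFlow X Y β d ρ) (V : κ → A) :
    ρ (Y.ip (fun a => d (Y.φ a)) V) = ρ (Y.ip (X.tens Y) V) := by
  simp only [MapCalculus.ip, map_sum, map_mul, hF.map_eq]

/-- The evolution of `tr S`. -/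
theorem map_d_tr_tensS (hF : IsFlow X Y β d ρ) : ρ (d (X.tr (X.tensS Y β))) =
    ρ (X.lap (X.tr (X.tensS Y β)) + 2 * X.pair2 (X.tensS Y β) (X.tensS Y β)
      + 2 * β * Y.ip (X.tens Y) (X.tens Y) - d β * X.tr (X.pb Y)) := by
  set S := X.tensS Y β with hS
  set y := X.along Y (X.tens Y) with hy
  have hR : ρ (2 * d (X.tr X.ric)) =
      ρ (2 * X.lap (X.tr S) + 4 * (β * X.div1 y) + 4 * X.pair2 S X.ric) := by
    have h1 : ρ (X.div1 (X.div2 fun i j => d (X.g i j))) =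
        ρ (-1 * (X.lap (X.tr S) - 2 * (β * X.div1 y))) := by
      rw [map_div1_congr hF.congr hF.map_two_mul_div2_dg, div1_mul (-1) (fun i => by simp),
        div1_sub, div1_mul 2 (fun i => by simp [D_ofNat_two]), div1_mul β hF.D_coupling]
      rfl
    have h2 : ρ (X.lap (X.tr fun i j => d (X.g i j))) = ρ (-2 * X.lap (X.tr S)) := by
      rw [map_lap_congr hF.congr hF.map_tr_dg]
      rw [lap_const_mul _ fun i => by simp [D_ofNat_two]]
    have h3 := hF.map_pair2_dg X.ric
    rw [two_mul_d_scal hF.comm]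
    simp only [map_sub, map_mul, map_add, map_neg, map_ofNat, map_one] at h1 h2 h3 ⊢
    rw [h1, h2, h3]
    ring
  -- Weighted by `β`, the divergence of `⟨τ, ∇φ⟩` here equals the one in the variation of scalar
  -- curvature, so it drops out of the derivative of `tr S`.
  have hE : ρ (d (X.tr (X.pb Y))) = ρ (2 * X.div1 y - 2 * Y.ip (X.tens Y) (X.tens Y)
      + 2 * X.pair2 S (X.pb Y)) := by
    rw [d_energy hF.compat hF.compat_d hF.comm]
    have h1 : ρ (X.div1 (X.along Y fun a => d (Y.φ a))) = ρ (X.div1 y) :=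
      map_div1_congr hF.congr fun i => hF.map_ip_dφ _
    have h3 := hF.map_pair2_dg (X.pb Y)
    simp only [map_sub, map_mul, map_add, map_neg, map_ofNat] at h3 ⊢
    rw [h1, h3, hF.map_ip_dφ]
    ring
  -- Recombines the pairings of `S` with Ricci and with `φ^*γ` into `|S|²`.
  have hSS : X.pair2 S S = X.pair2 S X.ric - β * X.pair2 S (X.pb Y) := by
    rw [pair2_comm S X.ric, pair2_comm S (X.pb Y), ← pair2_mul_left, ← pair2_sub_left]
    rfl
  refine eq_of_two_mul ρ ?_
  rw [hSS]
  rw [hS, tr_tensS, ← hS]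
  simp only [map_sub, map_mul, map_add, map_ofNat, Derivation.leibniz, smul_eq_mul] at hR hE ⊢
  rw [← tr_tensS, ← hS]
  linear_combination hR - 2 * ρ β * hE

/-- The evolution of the Laplacian. -/
theorem map_two_mul_d_lap (hF : IsFlow X Y β d ρ) (l : A) : ρ (2 * d (X.lap l)) =
    ρ (2 * X.lap (d l) + 4 * X.pair2 (X.tensS Y β) (X.hess l)
      - 4 * (β * Y.ip (X.tens Y) (X.pushed Y fun i => X.D i l))) := by
  -- With `dg = -2S`, the gradient of `tr S` in the divergence cancels that in the derivative of the
  -- trace, leaving only the coupling term.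
  have hV : ∀ p, ρ (2 * X.tr fun i j => X.dΓ d p i j) =
      ρ (4 * β * X.along Y (X.tens Y) p) := fun p => by
    rw [two_mul_tr_dΓ hF.comm]
    have h1 := hF.map_two_mul_div2_dg p
    have h2 := hF.congr p _ _ hF.map_tr_dg
    simp only [Derivation.leibniz, smul_eq_mul, map_neg, D_ofNat_two] at h2
    simp only [map_sub, map_mul, map_add, map_neg, map_ofNat, map_one, map_zero] at h1 h2 ⊢
    rw [h1, h2]
    ring
  have h3 := map_pair_congr (X := X) (fun i => X.D i l) hV
  rw [pair_mul_left, pair_mul_left, pair_along] at h3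
  have h4 := hF.map_pair2_dg (X.hess l)
  rw [d_lap hF.comm]
  simp only [map_sub, map_mul, map_add, map_neg, map_ofNat] at h3 h4 ⊢
  linear_combination -2 * h4 - h3

/-- The evolution of `|∇l|²`. -/
theorem map_d_gradSq (hF : IsFlow X Y β d ρ) (l : A) :
    ρ (d (X.pair (fun i => X.D i l) fun i => X.D i l)) =
    ρ (2 * X.pair (fun i => X.D i (d l)) (fun i => X.D i l)
      + 2 * X.pair2 (X.tensS Y β) fun i j => X.D i l * X.D j l) := by
  have h4 := hF.map_pair2_dg fun i j => X.D i l * X.D j l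
  rw [d_pair, pair_comm (fun i => X.D i l) fun i => d (X.D i l)]
  simp only [hF.comm]
  simp only [map_sub, map_mul, map_add, map_neg, map_ofNat] at h4 ⊢
  linear_combination -h4

/-- The evolution of `σ (2Δl - |∇l|² + tr S) + l - N`. -/
theorem map_d_harnack (hF : IsFlow X Y β d ρ) {l σ ν N : A}
    (hσ : ∀ i, X.D i σ = 0) (hσd : d σ = -1) (hN : ∀ i, X.D i N = 0) (hNd : d N = 0)
    (hν : ∀ i, X.D i ν = 0)
    (hl : ρ (d l) = ρ (-X.lap l + X.pair (fun i => X.D i l) (fun i => X.D i l)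
      - X.tr (X.tensS Y β) + ν)) {P : A}
    (hP : P = σ * (2 * X.lap l - X.pair (fun i => X.D i l) (fun i => X.D i l)
      + X.tr (X.tensS Y β)) + l - N) :
    ρ (d P + X.lap P - 2 * X.pair (fun i => X.D i P) fun i => X.D i l) =
    ρ (2 * σ * (X.pair2 (fun i j => X.tensS Y β i j + X.hess l i j)
        (fun i j => X.tensS Y β i j + X.hess l i j)
      + β * Y.ip (fun a => X.tens Y a - X.pushed Y (fun i => X.D i l) a)
        (fun a => X.tens Y a - X.pushed Y (fun i => X.D i l) a))
      - σ * (d β * X.tr (X.pb Y))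
      - 2 * X.tr (fun i j => X.tensS Y β i j + X.hess l i j) + ν) := by
  set S := X.tensS Y β with hS
  set dl : ι → A := fun i => X.D i l with hdl
  set G := X.pair dl dl with hG
  set L := X.lap l with hL
  set Z := X.pushed Y dl with hZ
  set Q := 2 * L - G + X.tr S with hQ
  have hlapP : X.lap P = σ * X.lap Q + L := by
    have hNl : X.lap (-N) = 0 := by
      simp [lap, hess, cov1, tr, hN]
    rw [hP, sub_eq_add_neg, lap_add, lap_add, hNl, lap_const_mul σ hσ]
    ring
  have hDP : (fun i => X.D i P) = fun i => σ * X.D i Q + X.D i l := by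
    funext i
    simp [hP, hN, hσ]
  have hpairP : X.pair (fun i => X.D i P) dl = σ * X.pair (fun i => X.D i Q) dl + G := by
    rw [hDP, pair_add_left, pair_mul_left]
  have hdP : d P = σ * d Q - Q + d l := by
    simp [hP, hNd, hσd]; ring
  have hdQ : d Q = 2 * d L - d G + d (X.tr S) := by
    simp [hQ, D_ofNat_two]
  have hlapQ : X.lap Q = 2 * X.lap L - X.lap G + X.lap (X.tr S) := by
    have h : X.lap (-1 * G) = -1 * X.lap G := lap_const_mul _ (fun i => by simp) _
    have e : Q = 2 * L + -1 * G + X.tr S := by rw [hQ]; ring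
    rw [e, lap_add, lap_add, h, lap_const_mul 2 fun i => by simp [D_ofNat_two]]
    ring
  have hpairQ : X.pair (fun i => X.D i Q) dl = 2 * X.pair (fun i => X.D i L) dl
      - X.pair (fun i => X.D i G) dl + X.pair (fun i => X.D i (X.tr S)) dl := by
    have e : (fun i => X.D i Q) =
        fun i => 2 * X.D i L + -1 * X.D i G + X.D i (X.tr S) := by
      funext i
      simp [hQ, D_ofNat_two]
      ring
    rw [e, pair_add_left, pair_add_left, pair_mul_left, pair_mul_left]
    ring
  have hlapdl : ρ (X.lap (d l)) = ρ (-X.lap L + X.lap G - X.lap (X.tr S)) := by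
    rw [map_lap_congr hF.congr hl]
    have e : -L + G - X.tr S + ν = -1 * L + G + -1 * X.tr S + ν := by ring
    have hνl : X.lap ν = 0 := by simp [lap, hess, cov1, tr, hν]
    rw [e, lap_add, lap_add, lap_add, lap_const_mul (-1) (fun i => by simp),
      lap_const_mul (-1) (fun i => by simp), hνl]
    congr 1
    ring
  have hpairdl : ρ (X.pair (fun i => X.D i (d l)) dl) =
      ρ (-X.pair (fun i => X.D i L) dl + X.pair (fun i => X.D i G) dl
        - X.pair (fun i => X.D i (X.tr S)) dl) := by
    rw [map_pair_congr dl fun i => hF.congr i _ _ hl]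
    have e : (fun i => X.D i (-L + G - X.tr S + ν)) =
        fun i => -1 * X.D i L + X.D i G + -1 * X.D i (X.tr S) := by
      funext i
      simp [hν]
      ring
    rw [e, pair_add_left, pair_add_left, pair_mul_left, pair_mul_left]
    congr 1
    ring
  have hB : X.lap G = 2 * X.pair2 (X.hess l) (X.hess l) + 2 * X.pair (fun i => X.D i L) dl
      + 2 * X.pair2 X.ric (fun i j => dl i * dl j) := by
    have e : (X.tr fun i j => X.tr fun p q => X.ric p i * X.D q l * X.D j l) =
        X.pair2 X.ric (fun i j => dl i * dl j) := by
      rw [tr_tr]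
      exact tr_congr fun i j => tr_congr fun p q => mul_assoc _ _ _
    rw [hG, bochner, pair_comm _ dl, e]
  -- Ricci in the Bochner formula and `S` in the variation of `|∇l|²` differ exactly by `β |⟨∇φ,
  -- ∇l⟩|²`, which completes the square with the tension field.
  have hric : X.pair2 S (fun i j => dl i * dl j) =
      X.pair2 X.ric (fun i j => dl i * dl j) - β * Y.ip Z Z := by
    rw [hZ, ← pair2_pb_mul, ← pair2_mul_left, ← pair2_sub_left]
    rfl
  have e1 : X.pair2 (fun i j => S i j + X.hess l i j) (fun i j => S i j + X.hess l i j) =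
      X.pair2 S S + 2 * X.pair2 S (X.hess l) + X.pair2 (X.hess l) (X.hess l) := by
    rw [pair2_add_left, pair2_comm S, pair2_comm (X.hess l), pair2_add_left, pair2_add_left,
      pair2_comm (X.hess l) S]
    ring
  have e2 : Y.ip (fun a => X.tens Y a - Z a) (fun a => X.tens Y a - Z a) =
      Y.ip (X.tens Y) (X.tens Y) - 2 * Y.ip (X.tens Y) Z + Y.ip Z Z := by
    rw [Y.ip_sub_left, Y.ip_sub_right, Y.ip_sub_right, Y.ip_comm Z (X.tens Y)]
    ring
  have e3 : X.tr (fun i j => S i j + X.hess l i j) = X.tr S + L := tr_add _ _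
  have hdL := hF.map_two_mul_d_lap l
  have hdG := hF.map_d_gradSq l
  have hdS := hF.map_d_tr_tensS
  rw [← hS] at hdL hdG hdS
  rw [← hdl] at hdL hdG
  rw [← hL, ← hZ] at hdL
  rw [← hG, hric] at hdG
  have hB' := congrArg ρ hB
  rw [e1, e2, e3, hdP, hdQ, hlapP, hlapQ, hpairP, hpairQ]
  rw [hQ]
  simp only [map_sub, map_mul, map_add, map_neg, map_ofNat] at *
  -- After substitution of `∂ₜl`, the terms `ΔΔl` and `Δ tr S`, and the pairings of `∇l` with `∇Δl`,
  -- `∇|∇l|²` and `∇ tr S`, all cancel; one copy of `Δ|∇l|²` is left for the Bochner formula.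
  linear_combination ρ σ * (hdL - hdG + hdS + 2 * hlapdl - 2 * hpairdl + hB') + hl

/-- The adjoint heat operator applied to `P v`. -/
theorem map_adjointHeat (hF : IsFlow X Y β d ρ) {l σ ν N : A}
    (hσ : ∀ i, X.D i σ = 0) (hσd : d σ = -1) (hN : ∀ i, X.D i N = 0) (hNd : d N = 0)
    (hν : ∀ i, X.D i ν = 0)
    (hl : ρ (d l) = ρ (-X.lap l + X.pair (fun i => X.D i l) (fun i => X.D i l)
      - X.tr (X.tensS Y β) + ν)) {P v : A}
    (hP : P = σ * (2 * X.lap l - X.pair (fun i => X.D i l) (fun i => X.D i l)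
      + X.tr (X.tensS Y β)) + l - N)
    (hv : ∀ i, X.D i v = -(v * X.D i l)) (hvd : d v = v * (ν - d l)) :
    ρ (-d (P * v) - X.lap (P * v) + X.tr (X.tensS Y β) * (P * v)) =
    ρ (-(2 * σ * (X.pair2 (fun i j => X.tensS Y β i j + X.hess l i j)
        (fun i j => X.tensS Y β i j + X.hess l i j)
      + β * Y.ip (fun a => X.tens Y a - X.pushed Y (fun i => X.D i l) a)
        (fun a => X.tens Y a - X.pushed Y (fun i => X.D i l) a))
      - σ * (d β * X.tr (X.pb Y))
      - 2 * X.tr (fun i j => X.tensS Y β i j + X.hess l i j) + ν) * v) := by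
  rw [map_mul ρ, map_neg ρ, ← hF.map_d_harnack hσ hσd hN hNd hν hl hP]
  have hlapv := lap_of_D_eq hv
  have hpair : X.pair (fun i => X.D i P) (fun i => X.D i v) =
      -v * X.pair (fun i => X.D i P) fun i => X.D i l := by
    rw [pair_comm, pair_comm (fun i => X.D i P), ← pair_mul_left]
    simp only [hv, neg_mul]
  rw [lap_mul, hlapv, hpair]
  simp only [Derivation.leibniz, smul_eq_mul, hvd, map_sub, map_mul, map_add, map_neg,
    map_ofNat] at hl ⊢
  -- The terms in which `P` is not differentiated form `P □^* v`, which vanishes by the equation for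
  -- `l`.
  linear_combination ρ P * ρ v * hl

end IsFlow

end MetricCalculus
/-! ### Rings of smooth functions on open sets -/

section SmoothFunctions

variable {E : Type*} [NormedAddCommGroup E] [NormedSpace ℝ E]

/-- The algebra of smooth functions on the set `Ω`. -/
def SmoothFun (Ω : Set E) : Subalgebra ℝ (Ω → ℝ) where
  carrier := {f | ∃ F : E → ℝ, ContDiffOn ℝ ∞ F Ω ∧ ∀ p : Ω, f p = F p}
  mul_mem' := by
    rintro f g ⟨F, hF, hf⟩ ⟨G, hG, hg⟩
    exact ⟨fun p => F p * G p, hF.mul hG, fun p => by simp [hf, hg]⟩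
  add_mem' := by
    rintro f g ⟨F, hF, hf⟩ ⟨G, hG, hg⟩
    exact ⟨fun p => F p + G p, hF.add hG, fun p => by simp [hf, hg]⟩
  algebraMap_mem' c := ⟨fun _ => c, contDiffOn_const, fun p => rfl⟩

namespace SmoothFun

variable {Ω : Set E}

/-- The smooth function given by a function on the whole space. -/
def mk (F : E → ℝ) (hF : ContDiffOn ℝ ∞ F Ω) : SmoothFun Ω := ⟨fun p => F p, F, hF, fun _ => rfl⟩

/-- A function on the whole space which restricts to the given one. -/
noncomputable def rep (f : SmoothFun Ω) : E → ℝ := f.2.choose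

theorem rep_contDiffOn (f : SmoothFun Ω) : ContDiffOn ℝ ∞ (rep f) Ω := f.2.choose_spec.1

theorem rep_eq (f : SmoothFun Ω) (p : Ω) : f.1 p = (rep f) p := f.2.choose_spec.2 p

theorem fderiv_eq (hΩ : IsOpen Ω) {F G : E → ℝ} (h : ∀ p ∈ Ω, F p = G p) {p : E} (hp : p ∈ Ω) :
    fderiv ℝ F p = fderiv ℝ G p :=
  Filter.EventuallyEq.fderiv_eq (Filter.eventually_of_mem (hΩ.mem_nhds hp) h)

theorem rep_differentiableAt (hΩ : IsOpen Ω) (f : SmoothFun Ω) (p : Ω) :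
    DifferentiableAt ℝ (rep f) p :=
  ((rep_contDiffOn f).contDiffAt (hΩ.mem_nhds p.2)).differentiableAt (by simp)

theorem contDiffOn_fderiv_apply (hΩ : IsOpen Ω) {F : E → ℝ} (hF : ContDiffOn ℝ ∞ F Ω) (v : E) :
    ContDiffOn ℝ ∞ (fun p => fderiv ℝ F p v) Ω :=
  (hF.fderiv_of_isOpen hΩ (by simp)).clm_apply contDiffOn_const

/-- The derivative in the direction `v` as a derivation. -/
noncomputable def D (hΩ : IsOpen Ω) (v : E) : Derivation ℝ (SmoothFun Ω) (SmoothFun Ω) :=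
  Derivation.mk'
    { toFun := fun f => mk (fun p => fderiv ℝ (rep f) p v)
        (contDiffOn_fderiv_apply hΩ (rep_contDiffOn f) v)
      map_add' := fun f g => by
        refine Subtype.ext (funext fun p => ?_)
        change fderiv ℝ (rep (f + g)) p v = fderiv ℝ (rep f) p v + fderiv ℝ (rep g) p v
        rw [fderiv_eq hΩ (G := (rep f) + (rep g)) (fun q hq => ?_) p.2,
          fderiv_add (rep_differentiableAt hΩ f p) (rep_differentiableAt hΩ g p)]
        · rfl
        · rw [← rep_eq (f + g) ⟨q, hq⟩, Pi.add_apply, ← rep_eq f ⟨q, hq⟩, ← rep_eq g ⟨q, hq⟩]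
          rfl
      map_smul' := fun c f => by
        refine Subtype.ext (funext fun p => ?_)
        change fderiv ℝ (rep (c • f)) p v = c • fderiv ℝ (rep f) p v
        rw [fderiv_eq hΩ (G := c • (rep f)) (fun q hq => ?_) p.2,
          fderiv_const_smul (rep_differentiableAt hΩ f p)]
        · rfl
        · rw [← rep_eq (c • f) ⟨q, hq⟩, Pi.smul_apply, ← rep_eq f ⟨q, hq⟩]
          rfl }
    fun f g => by
      refine Subtype.ext (funext fun p => ?_)
      change fderiv ℝ (rep (f * g)) p v = f.1 p * fderiv ℝ (rep g) p v + g.1 p * fderiv ℝ (rep f) p v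
      rw [fderiv_eq hΩ (G := (rep f) * (rep g)) (fun q hq => ?_) p.2,
        fderiv_mul (rep_differentiableAt hΩ f p) (rep_differentiableAt hΩ g p)]
      · simp [rep_eq]
      · rw [← rep_eq (f * g) ⟨q, hq⟩, Pi.mul_apply, ← rep_eq f ⟨q, hq⟩, ← rep_eq g ⟨q, hq⟩]
        rfl

/-- Since `Ω` is open, the derivative does not depend on the chosen extension `rep f`; any extension
may be used. -/
theorem D_apply (hΩ : IsOpen Ω) (v : E) (f : SmoothFun Ω) {F : E → ℝ}
    (h : ∀ p : Ω, f.1 p = F p) (p : Ω) : (D hΩ v f).1 p = fderiv ℝ F p v := by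
  change fderiv ℝ (rep f) p v = _
  rw [fderiv_eq hΩ (fun q hq => ?_) p.2]
  rw [← rep_eq f ⟨q, hq⟩, h]

theorem D_comm (hΩ : IsOpen Ω) (v w : E) (f : SmoothFun Ω) :
    D hΩ v (D hΩ w f) = D hΩ w (D hΩ v f) := by
  refine Subtype.ext (funext fun p => ?_)
  rw [D_apply hΩ v _ (F := fun q => fderiv ℝ (rep f) q w) fun q => rfl,
    D_apply hΩ w _ (F := fun q => fderiv ℝ (rep f) q v) fun q => rfl]
  have hc := (rep_contDiffOn f).contDiffAt (hΩ.mem_nhds p.2)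
  have hd : DifferentiableAt ℝ (fderiv ℝ (rep f)) p :=
    (hc.fderiv_right (m := 1) (WithTop.coe_le_coe.2 (le_top (a := (1 + 1 : ℕ∞))))).differentiableAt (by simp)
  rw [fderiv_clm_apply hd (differentiableAt_const _), fderiv_clm_apply hd (differentiableAt_const _)]
  simp only [fderiv_fun_const, Pi.zero_apply, ContinuousLinearMap.comp_zero, zero_add,
    ContinuousLinearMap.flip_apply]
  exact (hc.isSymmSndFDerivAt (by simpa using WithTop.coe_le_coe.2 (le_top (a := (2 : ℕ∞))))) v w

theorem isUnit_of_ne_zero {f : SmoothFun Ω} (h : ∀ p, f.1 p ≠ 0) : IsUnit f := by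
  refine IsUnit.of_mul_eq_one (mk (fun p => ((rep f) p)⁻¹) ((rep_contDiffOn f).inv fun p hp => ?_)) ?_
  · rw [← rep_eq f ⟨p, hp⟩]; exact h _
  · refine Subtype.ext (funext fun p => ?_)
    change f.1 p * ((rep f) p)⁻¹ = 1
    rw [← rep_eq]
    exact mul_inv_cancel₀ (h p)

/-- Evaluation at a point. -/
def ev (p : Ω) : SmoothFun Ω →+* ℝ :=
  (Pi.evalRingHom (fun _ : Ω => ℝ) p).comp (SmoothFun Ω).val.toRingHom

theorem ev_apply (p : Ω) (f : SmoothFun Ω) : ev p f = f.1 p := rfl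

end SmoothFun

end SmoothFunctions

/-! ### Functions of time and space -/

section SpaceTime

variable {n : ℕ} {Ω : Set (ℝ × EuclideanSpace ℝ (Fin n))}

open SmoothFun

/-- The function `F` of time and space represents the element `f`. -/
def Rep (f : SmoothFun Ω) (F : ℝ → EuclideanSpace ℝ (Fin n) → ℝ) : Prop :=
  ∀ p : Ω, f.1 p = F p.1.1 p.1.2

/-- The spatial partial derivatives. -/
noncomputable def Dx (hΩ : IsOpen Ω) (i : Fin n) : Derivation ℝ (SmoothFun Ω) (SmoothFun Ω) :=
  D hΩ (0, EuclideanSpace.single i 1)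

/-- The time derivative. -/
noncomputable def Dt (hΩ : IsOpen Ω) : Derivation ℝ (SmoothFun Ω) (SmoothFun Ω) :=
  D hΩ (1, 0)

theorem Rep.hasFDerivAt (hΩ : IsOpen Ω) {f : SmoothFun Ω} {F : ℝ → EuclideanSpace ℝ (Fin n) → ℝ}
    (h : Rep f F) (p : Ω) :
    HasFDerivAt (fun q : ℝ × EuclideanSpace ℝ (Fin n) => F q.1 q.2)
      (fderiv ℝ (fun q : ℝ × EuclideanSpace ℝ (Fin n) => F q.1 q.2) p.1) p.1 := by
  refine DifferentiableAt.hasFDerivAt ?_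
  refine (rep_differentiableAt hΩ f p).congr_of_eventuallyEq ?_
  refine Filter.eventually_of_mem (hΩ.mem_nhds p.2) fun q hq => ?_
  rw [← rep_eq f ⟨q, hq⟩, h]

theorem Rep.hasDerivAt (hΩ : IsOpen Ω) {f : SmoothFun Ω} {F : ℝ → EuclideanSpace ℝ (Fin n) → ℝ}
    (h : Rep f F) (p : Ω) : HasDerivAt (fun s => F s p.1.2) ((Dt hΩ f).1 p) p.1.1 := by
  rw [Dt, D_apply hΩ _ f (F := fun q => F q.1 q.2) h]
  have h1 : HasDerivAt (fun s : ℝ => (s, p.1.2)) ((1 : ℝ), (0 : EuclideanSpace ℝ (Fin n))) p.1.1 :=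
    (hasDerivAt_id _).prodMk (hasDerivAt_const _ _)
  exact HasFDerivAt.comp_hasDerivAt (x := p.1.1) (h.hasFDerivAt hΩ p) h1

theorem Rep.dt (hΩ : IsOpen Ω) {f : SmoothFun Ω} {F : ℝ → EuclideanSpace ℝ (Fin n) → ℝ}
    (h : Rep f F) : Rep (Dt hΩ f) fun t u => deriv (fun s => F s u) t :=
  fun p => (h.hasDerivAt hΩ p).deriv.symm

theorem Rep.dx (hΩ : IsOpen Ω) {f : SmoothFun Ω} {F : ℝ → EuclideanSpace ℝ (Fin n) → ℝ}
    (h : Rep f F) (i : Fin n) : Rep (Dx hΩ i f) fun t u => pd i (F t) u := fun p => by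
  rw [Dx, D_apply hΩ _ f (F := fun q => F q.1 q.2) h]
  have h1 : HasFDerivAt (fun u : EuclideanSpace ℝ (Fin n) => (p.1.1, u))
      (ContinuousLinearMap.inr ℝ ℝ (EuclideanSpace ℝ (Fin n))) p.1.2 :=
    hasFDerivAt_prodMk_right _ _
  have h2 := HasFDerivAt.comp (x := p.1.2) (h.hasFDerivAt hΩ p) h1
  have h3 : fderiv ℝ (F p.1.1) p.1.2 = _ := h2.fderiv
  change _ = fderiv ℝ (F p.1.1) p.1.2 _
  rw [h3]
  rfl

theorem Rep.congr {f : SmoothFun Ω} {F G : ℝ → EuclideanSpace ℝ (Fin n) → ℝ} (h : Rep f F)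
    (hFG : ∀ p ∈ Ω, F p.1 p.2 = G p.1 p.2) : Rep f G :=
  fun p => (h p).trans (hFG p.1 p.2)

theorem Rep.add {f g : SmoothFun Ω} {F G : ℝ → EuclideanSpace ℝ (Fin n) → ℝ}
    (hf : Rep f F) (hg : Rep g G) : Rep (f + g) fun t u => F t u + G t u :=
  fun p => congrArg₂ (· + ·) (hf p) (hg p)

theorem Rep.neg {f : SmoothFun Ω} {F : ℝ → EuclideanSpace ℝ (Fin n) → ℝ} (hf : Rep f F) :
    Rep (-f) fun t u => -F t u :=
  fun p => congrArg (- ·) (hf p)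

theorem Rep.sub {f g : SmoothFun Ω} {F G : ℝ → EuclideanSpace ℝ (Fin n) → ℝ}
    (hf : Rep f F) (hg : Rep g G) : Rep (f - g) fun t u => F t u - G t u :=
  fun p => congrArg₂ (· - ·) (hf p) (hg p)

theorem Rep.mul {f g : SmoothFun Ω} {F G : ℝ → EuclideanSpace ℝ (Fin n) → ℝ}
    (hf : Rep f F) (hg : Rep g G) : Rep (f * g) fun t u => F t u * G t u :=
  fun p => congrArg₂ (· * ·) (hf p) (hg p)

theorem Rep.smul (c : ℝ) {f : SmoothFun Ω} {F : ℝ → EuclideanSpace ℝ (Fin n) → ℝ}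
    (hf : Rep f F) : Rep (c • f) fun t u => c * F t u :=
  fun p => congrArg (c * ·) (hf p)

theorem Rep.sum {ι : Type*} {s : Finset ι} {f : ι → SmoothFun Ω}
    {F : ι → ℝ → EuclideanSpace ℝ (Fin n) → ℝ} (h : ∀ i, Rep (f i) (F i)) :
    Rep (∑ i ∈ s, f i) fun t u => ∑ i ∈ s, F i t u := fun p => by
  rw [← ev_apply, map_sum]
  exact Finset.sum_congr rfl fun i _ => h i p

theorem rep_mk {F : ℝ → EuclideanSpace ℝ (Fin n) → ℝ}
    (hF : ContDiffOn ℝ ∞ (fun q : ℝ × EuclideanSpace ℝ (Fin n) => F q.1 q.2) Ω) :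
    Rep (SmoothFun.mk (fun q : ℝ × EuclideanSpace ℝ (Fin n) => F q.1 q.2) hF) F := fun _ => rfl

end SpaceTime

/-! ### The calculus of a family of metrics in coordinates -/

section OfMetric

/-- The calculus of a symmetric invertible matrix, with the Levi-Civita connection. -/
noncomputable def MetricCalculus.ofMetric {ι A : Type*} [Fintype ι] [DecidableEq ι] [CommRing A]
    [Algebra ℝ A] (D : ι → Derivation ℝ A A) (D_comm : ∀ i j a, D i (D j a) = D j (D i a))
    (g : Matrix ι ι A) (g_symm : g.transpose = g) (hg : IsUnit g.det) : MetricCalculus ι A where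
  D := D
  g := g
  gi := g⁻¹
  Γ i := Matrix.of fun k j =>
    (1 / 2 : ℝ) • ∑ l, g⁻¹ k l * (D i (g j l) + D j (g i l) - D l (g i j))
  D_comm := D_comm
  g_symm := g_symm
  gi_symm := by rw [Matrix.transpose_nonsing_inv, g_symm]
  gi_mul_g := Matrix.nonsing_inv_mul g hg
  Γ_symm i j k := by
    have hs : ∀ i j, g i j = g j i := fun i j => congrFun (congrFun g_symm j) i
    simp only [Matrix.of_apply]
    congr 1
    exact Finset.sum_congr rfl fun l _ => by rw [hs i j]; ring
  compat m := by
    have hs : ∀ i j, g i j = g j i := fun i j => congrFun (congrFun g_symm j) i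
    -- Lowering the upper index removes the inverse metric. In the sum of the two lowered symbols
    -- all terms but those with `∂ₘ gᵢⱼ` cancel.
    have low : ∀ i j p, (g * Matrix.of fun k j => (1 / 2 : ℝ) •
        ∑ l, g⁻¹ k l * (D i (g j l) + D j (g i l) - D l (g i j))) p j =
        (1 / 2 : ℝ) • (D i (g j p) + D j (g i p) - D p (g i j)) := fun i j p => by
      have e : (Matrix.of fun k j => (1 / 2 : ℝ) •
          ∑ l, g⁻¹ k l * (D i (g j l) + D j (g i l) - D l (g i j))) =
          (1 / 2 : ℝ) • (g⁻¹ * Matrix.of fun l j => D i (g j l) + D j (g i l) - D l (g i j)) := by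
        ext a b
        simp [Matrix.mul_apply]
      rw [e, Matrix.mul_smul, ← Matrix.mul_assoc, Matrix.mul_nonsing_inv g hg, Matrix.one_mul]
      rfl
    ext i j
    rw [Matrix.add_apply, low, ← Matrix.transpose_apply (_ * g), Matrix.transpose_mul,
      Matrix.transpose_transpose, g_symm, low, Matrix.map_apply, ← smul_add, hs j i, hs m j,
      hs m i]
    have : D m (g i j) + D i (g j m) - D j (g i m) + (D m (g i j) + D j (g i m) - D i (g j m))
        = (2 : ℝ) • D m (g i j) := by
      rw [two_smul]; ring
    rw [this, smul_smul]
    norm_num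

variable {n : ℕ} {Ω : Set (ℝ × EuclideanSpace ℝ (Fin n))}

/-- A smooth family of nondegenerate symmetric matrices of functions. -/
structure IsMetricFamily (Ω : Set (ℝ × EuclideanSpace ℝ (Fin n)))
    (G : ℝ → EuclideanSpace ℝ (Fin n) → Matrix (Fin n) (Fin n) ℝ) : Prop where
  isOpen : IsOpen Ω
  smooth : ∀ i j, ContDiffOn ℝ ∞ (fun q : ℝ × EuclideanSpace ℝ (Fin n) => G q.1 q.2 i j) Ω
  symm : ∀ q ∈ Ω, ∀ i j, G q.1 q.2 i j = G q.1 q.2 j i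
  det_ne_zero : ∀ q ∈ Ω, (G q.1 q.2).det ≠ 0

variable {G : ℝ → EuclideanSpace ℝ (Fin n) → Matrix (Fin n) (Fin n) ℝ}

namespace IsMetricFamily

/-- The family as a matrix of smooth functions. -/
noncomputable def mat (hG : IsMetricFamily Ω G) : Matrix (Fin n) (Fin n) (SmoothFun Ω) :=
  Matrix.of fun i j => SmoothFun.mk _ (hG.smooth i j)

theorem mat_map (hG : IsMetricFamily Ω G) (p : Ω) :
    hG.mat.map (SmoothFun.ev p) = G p.1.1 p.1.2 := rfl

theorem isUnit_det (hG : IsMetricFamily Ω G) : IsUnit hG.mat.det := by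
  refine SmoothFun.isUnit_of_ne_zero fun p => ?_
  rw [← SmoothFun.ev_apply, RingHom.map_det]
  exact hG.det_ne_zero p.1 p.2

/-- The calculus of the family. -/
noncomputable def calculus (hG : IsMetricFamily Ω G) : MetricCalculus (Fin n) (SmoothFun Ω) :=
  MetricCalculus.ofMetric (Dx hG.isOpen) (fun _ _ _ => SmoothFun.D_comm _ _ _ _) hG.mat
    (Matrix.ext fun i j => Subtype.ext (funext fun p : Ω => hG.symm p.1 p.2 j i)) hG.isUnit_det

theorem rep_g (hG : IsMetricFamily Ω G) (i j : Fin n) :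
    Rep (hG.calculus.g i j) fun t u => G t u i j := fun _ => rfl

theorem rep_gi (hG : IsMetricFamily Ω G) (i j : Fin n) :
    Rep (hG.calculus.gi i j) fun t u => (G t u)⁻¹ i j := fun p => by
  have h := congrArg (fun M : Matrix (Fin n) (Fin n) (SmoothFun Ω) => M.map (SmoothFun.ev p))
    (Matrix.nonsing_inv_mul hG.mat hG.isUnit_det)
  simp only [Matrix.map_mul] at h
  rw [Matrix.map_one _ (map_zero _) (map_one _), hG.mat_map] at h
  exact congrFun (congrFun (Matrix.inv_eq_left_inv h).symm i) j

theorem rep_Γ (hG : IsMetricFamily Ω G) (i j k : Fin n) :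
    Rep (hG.calculus.Γ i k j) fun t u => christoffel (G t) k i j u :=
  Rep.smul _ (Rep.sum fun l => (hG.rep_gi k l).mul
    ((((hG.rep_g j l).dx hG.isOpen i).add ((hG.rep_g i l).dx hG.isOpen j)).sub
      ((hG.rep_g i j).dx hG.isOpen l)))

theorem rep_hess (hG : IsMetricFamily Ω G) {f : SmoothFun Ω}
    {F : ℝ → EuclideanSpace ℝ (Fin n) → ℝ} (hf : Rep f F) (i j : Fin n) :
    Rep (hG.calculus.hess f i j) fun t u => hessian (G t) (F t) u i j :=
  ((hf.dx hG.isOpen j).dx hG.isOpen i).sub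
    (Rep.sum fun k => (hG.rep_Γ i j k).mul (hf.dx hG.isOpen k))

theorem rep_tr (hG : IsMetricFamily Ω G) {T : Fin n → Fin n → SmoothFun Ω}
    {T' : ℝ → EuclideanSpace ℝ (Fin n) → Matrix (Fin n) (Fin n) ℝ}
    (hT : ∀ i j, Rep (T i j) fun t u => T' t u i j) :
    Rep (hG.calculus.tr T) fun t u => traceWith (G t u) (T' t u) :=
  Rep.sum fun i => Rep.sum fun j => (hG.rep_gi i j).mul (hT i j)

theorem rep_lap (hG : IsMetricFamily Ω G) {f : SmoothFun Ω}
    {F : ℝ → EuclideanSpace ℝ (Fin n) → ℝ} (hf : Rep f F) :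
    Rep (hG.calculus.lap f) fun t u => traceWith (G t u) (hessian (G t) (F t) u) :=
  hG.rep_tr (hG.rep_hess hf)

theorem rep_pair (hG : IsMetricFamily Ω G) {f h : SmoothFun Ω}
    {F H : ℝ → EuclideanSpace ℝ (Fin n) → ℝ} (hf : Rep f F) (hh : Rep h H) :
    Rep (hG.calculus.pair (fun i => hG.calculus.D i f) fun i => hG.calculus.D i h)
      fun t u => gradPairing (G t) (F t) (H t) u :=
  hG.rep_tr (T' := fun t u => Matrix.of fun i j => pd i (F t) u * pd j (H t) u)
    fun i j => (hf.dx hG.isOpen i).mul (hh.dx hG.isOpen j)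

theorem rep_pair2 (hG : IsMetricFamily Ω G) {T : Fin n → Fin n → SmoothFun Ω}
    {T' : ℝ → EuclideanSpace ℝ (Fin n) → Matrix (Fin n) (Fin n) ℝ}
    (hT : ∀ i j, Rep (T i j) fun t u => T' t u i j) :
    Rep (hG.calculus.pair2 T T) fun t u => tensorNormSq (G t u) (T' t u) := by
  have h : Rep (hG.calculus.pair2 T T) fun t u => ∑ i, ∑ k, (G t u)⁻¹ i k *
      ∑ j, ∑ l, (G t u)⁻¹ j l * (T' t u i j * T' t u k l) :=
    Rep.sum fun i => Rep.sum fun k => (hG.rep_gi i k).mul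
      (Rep.sum fun j => Rep.sum fun l => (hG.rep_gi j l).mul ((hT i j).mul (hT k l)))
  refine h.congr fun p _ => ?_
  simp only [tensorNormSq, Finset.mul_sum]
  refine Finset.sum_congr rfl fun i _ => ?_
  rw [Finset.sum_comm]
  exact Finset.sum_congr rfl fun j _ => Finset.sum_congr rfl fun k _ =>
    Finset.sum_congr rfl fun l _ => by ring

theorem rep_ric (hG : IsMetricFamily Ω G) (i j : Fin n) :
    Rep (hG.calculus.ric i j) fun t u => ricci (G t) u i j := by
  have hs := hG.calculus.Γ_symm
  -- The trace of the curvature endomorphism matches the coordinate formula `ricci` once lower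
  -- indices of `Γ` are interchanged.
  have e : hG.calculus.ric i j =
      ∑ k, (hG.calculus.D k (hG.calculus.Γ i k j) - hG.calculus.D j (hG.calculus.Γ i k k))
      + ∑ k, ∑ l, (hG.calculus.Γ k k l * hG.calculus.Γ i l j
        - hG.calculus.Γ j k l * hG.calculus.Γ i l k) := by
    simp only [MetricCalculus.ric, MetricCalculus.curv, Matrix.add_apply, Matrix.sub_apply,
      Matrix.map_apply, Matrix.mul_apply, Finset.sum_add_distrib, Finset.sum_sub_distrib,
      hs j i, hs _ i]
    ring
  rw [e]
  exact (Rep.sum fun k => ((hG.rep_Γ i j k).dx hG.isOpen k).sub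
    ((hG.rep_Γ i k k).dx hG.isOpen j)).add (Rep.sum fun k => Rep.sum fun l =>
      ((hG.rep_Γ k l k).mul (hG.rep_Γ i j l)).sub ((hG.rep_Γ j l k).mul (hG.rep_Γ i k l)))

end IsMetricFamily

end OfMetric

/-! ### Metrics and differentials of maps in charts -/

section Charts

set_option linter.unusedSectionVars false

variable {n k : ℕ}
  {M : Type*} [TopologicalSpace M] [ChartedSpace (EuclideanSpace ℝ (Fin n)) M]
  [IsManifold (𝓡 n) ∞ M]
  {N : Type*} [TopologicalSpace N] [ChartedSpace (EuclideanSpace ℝ (Fin k)) N]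
  [IsManifold (𝓡 k) ∞ N]

/-- The coordinate field is the tangent map of the inverse chart composed with a constant section.
-/
theorem contMDiffOn_coordinateField {e : OpenPartialHomeomorph N (EuclideanSpace ℝ (Fin k))}
    (he : e ∈ charts k N) (v : EuclideanSpace ℝ (Fin k)) :
    ContMDiffOn (𝓡 k) (𝓡 k).tangent ∞ (fun u => (⟨e.symm u, mfderiv (𝓡 k) (𝓡 k) e.symm u v⟩ :
      TangentBundle (𝓡 k) N)) e.target := by
  have h1 := (contMDiffOn_symm_of_mem_maximalAtlas he).contMDiffOn_tangentMapWithin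
    (m := ∞) (by simp) e.open_target.uniqueMDiffOn
  have h2 : ContMDiff (𝓡 k) (𝓡 k).tangent ∞ (fun u : EuclideanSpace ℝ (Fin k) =>
      (⟨u, v⟩ : TangentBundle (𝓡 k) (EuclideanSpace ℝ (Fin k)))) :=
    contMDiff_vectorSpace_iff_contDiff.2 contDiff_const
  refine (h1.comp h2.contMDiffOn fun u hu => hu).congr fun u hu => ?_
  simp only [Function.comp, tangentMapWithin]
  rw [mfderivWithin_of_isOpen e.open_target hu]

theorem metricIn_contDiffOn (γ : RMetric k N)
    {e : OpenPartialHomeomorph N (EuclideanSpace ℝ (Fin k))} (he : e ∈ charts k N) (a b : Fin k) :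
    ContDiffOn ℝ ∞ (fun u => metricIn γ e u a b) e.target := by
  rw [← contMDiffOn_iff_contDiffOn]
  intro u hu
  have ha := contMDiffOn_coordinateField he (EuclideanSpace.single a 1) u hu
  have hb := contMDiffOn_coordinateField he (EuclideanSpace.single b 1) u hu
  have hs := contMDiffOn_symm_of_mem_maximalAtlas he u hu
  have : ContMDiffWithinAt (𝓡 k) ((𝓡 k).prod 𝓘(ℝ, ℝ)) ∞ (fun u =>
      (Bundle.TotalSpace.mk' ℝ (E := Bundle.Trivial N ℝ) (e.symm u) (metricIn γ e u a b)))
      e.target u := by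
    refine ContMDiffWithinAt.clm_bundle_apply₂ (F₁ := EuclideanSpace ℝ (Fin k))
      (F₂ := EuclideanSpace ℝ (Fin k))
      (ContMDiffAt.comp_contMDiffWithinAt u γ.contMDiff.contMDiffAt hs) ha hb
  rw [Bundle.contMDiffWithinAt_totalSpace] at this
  exact this.2

theorem mdifferentiableAt_chart {e : OpenPartialHomeomorph N (EuclideanSpace ℝ (Fin k))}
    (he : e ∈ charts k N) {y : N} (hy : y ∈ e.source) : MDifferentiableAt (𝓡 k) (𝓡 k) e y :=
  ((contMDiffOn_of_mem_maximalAtlas he).contMDiffAt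
    (e.open_source.mem_nhds hy)).mdifferentiableAt (by simp)

theorem mdifferentiableAt_chart_symm {e : OpenPartialHomeomorph N (EuclideanSpace ℝ (Fin k))}
    (he : e ∈ charts k N) {u : EuclideanSpace ℝ (Fin k)} (hu : u ∈ e.target) :
    MDifferentiableAt (𝓡 k) (𝓡 k) e.symm u :=
  ((contMDiffOn_symm_of_mem_maximalAtlas he).contMDiffAt
    (e.open_target.mem_nhds hu)).mdifferentiableAt (by simp)

theorem sum_single (w : EuclideanSpace ℝ (Fin k)) :
    w = ∑ a, w a • EuclideanSpace.single a (1 : ℝ) := by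
  ext b
  simp [Finset.sum_apply, Pi.single_apply]

/-- A map read in charts is differentiable. -/
theorem differentiableAt_inCharts {φ : M → N}
    {e : OpenPartialHomeomorph M (EuclideanSpace ℝ (Fin n))}
    {e' : OpenPartialHomeomorph N (EuclideanSpace ℝ (Fin k))} (he' : e' ∈ charts k N)
    {u : EuclideanSpace ℝ (Fin n)} (hφ : MDifferentiableAt (𝓡 n) (𝓡 k) (φ ∘ e.symm) u)
    (hu : φ (e.symm u) ∈ e'.source) :
    DifferentiableAt ℝ (fun z => e' (φ (e.symm z))) u := by
  rw [← mdifferentiableAt_iff_differentiableAt]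
  exact MDifferentiableAt.comp u (mdifferentiableAt_chart he' hu) hφ

theorem pd_mapComp {φ : M → N} {e : OpenPartialHomeomorph M (EuclideanSpace ℝ (Fin n))}
    {e' : OpenPartialHomeomorph N (EuclideanSpace ℝ (Fin k))} {u : EuclideanSpace ℝ (Fin n)}
    (h : DifferentiableAt ℝ (fun z => e' (φ (e.symm z))) u) (i : Fin n) (a : Fin k) :
    pd i (mapComp φ e e' a) u =
      fderiv ℝ (fun z => e' (φ (e.symm z))) u (EuclideanSpace.single i 1) a := by
  have h1 := ((EuclideanSpace.proj a : EuclideanSpace ℝ (Fin k) →L[ℝ] ℝ).hasFDerivAt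
    (x := e' (φ (e.symm u)))).comp u h.hasFDerivAt
  have h2 : fderiv ℝ (mapComp φ e e' a) u = _ := h1.fderiv
  rw [pd, h2]
  rfl

/-- The coordinate vector field `∂ₐ` of a chart. -/
noncomputable def coordField (e : OpenPartialHomeomorph N (EuclideanSpace ℝ (Fin k)))
    (u : EuclideanSpace ℝ (Fin k)) (a : Fin k) : EuclideanSpace ℝ (Fin k) :=
  mfderiv (𝓡 k) (𝓡 k) e.symm u (EuclideanSpace.single a (1 : ℝ))

/-- Near `u`, the map factors as its coordinate expression followed by the inverse chart of the
target; apply the chain rule and expand in the standard basis. -/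
theorem mfderiv_eq_sum {φ : M → N} {e : OpenPartialHomeomorph M (EuclideanSpace ℝ (Fin n))}
    {e' : OpenPartialHomeomorph N (EuclideanSpace ℝ (Fin k))} (he' : e' ∈ charts k N)
    {u : EuclideanSpace ℝ (Fin n)} (hφ : MDifferentiableAt (𝓡 n) (𝓡 k) (φ ∘ e.symm) u)
    (hu : φ (e.symm u) ∈ e'.source) (i : Fin n) :
    (mfderiv (𝓡 n) (𝓡 k) (φ ∘ e.symm) u (EuclideanSpace.single i (1 : ℝ)) :
      EuclideanSpace ℝ (Fin k)) =
    ∑ a, pd i (mapComp φ e e' a) u • coordField e' (e' (φ (e.symm u))) a := by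
  have hd := differentiableAt_inCharts he' hφ hu
  have hev : φ ∘ e.symm =ᶠ[nhds u] e'.symm ∘ fun z => e' (φ (e.symm z)) := by
    have : ∀ᶠ z in nhds u, φ (e.symm z) ∈ e'.source :=
      hφ.continuousAt.eventually (e'.open_source.mem_nhds hu)
    filter_upwards [this] with z hz
    exact (e'.left_inv hz).symm
  have hc : mfderiv (𝓡 n) (𝓡 k) (e'.symm ∘ fun z => e' (φ (e.symm z))) u =
      (mfderiv (𝓡 k) (𝓡 k) e'.symm (e' (φ (e.symm u)))).comp
        (mfderiv (𝓡 n) (𝓡 k) (fun z => e' (φ (e.symm z))) u) :=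
    mfderiv_comp u (mdifferentiableAt_chart_symm he' (e'.map_source hu)) hd.mdifferentiableAt
  have h3 : (mfderiv (𝓡 n) (𝓡 k) (φ ∘ e.symm) u (EuclideanSpace.single i (1 : ℝ)) :
      EuclideanSpace ℝ (Fin k)) = mfderiv (𝓡 k) (𝓡 k) e'.symm (e' (φ (e.symm u)))
      (fderiv ℝ (fun z => e' (φ (e.symm z))) u (EuclideanSpace.single i 1)) := by
    rw [hev.mfderiv_eq, hc, mfderiv_eq_fderiv]
    rfl
  rw [h3, sum_single (fderiv ℝ (fun z => e' (φ (e.symm z))) u (EuclideanSpace.single i 1))]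
  simp only [← pd_mapComp hd]
  exact (map_sum (mfderiv (𝓡 k) (𝓡 k) e'.symm (e' (φ (e.symm u)))) _ _).trans
    (Finset.sum_congr rfl fun a _ => map_smul _ _ _)

/-- The value of a metric at a point, as a bilinear form on the model space. -/
noncomputable def innerAt (γ : RMetric k N) (y : N) :
    EuclideanSpace ℝ (Fin k) →L[ℝ] EuclideanSpace ℝ (Fin k) →L[ℝ] ℝ := γ.inner y

theorem innerAt_sum {ι : Type*} [Fintype ι] (γ : RMetric k N) (y : N) (c d : ι → ℝ)
    (v : ι → EuclideanSpace ℝ (Fin k)) :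
    innerAt γ y (∑ a, c a • v a) (∑ a, d a • v a) =
      ∑ a, ∑ b, innerAt γ y (v a) (v b) * c a * d b := by
  simp only [map_sum, map_smul, sum_apply, smul_apply,
    smul_eq_mul, Finset.mul_sum]
  rw [Finset.sum_comm]
  exact Finset.sum_congr rfl fun a _ => Finset.sum_congr rfl fun b _ => by ring

theorem metricIn_apply (γ : RMetric k N) (e : OpenPartialHomeomorph N (EuclideanSpace ℝ (Fin k)))
    (u : EuclideanSpace ℝ (Fin k)) (a b : Fin k) : metricIn γ e u a b =
    innerAt γ (e.symm u) (coordField e u a) (coordField e u b) := rfl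

/-- The pullback of a metric in coordinates. -/
theorem pullbackIn_apply (γ : RMetric k N) {φ : M → N}
    {e : OpenPartialHomeomorph M (EuclideanSpace ℝ (Fin n))}
    {e' : OpenPartialHomeomorph N (EuclideanSpace ℝ (Fin k))} (he' : e' ∈ charts k N)
    {u : EuclideanSpace ℝ (Fin n)} (hφ : MDifferentiableAt (𝓡 n) (𝓡 k) (φ ∘ e.symm) u)
    (hu : φ (e.symm u) ∈ e'.source) (i j : Fin n) :
    pullbackIn γ φ e u i j = ∑ a, ∑ b, metricIn γ e' (e' (φ (e.symm u))) a b *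
      pd i (mapComp φ e e' a) u * pd j (mapComp φ e e' b) u := by
  have h : pullbackIn γ φ e u i j = innerAt γ (φ (e.symm u))
      (mfderiv (𝓡 n) (𝓡 k) (φ ∘ e.symm) u (EuclideanSpace.single i (1 : ℝ)))
      (mfderiv (𝓡 n) (𝓡 k) (φ ∘ e.symm) u (EuclideanSpace.single j (1 : ℝ))) := rfl
  rw [h, mfderiv_eq_sum he' hφ hu, mfderiv_eq_sum he' hφ hu, innerAt_sum]
  simp only [metricIn_apply, e'.left_inv hu]

theorem metricIn_symm (γ : RMetric k N) (e : OpenPartialHomeomorph N (EuclideanSpace ℝ (Fin k)))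
    (u : EuclideanSpace ℝ (Fin k)) (a b : Fin k) : metricIn γ e u a b = metricIn γ e u b a :=
  γ.symm _ _ _

/-- A kernel vector of the Gram matrix gives a tangent vector of length zero, which vanishes by
positivity; its coordinates then vanish because the differential of the inverse chart has a left
inverse. -/
theorem metricIn_det_ne_zero (γ : RMetric k N)
    {e : OpenPartialHomeomorph N (EuclideanSpace ℝ (Fin k))} (he : e ∈ charts k N)
    {u : EuclideanSpace ℝ (Fin k)} (hu : u ∈ e.target) : (metricIn γ e u).det ≠ 0 := by
  intro h0
  obtain ⟨c, hc, hc0⟩ := Matrix.exists_mulVec_eq_zero_iff.2 h0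
  set L := mfderiv (𝓡 k) (𝓡 k) e.symm u with hL
  set v : EuclideanSpace ℝ (Fin k) := ∑ a, c a • coordField e u a with hv
  have hvv : innerAt γ (e.symm u) v v = 0 := by
    rw [hv, innerAt_sum]
    have : ∀ a, ∑ b, metricIn γ e u a b * c b = 0 := fun a => congrFun hc0 a
    refine Finset.sum_eq_zero fun a _ => ?_
    have h2 : ∑ b, innerAt γ (e.symm u) (coordField e u a) (coordField e u b) * c a * c b =
        c a * ∑ b, metricIn γ e u a b * c b := by
      rw [Finset.mul_sum]
      exact Finset.sum_congr rfl fun b _ => by rw [metricIn_apply]; ring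
    rw [h2, this, mul_zero]
  have hv0 : v = 0 := by
    by_contra hne
    exact (γ.pos (e.symm u) v hne).ne' hvv
  have hLc : L (∑ a, c a • EuclideanSpace.single a (1 : ℝ)) = v :=
    (map_sum L _ _).trans (Finset.sum_congr rfl fun a _ => map_smul _ _ _)
  have hid : (mfderiv (𝓡 k) (𝓡 k) e (e.symm u)).comp L = ContinuousLinearMap.id ℝ _ := by
    rw [hL, ← mfderiv_comp u (mdifferentiableAt_chart he (e.map_target hu))
      (mdifferentiableAt_chart_symm he hu)]
    have : e ∘ e.symm =ᶠ[nhds u] id := by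
      filter_upwards [e.open_target.mem_nhds hu] with z hz
      exact e.right_inv hz
    rw [this.mfderiv_eq, mfderiv_id]
  have hz : (∑ a, c a • EuclideanSpace.single a (1 : ℝ) : EuclideanSpace ℝ (Fin k)) = 0 := by
    have := congrArg (fun T => T (∑ a, c a • EuclideanSpace.single a (1 : ℝ))) hid
    simp only [ContinuousLinearMap.comp_apply] at this
    rw [hLc, hv0] at this
    exact (this.symm.trans (map_zero _))
  refine hc (funext fun b => ?_)
  have := congrArg (fun w : EuclideanSpace ℝ (Fin k) => w b) hz
  simpa [Finset.sum_apply, Pi.single_apply] using this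

end Charts
-- Change of charts and chart independence of the scalars
section ChartChange

set_option linter.unusedSectionVars false

variable {n k : ℕ}
  {M : Type*} [TopologicalSpace M] [ChartedSpace (EuclideanSpace ℝ (Fin n)) M]
  [IsManifold (𝓡 n) ∞ M]
  {N : Type*} [TopologicalSpace N] [ChartedSpace (EuclideanSpace ℝ (Fin k)) N]
  [IsManifold (𝓡 k) ∞ N]

theorem traceWith_eq_trace (G A : Matrix (Fin n) (Fin n) ℝ) :
    traceWith G A = (G⁻¹ * A.transpose).trace := by
  simp [traceWith, Matrix.trace, Matrix.mul_apply]

theorem traceWith_congruence {G P : Matrix (Fin n) (Fin n) ℝ} (A : Matrix (Fin n) (Fin n) ℝ)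
    (hP : (P.transpose * G * P).det ≠ 0) :
    traceWith (P.transpose * G * P) (P.transpose * A * P) = traceWith G A := by
  have hu : IsUnit P.det := by
    refine isUnit_iff_ne_zero.2 fun h => hP ?_
    rw [Matrix.det_mul, h, mul_zero]
  have hu' : IsUnit P.transpose.det := by rwa [Matrix.det_transpose]
  rw [traceWith_eq_trace, traceWith_eq_trace, Matrix.mul_inv_rev, Matrix.mul_inv_rev,
    Matrix.transpose_mul, Matrix.transpose_mul, Matrix.transpose_transpose]
  have : P⁻¹ * (G⁻¹ * P.transpose⁻¹) * (P.transpose * (A.transpose * P)) =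
      P⁻¹ * (G⁻¹ * (P.transpose⁻¹ * P.transpose) * A.transpose * P) := by
    noncomm_ring
  rw [this, Matrix.nonsing_inv_mul _ hu', Matrix.trace_mul_comm, Matrix.mul_one, Matrix.mul_assoc,
    Matrix.mul_nonsing_inv _ hu, Matrix.mul_one]

/-- The Jacobian matrix of the change of coordinates from `e` to `e₂`. -/
noncomputable def jac (e e₂ : OpenPartialHomeomorph M (EuclideanSpace ℝ (Fin n))) (x : M) :
    Matrix (Fin n) (Fin n) ℝ :=
  Matrix.of fun a i => pd i (mapComp id e e₂ a) (e x)

variable {e e₂ : OpenPartialHomeomorph M (EuclideanSpace ℝ (Fin n))}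

/-- A metric in a chart is its own pullback under the identity map, so this is a case of
`pullbackIn_apply`. -/
theorem metricIn_change (he : e ∈ charts n M) (he₂ : e₂ ∈ charts n M) (g : RMetric n M) {x : M}
    (hx : x ∈ e.source) (hx₂ : x ∈ e₂.source) :
    metricIn g e (e x) = (jac e e₂ x).transpose * metricIn g e₂ (e₂ x) * jac e e₂ x := by
  ext i j
  have h := pullbackIn_apply g (φ := id) (e := e) he₂ (u := e x)
    (mdifferentiableAt_chart_symm he (e.map_source hx)) (by simpa [e.left_inv hx] using hx₂) i j
  have h' : metricIn g e (e x) i j = pullbackIn g id e (e x) i j := rfl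
  rw [h', h]
  simp only [id, e.left_inv hx, Matrix.mul_apply, Matrix.transpose_apply, Finset.sum_mul, jac,
    Matrix.of_apply]
  rw [Finset.sum_comm]
  exact Finset.sum_congr rfl fun b _ => Finset.sum_congr rfl fun a _ => by ring

theorem traceWith_change (he : e ∈ charts n M) (he₂ : e₂ ∈ charts n M) (g : RMetric n M) {x : M}
    (hx : x ∈ e.source) (hx₂ : x ∈ e₂.source) (A : Matrix (Fin n) (Fin n) ℝ) :
    traceWith (metricIn g e (e x)) ((jac e e₂ x).transpose * A * jac e e₂ x) =
      traceWith (metricIn g e₂ (e₂ x)) A := by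
  have h := metricIn_det_ne_zero g he (e.map_source hx)
  rw [metricIn_change he he₂ g hx hx₂] at h ⊢
  exact traceWith_congruence A h

theorem pd_change (he : e ∈ charts n M) (he₂ : e₂ ∈ charts n M) {x : M}
    (hx : x ∈ e.source) (hx₂ : x ∈ e₂.source) {f : M → ℝ}
    (hf : DifferentiableAt ℝ (f ∘ e₂.symm) (e₂ x)) (i : Fin n) :
    pd i (f ∘ e.symm) (e x) = ∑ a, jac e e₂ x a i * pd a (f ∘ e₂.symm) (e₂ x) := by
  have hs := mdifferentiableAt_chart_symm he (e.map_source hx)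
  have hsrc : id (e.symm (e x)) ∈ e₂.source := by simpa [e.left_inv hx] using hx₂
  have hd := differentiableAt_inCharts (φ := id) (e := e) he₂ (u := e x) hs hsrc
  have hev : f ∘ e.symm =ᶠ[nhds (e x)] (f ∘ e₂.symm) ∘ fun z => e₂ (id (e.symm z)) := by
    have : ∀ᶠ z in nhds (e x), e.symm z ∈ e₂.source :=
      hs.continuousAt.eventually (e₂.open_source.mem_nhds hsrc)
    filter_upwards [this] with z hz
    simp [e₂.left_inv hz]
  have hval : e₂ (id (e.symm (e x))) = e₂ x := by simp [e.left_inv hx]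
  rw [pd, hev.fderiv_eq, fderiv_comp _ (by rw [hval]; exact hf) hd, hval,
    ContinuousLinearMap.comp_apply,
    sum_single (fderiv ℝ (fun z => e₂ (id (e.symm z))) (e x) (EuclideanSpace.single i 1)), map_sum]
  refine Finset.sum_congr rfl fun a _ => ?_
  rw [map_smul, smul_eq_mul, ← pd_mapComp hd]
  rfl

theorem gradPairing_change (he : e ∈ charts n M) (he₂ : e₂ ∈ charts n M) (g : RMetric n M) {x : M}
    (hx : x ∈ e.source) (hx₂ : x ∈ e₂.source) {f : M → ℝ}
    (hf : DifferentiableAt ℝ (f ∘ e₂.symm) (e₂ x)) :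
    gradPairing (metricIn g e) (f ∘ e.symm) (f ∘ e.symm) (e x) =
      gradPairing (metricIn g e₂) (f ∘ e₂.symm) (f ∘ e₂.symm) (e₂ x) := by
  rw [gradPairing, gradPairing, ← traceWith_change he he₂ g hx hx₂]
  congr 1
  ext i j
  simp only [Matrix.of_apply, pd_change he he₂ hx hx₂ hf, Matrix.mul_apply,
    Matrix.transpose_apply, Finset.sum_mul, Finset.mul_sum]
  exact Finset.sum_congr rfl fun b _ => Finset.sum_congr rfl fun a _ => by ring

variable {J : Set ℝ} {g : ℝ → RMetric n M} {γ : RMetric k N} {φ : ℝ → M → N} {α : ℝ → ℝ}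

theorem differentiableAt_metricIn (hJ : IsOpen J) (hflow : IsHarmonicRicciFlow J g γ φ α)
    (he : e ∈ charts n M) {t : ℝ} (ht : t ∈ J) {u : EuclideanSpace ℝ (Fin n)} (hu : u ∈ e.target)
    (i j : Fin n) : DifferentiableAt ℝ (fun s => metricIn (g s) e u i j) t := by
  have h := ((hflow.metric_smooth e he i j).contDiffAt
    ((hJ.prod e.open_target).mem_nhds (x := (t, u)) ⟨ht, hu⟩)).differentiableAt (by simp)
  exact DifferentiableAt.comp (f := fun s : ℝ => (s, u)) t h
    (differentiableAt_id.prodMk (differentiableAt_const _))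

/-- By the flow equation, the transformation law of `S` is inherited from that of `g`; tensoriality
of the coordinate Ricci formula need not be shown. -/
theorem tensorSIn_eq_deriv (hflow : IsHarmonicRicciFlow J g γ φ α) (he : e ∈ charts n M)
    {t : ℝ} (ht : t ∈ J) {u : EuclideanSpace ℝ (Fin n)} (hu : u ∈ e.target) (i j : Fin n) :
    tensorSIn (g t) γ (φ t) (α t) e u i j =
      -(1 / 2) * deriv (fun s => metricIn (g s) e u i j) t := by
  rw [hflow.metric_eq t ht e he u hu i j]
  simp only [tensorSIn, Matrix.sub_apply, Matrix.smul_apply, smul_eq_mul]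
  ring

/-- The Jacobian does not depend on time, so the transformation law of `g` may be differentiated in
time term by term. -/
theorem tensorSIn_change (hJ : IsOpen J) (hflow : IsHarmonicRicciFlow J g γ φ α)
    (he : e ∈ charts n M) (he₂ : e₂ ∈ charts n M) {t : ℝ} (ht : t ∈ J) {x : M}
    (hx : x ∈ e.source) (hx₂ : x ∈ e₂.source) :
    tensorSIn (g t) γ (φ t) (α t) e (e x) =
      (jac e e₂ x).transpose * tensorSIn (g t) γ (φ t) (α t) e₂ (e₂ x) * jac e e₂ x := by
  ext i j
  rw [tensorSIn_eq_deriv hflow he ht (e.map_source hx)]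
  have h : (fun s => metricIn (g s) e (e x) i j) = fun s => ∑ b, ∑ a,
      jac e e₂ x a i * metricIn (g s) e₂ (e₂ x) a b * jac e e₂ x b j := by
    funext s
    rw [metricIn_change he he₂ (g s) hx hx₂]
    simp only [Matrix.mul_apply, Matrix.transpose_apply, Finset.sum_mul]
  have hd : HasDerivAt (fun s => ∑ b, ∑ a,
      jac e e₂ x a i * metricIn (g s) e₂ (e₂ x) a b * jac e e₂ x b j)
      (∑ b, ∑ a, jac e e₂ x a i * deriv (fun s => metricIn (g s) e₂ (e₂ x) a b) t
        * jac e e₂ x b j) t :=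
    HasDerivAt.fun_sum fun b _ => HasDerivAt.fun_sum fun a _ =>
      ((differentiableAt_metricIn hJ hflow he₂ ht (e₂.map_source hx₂) a b).hasDerivAt.const_mul
        _).mul_const _
  rw [h, hd.deriv, Finset.mul_sum]
  simp only [Matrix.mul_apply, Matrix.transpose_apply, Finset.sum_mul, Finset.mul_sum,
    tensorSIn_eq_deriv hflow he₂ ht (e₂.map_source hx₂)]
  exact Finset.sum_congr rfl fun b _ => Finset.sum_congr rfl fun a _ => by ring

/-- The trace of `S` may be computed in any chart. -/
theorem traceS_eq (hJ : IsOpen J) (hflow : IsHarmonicRicciFlow J g γ φ α)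
    (he : e ∈ charts n M) {t : ℝ} (ht : t ∈ J) {x : M} (hx : x ∈ e.source) :
    traceS (g t) γ (φ t) (α t) x =
      traceWith (metricIn (g t) e (e x)) (tensorSIn (g t) γ (φ t) (α t) e (e x)) := by
  have he₂ : chartAt (EuclideanSpace ℝ (Fin n)) x ∈ charts n M :=
    IsManifold.chart_mem_maximalAtlas x
  have hx₂ := mem_chart_source (EuclideanSpace ℝ (Fin n)) x
  rw [tensorSIn_change hJ hflow he he₂ ht hx hx₂, traceWith_change he he₂ (g t) hx hx₂]
  rfl

theorem contMDiffOn_inChart {P : Type*} [TopologicalSpace P] {F : Type*} [NormedAddCommGroup F]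
    [NormedSpace ℝ F] [ChartedSpace F P] {f : ℝ → M → P}
    (hf : ContMDiffOn (𝓘(ℝ, ℝ).prod (𝓡 n)) 𝓘(ℝ, F) ∞ (fun p : ℝ × M => f p.1 p.2)
      (J ×ˢ Set.univ)) (he : e ∈ charts n M) :
    ContMDiffOn 𝓘(ℝ, ℝ × EuclideanSpace ℝ (Fin n)) 𝓘(ℝ, F) ∞
      (fun q : ℝ × EuclideanSpace ℝ (Fin n) => f q.1 (e.symm q.2)) (J ×ˢ e.target) := by
  have h1 : ContMDiffOn 𝓘(ℝ, ℝ × EuclideanSpace ℝ (Fin n)) (𝓘(ℝ, ℝ).prod (𝓡 n)) ∞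
      (fun q : ℝ × EuclideanSpace ℝ (Fin n) => (q.1, e.symm q.2)) (J ×ˢ e.target) :=
    contDiff_fst.contMDiff.contMDiffOn.prodMk
      ((contMDiffOn_symm_of_mem_maximalAtlas he).comp contDiff_snd.contMDiff.contMDiffOn
        fun q hq => hq.2)
  exact hf.comp h1 fun q hq => ⟨hq.1, trivial⟩

theorem contDiffOn_inChart {l : ℝ → M → ℝ}
    (hl : ContMDiffOn (𝓘(ℝ, ℝ).prod (𝓡 n)) 𝓘(ℝ, ℝ) ∞ (fun p : ℝ × M => l p.1 p.2)
      (J ×ˢ Set.univ)) (he : e ∈ charts n M) :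
    ContDiffOn ℝ ∞ (fun q : ℝ × EuclideanSpace ℝ (Fin n) => l q.1 (e.symm q.2)) (J ×ˢ e.target) :=
  contMDiffOn_iff_contDiffOn.1 (contMDiffOn_inChart hl he)

theorem isMetricFamily_metricIn (hflow : IsHarmonicRicciFlow J g γ φ α) (he : e ∈ charts n M)
    {Ω : Set (ℝ × EuclideanSpace ℝ (Fin n))} (hΩ : IsOpen Ω) (hsub : Ω ⊆ J ×ˢ e.target) :
    IsMetricFamily Ω fun t => metricIn (g t) e where
  isOpen := hΩ
  smooth i j := (hflow.metric_smooth e he i j).mono hsub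
  symm _ _ _ _ := metricIn_symm _ _ _ _ _
  det_ne_zero _ hq := metricIn_det_ne_zero _ he (hsub hq).2

/-- `v = (4π(T-t))^{-n/2} e^{-l}` in a chart, as a smooth function. -/
theorem kernelOf_contDiffOn {T : ℝ} (hJT : J ⊆ Set.Iio T) {l : ℝ → M → ℝ}
    (hl : ContMDiffOn (𝓘(ℝ, ℝ).prod (𝓡 n)) 𝓘(ℝ, ℝ) ∞ (fun p : ℝ × M => l p.1 p.2)
      (J ×ˢ Set.univ)) (he : e ∈ charts n M) :
    ContDiffOn ℝ ∞ (fun q : ℝ × EuclideanSpace ℝ (Fin n) => kernelOf n T l q.1 (e.symm q.2))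
      (J ×ˢ e.target) := by
  have h1 : ContDiffOn ℝ ∞ (fun q : ℝ × EuclideanSpace ℝ (Fin n) => 4 * Real.pi * (T - q.1))
      (J ×ˢ e.target) :=
    (contDiff_const.mul (contDiff_const.sub contDiff_fst)).contDiffOn
  refine (h1.rpow_const_of_ne fun q hq => ?_).mul ((contDiffOn_inChart hl he).neg.exp)
  have : 0 < T - q.1 := sub_pos.2 (hJT hq.1)
  positivity

theorem kernelOf_ne_zero {T : ℝ} (hJT : J ⊆ Set.Iio T) (l : ℝ → M → ℝ) {t : ℝ} (ht : t ∈ J)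
    (x : M) : kernelOf n T l t x ≠ 0 := by
  have : 0 < T - t := sub_pos.2 (hJT ht)
  unfold kernelOf
  positivity

variable {Ω : Set (ℝ × EuclideanSpace ℝ (Fin n))} {T : ℝ} {l : ℝ → M → ℝ}

theorem dx_kernelOf (hΩ : IsOpen Ω) {L v : SmoothFun Ω}
    (hL : Rep L fun t u => l t (e.symm u)) (hv : Rep v fun t u => kernelOf n T l t (e.symm u))
    (i : Fin n) : Dx hΩ i v = -(v * Dx hΩ i L) := by
  refine Subtype.ext (funext fun p => ?_)
  have h1 := hv.dx hΩ i p
  have h2 := hL.dx hΩ i p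
  change (Dx hΩ i v).1 p = -(v.1 p * (Dx hΩ i L).1 p)
  rw [h1, h2, hv p]
  have hd : DifferentiableAt ℝ (fun u => l p.1.1 (e.symm u)) p.1.2 :=
    DifferentiableAt.comp (f := fun u : EuclideanSpace ℝ (Fin n) => (p.1.1, u)) p.1.2
      (hL.hasFDerivAt hΩ p).differentiableAt
      ((differentiableAt_const _).prodMk differentiableAt_id)
  have hk : HasFDerivAt (fun u => kernelOf n T l p.1.1 (e.symm u)) _ p.1.2 :=
    (hd.hasFDerivAt.neg.exp).const_mul ((4 * Real.pi * (T - p.1.1)) ^ (-(n : ℝ) / 2))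
  change fderiv ℝ (fun u => kernelOf n T l p.1.1 (e.symm u)) p.1.2 _ =
    -(_ * fderiv ℝ (fun u => l p.1.1 (e.symm u)) p.1.2 _)
  rw [hk.fderiv]
  simp only [kernelOf, smul_apply, neg_apply, Pi.neg_apply, smul_eq_mul]
  ring

/-- `n/(2(T-t))` is the logarithmic time derivative of the factor `(4π(T-t))^{-n/2}`. -/
theorem dt_kernelOf (hΩ : IsOpen Ω) (hT : ∀ q ∈ Ω, q.1 < T) {L v ν : SmoothFun Ω}
    (hL : Rep L fun t u => l t (e.symm u)) (hv : Rep v fun t u => kernelOf n T l t (e.symm u))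
    (hν : Rep ν fun t _ => n / (2 * (T - t))) : Dt hΩ v = v * (ν - Dt hΩ L) := by
  refine Subtype.ext (funext fun p => ?_)
  have h1 := hv.hasDerivAt hΩ p
  have h2 := hL.hasDerivAt hΩ p
  have hpos : 0 < T - p.1.1 := sub_pos.2 (hT p.1 p.2)
  have hpos' : 0 < 4 * Real.pi * (T - p.1.1) := by positivity
  have hb : HasDerivAt (fun s => 4 * Real.pi * (T - s)) (4 * Real.pi * (0 - 1)) p.1.1 :=
    ((hasDerivAt_const _ _).sub (hasDerivAt_id _)).const_mul _
  have hk : HasDerivAt (fun s => kernelOf n T l s (e.symm p.1.2)) _ p.1.1 :=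
    (hb.rpow_const (p := -(n : ℝ) / 2) (Or.inl hpos'.ne')).mul h2.neg.exp
  change (Dt hΩ v).1 p = v.1 p * (ν.1 p - (Dt hΩ L).1 p)
  rw [h1.unique hk, hv p, hν p, Real.rpow_sub_one hpos'.ne']
  simp only [kernelOf, Pi.neg_apply]
  field_simp
  ring

/-- The Laplacian of `v`. -/
theorem laplacianIn_kernelOf (hJ : IsOpen J) (hJT : J ⊆ Set.Iio T)
    (hflow : IsHarmonicRicciFlow J g γ φ α)
    (hl : ContMDiffOn (𝓘(ℝ, ℝ).prod (𝓡 n)) 𝓘(ℝ, ℝ) ∞ (fun p : ℝ × M => l p.1 p.2)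
      (J ×ˢ Set.univ)) (he : e ∈ charts n M) {t : ℝ} (ht : t ∈ J) {x : M} (hx : x ∈ e.source) :
    laplacianIn (g t) e (kernelOf n T l t) x = kernelOf n T l t x *
      (gradPairing (metricIn (g t) e) (l t ∘ e.symm) (l t ∘ e.symm) (e x)
        - laplacianIn (g t) e (l t) x) := by
  have hΩ := hJ.prod e.open_target
  have hG := isMetricFamily_metricIn hflow he hΩ subset_rfl
  have hL := rep_mk (F := fun t u => l t (e.symm u)) (contDiffOn_inChart hl he)
  have hv := rep_mk (F := fun t u => kernelOf n T l t (e.symm u)) (kernelOf_contDiffOn hJT hl he)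
  have h := MetricCalculus.lap_of_D_eq (X := hG.calculus) (dx_kernelOf hΩ hL hv)
  have h' := (hv.mul ((hG.rep_pair hL hL).sub (hG.rep_lap hL))) ⟨(t, e x), ht, e.map_source hx⟩
  rw [← h, hG.rep_lap hv] at h'
  simp only [e.left_inv hx] at h'
  exact h'

theorem differentiableAt_inChart (hJ : IsOpen J)
    (hl : ContMDiffOn (𝓘(ℝ, ℝ).prod (𝓡 n)) 𝓘(ℝ, ℝ) ∞ (fun p : ℝ × M => l p.1 p.2)
      (J ×ˢ Set.univ)) (he : e ∈ charts n M) {t : ℝ} (ht : t ∈ J)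
    {u : EuclideanSpace ℝ (Fin n)} (hu : u ∈ e.target) :
    DifferentiableAt ℝ (l t ∘ e.symm) u := by
  have h := ((contDiffOn_inChart hl he).contDiffAt
    ((hJ.prod e.open_target).mem_nhds (x := (t, u)) ⟨ht, hu⟩)).differentiableAt (by simp)
  exact DifferentiableAt.comp (f := fun u : EuclideanSpace ℝ (Fin n) => (t, u)) u h
    ((differentiableAt_const _).prodMk differentiableAt_id)

/-- `|∇l|²` may be computed in any chart. -/
theorem gradSq_eq (hJ : IsOpen J)
    (hl : ContMDiffOn (𝓘(ℝ, ℝ).prod (𝓡 n)) 𝓘(ℝ, ℝ) ∞ (fun p : ℝ × M => l p.1 p.2)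
      (J ×ˢ Set.univ)) (he : e ∈ charts n M) {t : ℝ} (ht : t ∈ J) {x : M} (hx : x ∈ e.source) :
    gradSq (g t) (l t) x =
      gradPairing (metricIn (g t) e) (l t ∘ e.symm) (l t ∘ e.symm) (e x) := by
  have he₂ : chartAt (EuclideanSpace ℝ (Fin n)) x ∈ charts n M :=
    IsManifold.chart_mem_maximalAtlas x
  have hx₂ := mem_chart_source (EuclideanSpace ℝ (Fin n)) x
  exact (gradPairing_change he he₂ (g t) hx hx₂ (differentiableAt_inChart hJ hl he₂ ht
    ((chartAt _ x).map_source hx₂))).symm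

/-- If `v` solves the adjoint heat equation in all charts, the Laplacian of `l` may be computed in
any chart. -/
theorem laplacian_eq (hJ : IsOpen J) (hJT : J ⊆ Set.Iio T)
    (hflow : IsHarmonicRicciFlow J g γ φ α)
    (hl : ContMDiffOn (𝓘(ℝ, ℝ).prod (𝓡 n)) 𝓘(ℝ, ℝ) ∞ (fun p : ℝ × M => l p.1 p.2)
      (J ×ˢ Set.univ))
    (hv : ∀ t ∈ J, ∀ e ∈ charts n M, ∀ x ∈ e.source,
      adjointHeatIn g γ φ α e (kernelOf n T l) t x = 0)
    (he : e ∈ charts n M) {t : ℝ} (ht : t ∈ J) {x : M} (hx : x ∈ e.source) :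
    laplacian (g t) (l t) x = laplacianIn (g t) e (l t) x := by
  have he₂ : chartAt (EuclideanSpace ℝ (Fin n)) x ∈ charts n M :=
    IsManifold.chart_mem_maximalAtlas x
  have hx₂ := mem_chart_source (EuclideanSpace ℝ (Fin n)) x
  -- The two equations share the time derivative of `v`, the trace of `S` and `|∇l|²`, so their
  -- difference compares the two Laplacians of `l`, multiplied by the nonzero `v`.
  have h1 := hv t ht e he x hx
  have h2 := hv t ht _ he₂ x hx₂
  rw [adjointHeatIn, laplacianIn_kernelOf hJ hJT hflow hl he ht hx, ← gradSq_eq (g := g) hJ hl he ht hx]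
    at h1
  rw [adjointHeatIn, laplacianIn_kernelOf hJ hJT hflow hl he₂ ht hx₂,
    ← gradSq_eq (g := g) hJ hl he₂ ht hx₂] at h2
  refine mul_left_cancel₀ (kernelOf_ne_zero (n := n) hJT l ht x) ?_
  unfold laplacian
  linear_combination h2 - h1

end ChartChange
-- The target geometry along the map, and restriction to a time slice
section FlowInChart

set_option linter.unusedSectionVars false

variable {n k : ℕ}
  {M : Type*} [TopologicalSpace M] [ChartedSpace (EuclideanSpace ℝ (Fin n)) M]
  [IsManifold (𝓡 n) ∞ M]
  {N : Type*} [TopologicalSpace N] [ChartedSpace (EuclideanSpace ℝ (Fin k)) N]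
  [IsManifold (𝓡 k) ∞ N]

/-- Viewing the target metric as constant in time makes the calculus of families available for it;
its consequences are read off at time 0. -/
theorem isMetricFamily_const (γ : RMetric k N)
    {e : OpenPartialHomeomorph N (EuclideanSpace ℝ (Fin k))} (he : e ∈ charts k N) :
    IsMetricFamily (Set.univ ×ˢ e.target) fun _ => metricIn γ e where
  isOpen := isOpen_univ.prod e.open_target
  smooth a b := (metricIn_contDiffOn γ he a b).comp contDiff_snd.contDiffOn fun _ hq => hq.2
  symm _ _ _ _ := metricIn_symm _ _ _ _ _
  det_ne_zero _ hq := metricIn_det_ne_zero _ he hq.2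

theorem christoffel_contDiffOn (γ : RMetric k N)
    {e : OpenPartialHomeomorph N (EuclideanSpace ℝ (Fin k))} (he : e ∈ charts k N)
    (a b c : Fin k) : ContDiffOn ℝ ∞ (christoffel (metricIn γ e) a b c) e.target := by
  have hG := isMetricFamily_const γ he
  refine ((SmoothFun.rep_contDiffOn (hG.calculus.Γ b a c)).comp
    ((contDiff_const (c := (0 : ℝ))).prodMk contDiff_id).contDiffOn
    fun u hu => ⟨trivial, hu⟩).congr fun u hu => ?_
  have h := hG.rep_Γ b c a ⟨(0, u), trivial, hu⟩
  rw [SmoothFun.rep_eq] at h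
  exact h.symm

theorem christoffel_symm (γ : RMetric k N)
    {e : OpenPartialHomeomorph N (EuclideanSpace ℝ (Fin k))} (he : e ∈ charts k N)
    (a b c : Fin k) {y : EuclideanSpace ℝ (Fin k)} (hy : y ∈ e.target) :
    christoffel (metricIn γ e) a b c y = christoffel (metricIn γ e) a c b y := by
  have hG := isMetricFamily_const γ he
  have h := hG.rep_Γ b c a ⟨(0, y), trivial, hy⟩
  rw [hG.calculus.Γ_symm, hG.rep_Γ] at h
  exact h.symm

/-- The metric of the target is parallel. -/
theorem pd_metricIn (γ : RMetric k N)
    {e : OpenPartialHomeomorph N (EuclideanSpace ℝ (Fin k))} (he : e ∈ charts k N)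
    (c a b : Fin k) {y : EuclideanSpace ℝ (Fin k)} (hy : y ∈ e.target) :
    pd c (fun z => metricIn γ e z a b) y =
      ∑ d, christoffel (metricIn γ e) d c a y * metricIn γ e y d b
        + ∑ d, christoffel (metricIn γ e) d c b y * metricIn γ e y a d := by
  have hG := isMetricFamily_const γ he
  have h1 := (hG.rep_g a b).dx hG.isOpen c ⟨(0, y), trivial, hy⟩
  have h2 : Rep (∑ d, hG.calculus.Γ c d a * hG.calculus.g d b
      + ∑ d, hG.calculus.Γ c d b * hG.calculus.g a d) _ :=
    (Rep.sum fun d => (hG.rep_Γ c a d).mul (hG.rep_g d b)).add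
      (Rep.sum fun d => (hG.rep_Γ c b d).mul (hG.rep_g a d))
  rw [← MetricCalculus.D_g_apply] at h2
  exact h1.symm.trans (h2 ⟨(0, y), trivial, hy⟩)

/-- A map into `N`, read in charts on an open set of times and coordinates. -/
structure IsMapFamily (Ω : Set (ℝ × EuclideanSpace ℝ (Fin n))) (φ : ℝ → M → N)
    (e : OpenPartialHomeomorph M (EuclideanSpace ℝ (Fin n)))
    (e' : OpenPartialHomeomorph N (EuclideanSpace ℝ (Fin k))) : Prop where
  mem_charts : e' ∈ charts k N
  smooth : ContDiffOn ℝ ∞ (fun q : ℝ × EuclideanSpace ℝ (Fin n) => e' (φ q.1 (e.symm q.2))) Ω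
  mem_source : ∀ q ∈ Ω, φ q.1 (e.symm q.2) ∈ e'.source

variable {Ω : Set (ℝ × EuclideanSpace ℝ (Fin n))} {φ : ℝ → M → N}
  {e : OpenPartialHomeomorph M (EuclideanSpace ℝ (Fin n))}
  {e' : OpenPartialHomeomorph N (EuclideanSpace ℝ (Fin k))}

namespace IsMapFamily

/-- The data of the map over the ring of smooth functions. -/
noncomputable def calculus (hφ : IsMapFamily Ω φ e e') (γ : RMetric k N) :
    MapCalculus (Fin k) (SmoothFun Ω) where
  φ a := SmoothFun.mk (fun q => mapComp (φ q.1) e e' a q.2)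
    ((EuclideanSpace.proj a : EuclideanSpace ℝ (Fin k) →L[ℝ] ℝ).contDiff.comp_contDiffOn hφ.smooth)
  H a b := SmoothFun.mk (fun q => metricIn γ e' (e' (φ q.1 (e.symm q.2))) a b)
    ((metricIn_contDiffOn γ hφ.mem_charts a b).comp hφ.smooth
      fun q hq => e'.map_source (hφ.mem_source q hq))
  ΓN a b c := SmoothFun.mk (fun q => christoffel (metricIn γ e') a b c (e' (φ q.1 (e.symm q.2))))
    ((christoffel_contDiffOn γ hφ.mem_charts a b c).comp hφ.smooth
      fun q hq => e'.map_source (hφ.mem_source q hq))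
  H_symm _ _ := Subtype.ext (funext fun _ => metricIn_symm _ _ _ _ _)
  ΓN_symm a b c := Subtype.ext (funext fun p => christoffel_symm γ hφ.mem_charts a b c
    (e'.map_source (hφ.mem_source p.1 p.2)))

/-- The chain rule reduces a derivative of the target metric along the map to `pd_metricIn`. It
holds for every direction `w`, in space as in time. -/
theorem isCompat (hφ : IsMapFamily Ω φ e e') (γ : RMetric k N) (hΩ : IsOpen Ω)
    (w : ℝ × EuclideanSpace ℝ (Fin n)) : (hφ.calculus γ).IsCompat (SmoothFun.D hΩ w) := by
  intro a b
  refine Subtype.ext (funext fun p => ?_)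
  set Φ := fun q : ℝ × EuclideanSpace ℝ (Fin n) => e' (φ q.1 (e.symm q.2)) with hΦ
  have hy : Φ p.1 ∈ e'.target := e'.map_source (hφ.mem_source p.1 p.2)
  have hd : DifferentiableAt ℝ Φ p.1 :=
    (hφ.smooth.contDiffAt (hΩ.mem_nhds p.2)).differentiableAt (by simp)
  have hH : DifferentiableAt ℝ (fun z => metricIn γ e' z a b) (Φ p.1) :=
    ((metricIn_contDiffOn γ hφ.mem_charts a b).contDiffAt
      (e'.open_target.mem_nhds hy)).differentiableAt (by simp)
  have h1 : (SmoothFun.D hΩ w ((hφ.calculus γ).H a b)).1 p =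
      fderiv ℝ ((fun z => metricIn γ e' z a b) ∘ Φ) p.1 w :=
    SmoothFun.D_apply hΩ w _ (fun q => rfl) p
  have h2 : ∀ c, (SmoothFun.D hΩ w ((hφ.calculus γ).φ c)).1 p = fderiv ℝ Φ p.1 w c := fun c => by
    have h := ((EuclideanSpace.proj c : EuclideanSpace ℝ (Fin k) →L[ℝ] ℝ).hasFDerivAt
      (x := Φ p.1)).comp p.1 hd.hasFDerivAt
    refine (SmoothFun.D_apply hΩ w _ (F := (EuclideanSpace.proj c :
      EuclideanSpace ℝ (Fin k) →L[ℝ] ℝ) ∘ Φ) (fun q => rfl) p).trans ?_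
    rw [h.fderiv]
    rfl
  rw [h1, fderiv_comp _ hH hd, ContinuousLinearMap.comp_apply, sum_single (fderiv ℝ Φ p.1 w),
    map_sum, ← SmoothFun.ev_apply, map_sum]
  refine Finset.sum_congr rfl fun c _ => ?_
  rw [map_smul, smul_eq_mul, map_mul, SmoothFun.ev_apply, h2]
  congr 1
  refine (pd_metricIn γ hφ.mem_charts c a b hy).trans ?_
  simp only [map_add, map_sum, map_mul]
  rfl

theorem rep_φ (hφ : IsMapFamily Ω φ e e') (γ : RMetric k N) (a : Fin k) :
    Rep ((hφ.calculus γ).φ a) fun t u => mapComp (φ t) e e' a u := fun _ => rfl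

theorem rep_ip (hφ : IsMapFamily Ω φ e e') (γ : RMetric k N) {V W : Fin k → SmoothFun Ω}
    {V' W' : Fin k → ℝ → EuclideanSpace ℝ (Fin n) → ℝ} (hV : ∀ a, Rep (V a) (V' a))
    (hW : ∀ a, Rep (W a) (W' a)) : Rep ((hφ.calculus γ).ip V W) fun t u =>
      ∑ a, ∑ b, metricIn γ e' (e' (φ t (e.symm u))) a b * V' a t u * W' b t u :=
  Rep.sum fun a => Rep.sum fun b => Rep.mul (Rep.mul (fun _ => rfl) (hV a)) (hW b)

variable {g : ℝ → RMetric n M}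

theorem rep_pb (hφ : IsMapFamily Ω φ e e') (γ : RMetric k N)
    (hG : IsMetricFamily Ω fun t => metricIn (g t) e)
    (hd : ∀ q ∈ Ω, MDifferentiableAt (𝓡 n) (𝓡 k) (φ q.1 ∘ e.symm) q.2) (i j : Fin n) :
    Rep (hG.calculus.pb (hφ.calculus γ) i j) fun t u => pullbackIn γ (φ t) e u i j := by
  refine (hφ.rep_ip γ (fun a => (hφ.rep_φ γ a).dx hG.isOpen i)
    (fun a => (hφ.rep_φ γ a).dx hG.isOpen j)).congr fun q hq => ?_
  exact (pullbackIn_apply γ hφ.mem_charts (hd q hq) (hφ.mem_source q hq) i j).symm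

theorem rep_tens (hφ : IsMapFamily Ω φ e e') (γ : RMetric k N)
    (hG : IsMetricFamily Ω fun t => metricIn (g t) e) (hsub : ∀ q ∈ Ω, q.2 ∈ e.target)
    (a : Fin k) : Rep (hG.calculus.tens (hφ.calculus γ) a) fun t u =>
      tensionIn (g t) γ (φ t) e e' (e.symm u) a := by
  have h : Rep (hG.calculus.tens (hφ.calculus γ) a) fun t u =>
      traceWith (metricIn (g t) e u) (hessian (metricIn (g t) e) (mapComp (φ t) e e' a) u)
      + ∑ b, ∑ c, christoffel (metricIn γ e') a b c (e' (φ t (e.symm u))) *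
        gradPairing (metricIn (g t) e) (mapComp (φ t) e e' b) (mapComp (φ t) e e' c) u :=
    (hG.rep_lap (hφ.rep_φ γ a)).add (Rep.sum fun b => Rep.sum fun c =>
      Rep.mul (fun _ => rfl) (hG.rep_pair (hφ.rep_φ γ b) (hφ.rep_φ γ c)))
  refine h.congr fun q hq => ?_
  simp only [tensionIn, e.right_inv (hsub q hq)]

end IsMapFamily

/-- Restriction of smooth functions to the time slice at `t₀`. -/
noncomputable def slice (Ω : Set (ℝ × EuclideanSpace ℝ (Fin n))) (t₀ : ℝ) :
    SmoothFun Ω →+* ({u : EuclideanSpace ℝ (Fin n) // (t₀, u) ∈ Ω} → ℝ) :=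
  RingHom.pi fun u => SmoothFun.ev ⟨(t₀, u.1), u.2⟩

theorem slice_apply (t₀ : ℝ) (f : SmoothFun Ω) (u : {u // (t₀, u) ∈ Ω}) :
    slice Ω t₀ f u = f.1 ⟨(t₀, u.1), u.2⟩ := rfl

/-- Spatial derivatives are tangent to the slice, so they only see the values on it. -/
theorem slice_dx_congr (hΩ : IsOpen Ω) (t₀ : ℝ) (i : Fin n) (f h : SmoothFun Ω)
    (hfh : slice Ω t₀ f = slice Ω t₀ h) :
    slice Ω t₀ (Dx hΩ i f) = slice Ω t₀ (Dx hΩ i h) := by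
  funext u
  have hf : Rep f fun t u => SmoothFun.rep f (t, u) := fun p => SmoothFun.rep_eq f p
  have hh : Rep h fun t u => SmoothFun.rep h (t, u) := fun p => SmoothFun.rep_eq h p
  rw [slice_apply, slice_apply, hf.dx hΩ i, hh.dx hΩ i]
  change fderiv ℝ (fun z => SmoothFun.rep f (t₀, z)) u.1 _ =
    fderiv ℝ (fun z => SmoothFun.rep h (t₀, z)) u.1 _
  have hev : (fun z => SmoothFun.rep f (t₀, z)) =ᶠ[nhds u.1]
      fun z => SmoothFun.rep h (t₀, z) := by
    have hc : Continuous fun z : EuclideanSpace ℝ (Fin n) => (t₀, z) := by fun_prop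
    filter_upwards [(hΩ.preimage hc).mem_nhds u.2] with z hz
    have := congrFun hfh ⟨z, hz⟩
    rw [slice_apply, slice_apply, SmoothFun.rep_eq, SmoothFun.rep_eq] at this
    exact this
  rw [hev.fderiv_eq]

end FlowInChart
-- The flow as an instance of the abstract calculus
section FlowOnDomain

set_option linter.unusedSectionVars false

variable {n k : ℕ}
  {M : Type*} [TopologicalSpace M] [ChartedSpace (EuclideanSpace ℝ (Fin n)) M]
  [IsManifold (𝓡 n) ∞ M]
  {N : Type*} [TopologicalSpace N] [ChartedSpace (EuclideanSpace ℝ (Fin k)) N]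
  [IsManifold (𝓡 k) ∞ N]
  {J : Set ℝ} {g : ℝ → RMetric n M} {γ : RMetric k N} {φ : ℝ → M → N} {α : ℝ → ℝ}
  {e : OpenPartialHomeomorph M (EuclideanSpace ℝ (Fin n))}
  {e' : OpenPartialHomeomorph N (EuclideanSpace ℝ (Fin k))}

/-- The times and coordinates in the chart `e` at which the flow maps into the chart `e'`. -/
def flowDomain (J : Set ℝ) (φ : ℝ → M → N)
    (e : OpenPartialHomeomorph M (EuclideanSpace ℝ (Fin n)))
    (e' : OpenPartialHomeomorph N (EuclideanSpace ℝ (Fin k))) :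
    Set (ℝ × EuclideanSpace ℝ (Fin n)) :=
  (J ×ˢ e.target) ∩ (fun q => φ q.1 (e.symm q.2)) ⁻¹' e'.source

theorem flowDomain_subset : flowDomain J φ e e' ⊆ J ×ˢ e.target := Set.inter_subset_left

theorem isOpen_flowDomain (hJ : IsOpen J) (hflow : IsHarmonicRicciFlow J g γ φ α)
    (he : e ∈ charts n M) : IsOpen (flowDomain J φ e e') :=
  (contMDiffOn_inChart hflow.map_smooth he).continuousOn.isOpen_inter_preimage
    (hJ.prod e.open_target) e'.open_source

theorem isMapFamily_flowDomain (hflow : IsHarmonicRicciFlow J g γ φ α)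
    (he : e ∈ charts n M) (he' : e' ∈ charts k N) :
    IsMapFamily (flowDomain J φ e e') φ e e' where
  mem_charts := he'
  smooth := contMDiffOn_iff_contDiffOn.1 ((contMDiffOn_of_mem_maximalAtlas he').comp
    ((contMDiffOn_inChart hflow.map_smooth he).mono flowDomain_subset) fun _ hq => hq.2)
  mem_source _ hq := hq.2

theorem mdifferentiableAt_flow (hJ : IsOpen J) (hflow : IsHarmonicRicciFlow J g γ φ α)
    (he : e ∈ charts n M) {q : ℝ × EuclideanSpace ℝ (Fin n)} (hq : q ∈ J ×ˢ e.target) :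
    MDifferentiableAt (𝓡 n) (𝓡 k) (φ q.1 ∘ e.symm) q.2 := by
  have h := ((contMDiffOn_inChart hflow.map_smooth he).contMDiffAt
    ((hJ.prod e.open_target).mem_nhds hq)).mdifferentiableAt (by simp)
  have h2 : MDifferentiableAt (𝓡 n) 𝓘(ℝ, ℝ × EuclideanSpace ℝ (Fin n))
      (fun u : EuclideanSpace ℝ (Fin n) => (q.1, u)) q.2 :=
    ((differentiableAt_const _).prodMk differentiableAt_id).mdifferentiableAt
  exact MDifferentiableAt.comp (f := fun u : EuclideanSpace ℝ (Fin n) => (q.1, u)) q.2 h h2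

/-- The first order Taylor polynomial of the coupling function at `t₀`. -/
noncomputable def taylor (α : ℝ → ℝ) (t₀ t : ℝ) : ℝ := α t₀ + deriv α t₀ * (t - t₀)

theorem taylor_self (α : ℝ → ℝ) (t₀ : ℝ) : taylor α t₀ t₀ = α t₀ := by simp [taylor]

theorem hasDerivAt_taylor (α : ℝ → ℝ) (t₀ t : ℝ) : HasDerivAt (taylor α t₀) (deriv α t₀) t := by
  have := (((hasDerivAt_id t).sub_const t₀).const_mul (deriv α t₀)).const_add (α t₀)
  rwa [mul_one] at this

/-- A smooth function of time as an element of the ring of smooth functions. -/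
noncomputable def ofTime {Ω : Set (ℝ × EuclideanSpace ℝ (Fin n))} (f : ℝ → ℝ)
    (hf : ContDiffOn ℝ ∞ (fun q : ℝ × EuclideanSpace ℝ (Fin n) => f q.1) Ω) : SmoothFun Ω :=
  SmoothFun.mk (fun q => f q.1) hf

variable {Ω : Set (ℝ × EuclideanSpace ℝ (Fin n))}

theorem rep_ofTime (f : ℝ → ℝ)
    (hf : ContDiffOn ℝ ∞ (fun q : ℝ × EuclideanSpace ℝ (Fin n) => f q.1) Ω) :
    Rep (ofTime f hf) fun t _ => f t := fun _ => rfl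

theorem dx_eq_zero (hΩ : IsOpen Ω) {f : SmoothFun Ω} {F : ℝ → ℝ} (hf : Rep f fun t _ => F t)
    (i : Fin n) : Dx hΩ i f = 0 := by
  refine Subtype.ext (funext fun p => ?_)
  refine (hf.dx hΩ i p).trans ?_
  change fderiv ℝ (fun _ => F p.1.1) p.1.2 _ = 0
  simp

theorem taylor_contDiffOn (α : ℝ → ℝ) (t₀ : ℝ) : ContDiffOn ℝ ∞
    (fun q : ℝ × EuclideanSpace ℝ (Fin n) => taylor α t₀ q.1) Ω := by
  unfold taylor
  fun_prop

theorem rep_tensS (hφ : IsMapFamily Ω φ e e') (hG : IsMetricFamily Ω fun t => metricIn (g t) e)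
    (hd : ∀ q ∈ Ω, MDifferentiableAt (𝓡 n) (𝓡 k) (φ q.1 ∘ e.symm) q.2) {β : SmoothFun Ω}
    {b : ℝ → ℝ} (hβ : Rep β fun t _ => b t) (i j : Fin n) :
    Rep (hG.calculus.tensS (hφ.calculus γ) β i j) fun t u =>
      tensorSIn (g t) γ (φ t) (b t) e u i j :=
  (hG.rep_ric i j).sub (hβ.mul (hφ.rep_pb γ hG hd i j))

/-- The Taylor polynomial has the value of `α` at `t₀` only, which is why the metric equation is
claimed on that slice. The structural identities hold on the whole domain. -/
theorem isFlow (hJ : IsOpen J) (hflow : IsHarmonicRicciFlow J g γ φ α) (he : e ∈ charts n M)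
    (he' : e' ∈ charts k N) {t₀ : ℝ} (ht₀ : t₀ ∈ J)
    (hG : IsMetricFamily (flowDomain J φ e e') fun t => metricIn (g t) e)
    (hφ : IsMapFamily (flowDomain J φ e e') φ e e') :
    MetricCalculus.IsFlow hG.calculus (hφ.calculus γ)
      (ofTime (taylor α t₀) (taylor_contDiffOn α t₀)) (Dt hG.isOpen) (slice _ t₀) where
  congr i a b h := slice_dx_congr hG.isOpen t₀ i a b h
  compat i := hφ.isCompat γ hG.isOpen _
  compat_d := hφ.isCompat γ hG.isOpen _
  comm i a := SmoothFun.D_comm _ _ _ _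
  D_coupling i := dx_eq_zero hG.isOpen (rep_ofTime _ _) i
  metric_eq i j := by
    funext u
    have hS := rep_tensS (γ := γ) hφ hG (fun q hq => mdifferentiableAt_flow hJ hflow he hq.1)
      (rep_ofTime (taylor α t₀) (taylor_contDiffOn α t₀)) i j ⟨(t₀, u.1), u.2⟩
    have hg := (hG.rep_g i j).dt hG.isOpen ⟨(t₀, u.1), u.2⟩
    have hflow' := hflow.metric_eq t₀ ht₀ e he u.1 u.2.1.2 i j
    simp only [taylor_self, tensorSIn, Matrix.sub_apply, Matrix.smul_apply, smul_eq_mul] at hS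
    rw [slice_apply, hg]
    simp only [map_mul, map_neg, map_ofNat, Pi.mul_apply, Pi.neg_apply, Pi.ofNat_apply]
    rw [slice_apply, hS]
    refine hflow'.trans ?_
    ring
  map_eq a := by
    funext u
    have h1 := (hφ.rep_φ γ a).dt hG.isOpen ⟨(t₀, u.1), u.2⟩
    have h2 := hφ.rep_tens γ hG (fun q hq => hq.1.2) a ⟨(t₀, u.1), u.2⟩
    rw [slice_apply, slice_apply, h1, h2]
    exact hflow.map_eq t₀ ht₀ e he e' he' (e.symm u.1) (e.map_target u.2.1.2) u.2.2 a

theorem hessian_congr (G : EuclideanSpace ℝ (Fin n) → Matrix (Fin n) (Fin n) ℝ)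
    {f h : EuclideanSpace ℝ (Fin n) → ℝ} {u : EuclideanSpace ℝ (Fin n)}
    (hfh : f =ᶠ[nhds u] h) : hessian G f u = hessian G h u := by
  have h1 : ∀ j, pd j f =ᶠ[nhds u] pd j h := fun j => by
    filter_upwards [Filter.EventuallyEq.fderiv (𝕜 := ℝ) hfh] with z hz
    rw [pd, hz, pd]
  ext i j
  simp only [hessian, Matrix.of_apply]
  have h2 : pd i (pd j f) u = pd i (pd j h) u := by
    rw [pd, (h1 j).fderiv_eq]; rfl
  rw [h2]
  simp only [(h1 _).eq_of_nhds]

variable {T : ℝ} {l : ℝ → M → ℝ}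

/-- The function `w` at time `t` in the chart `e`, with `a` in place of `α t`. -/
noncomputable def harnackIn (T : ℝ) (g : RMetric n M) (γ : RMetric k N) (φ : M → N) (a : ℝ)
    (l : ℝ → M → ℝ) (e : OpenPartialHomeomorph M (EuclideanSpace ℝ (Fin n))) (t : ℝ)
    (u : EuclideanSpace ℝ (Fin n)) : ℝ :=
  ((T - t) * (2 * traceWith (metricIn g e u) (hessian (metricIn g e) (fun z => l t (e.symm z)) u)
      - gradPairing (metricIn g e) (fun z => l t (e.symm z)) (fun z => l t (e.symm z)) u
      + traceWith (metricIn g e u) (tensorSIn g γ φ a e u)) + l t (e.symm u) - n)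
    * kernelOf n T l t (e.symm u)

/-- The coupling enters `w` affinely, so replacing it costs the difference of the two values times a
factor independent of both. -/
theorem harnackIn_sub (T : ℝ) (g : RMetric n M) (γ : RMetric k N) (φ : M → N) (a b : ℝ)
    (l : ℝ → M → ℝ) (e : OpenPartialHomeomorph M (EuclideanSpace ℝ (Fin n))) (t : ℝ)
    (u : EuclideanSpace ℝ (Fin n)) :
    harnackIn T g γ φ a l e t u = harnackIn T g γ φ b l e t u
      - (a - b) * ((T - t) * traceWith (metricIn g e u) (pullbackIn γ φ e u)
        * kernelOf n T l t (e.symm u)) := by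
  have h : traceWith (metricIn g e u) (tensorSIn g γ φ a e u) =
      traceWith (metricIn g e u) (tensorSIn g γ φ b e u)
        - (a - b) * traceWith (metricIn g e u) (pullbackIn γ φ e u) := by
    simp only [traceWith, tensorSIn, Matrix.sub_apply, Matrix.smul_apply, smul_eq_mul,
      Finset.mul_sum, ← Finset.sum_sub_distrib]
    exact Finset.sum_congr rfl fun i _ => Finset.sum_congr rfl fun j _ => by ring
  rw [harnackIn, h, harnackIn]
  ring

/-- `w` may be computed in any chart. -/
theorem harnackOf_eq (hJ : IsOpen J) (hJT : J ⊆ Set.Iio T)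
    (hflow : IsHarmonicRicciFlow J g γ φ α)
    (hl : ContMDiffOn (𝓘(ℝ, ℝ).prod (𝓡 n)) 𝓘(ℝ, ℝ) ∞ (fun p : ℝ × M => l p.1 p.2)
      (J ×ˢ Set.univ))
    (hv : ∀ t ∈ J, ∀ e ∈ charts n M, ∀ x ∈ e.source,
      adjointHeatIn g γ φ α e (kernelOf n T l) t x = 0)
    (he : e ∈ charts n M) {t : ℝ} (ht : t ∈ J) {u : EuclideanSpace ℝ (Fin n)}
    (hu : u ∈ e.target) :
    harnackOf T g γ φ α l t (e.symm u) = harnackIn T (g t) γ (φ t) (α t) l e t u := by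
  have hx := e.map_target hu
  rw [harnackOf, laplacian_eq hJ hJT hflow hl hv he ht hx, gradSq_eq hJ hl he ht hx,
    traceS_eq hJ hflow he ht hx, laplacianIn, e.right_inv hu]
  rfl

/-- The evolution of `l`. -/
theorem deriv_l_eq (hJ : IsOpen J) (hJT : J ⊆ Set.Iio T)
    (hflow : IsHarmonicRicciFlow J g γ φ α)
    (hl : ContMDiffOn (𝓘(ℝ, ℝ).prod (𝓡 n)) 𝓘(ℝ, ℝ) ∞ (fun p : ℝ × M => l p.1 p.2)
      (J ×ˢ Set.univ))
    (hv : ∀ t ∈ J, ∀ e ∈ charts n M, ∀ x ∈ e.source,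
      adjointHeatIn g γ φ α e (kernelOf n T l) t x = 0)
    (he : e ∈ charts n M) {t : ℝ} (ht : t ∈ J) {u : EuclideanSpace ℝ (Fin n)}
    (hu : u ∈ e.target) {d : ℝ}
    (hd : deriv (fun s => kernelOf n T l s (e.symm u)) t =
      kernelOf n T l t (e.symm u) * (n / (2 * (T - t)) - d)) :
    d = -traceWith (metricIn (g t) e u) (hessian (metricIn (g t) e) (fun z => l t (e.symm z)) u)
        + gradPairing (metricIn (g t) e) (fun z => l t (e.symm z)) (fun z => l t (e.symm z)) u
        - traceWith (metricIn (g t) e u) (tensorSIn (g t) γ (φ t) (α t) e u)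
        + n / (2 * (T - t)) := by
  have hx := e.map_target hu
  have h := hv t ht e he _ hx
  rw [adjointHeatIn, laplacianIn_kernelOf hJ hJT hflow hl he ht hx, traceS_eq hJ hflow he ht hx,
    laplacianIn, e.right_inv hu, hd] at h
  refine mul_left_cancel₀ (kernelOf_ne_zero (n := n) hJT l ht (e.symm u)) ?_
  change _ = _ * (-traceWith (metricIn (g t) e u) (hessian (metricIn (g t) e) (l t ∘ e.symm) u)
    + gradPairing (metricIn (g t) e) (l t ∘ e.symm) (l t ∘ e.symm) u - _ + _)
  linear_combination h

/-- Only the first order Taylor polynomial of the coupling function matters for the first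
derivative of `w`. -/
theorem deriv_harnackOf_eq (hJ : IsOpen J) (hJT : J ⊆ Set.Iio T)
    (hflow : IsHarmonicRicciFlow J g γ φ α)
    (hl : ContMDiffOn (𝓘(ℝ, ℝ).prod (𝓡 n)) 𝓘(ℝ, ℝ) ∞ (fun p : ℝ × M => l p.1 p.2)
      (J ×ˢ Set.univ))
    (hv : ∀ t ∈ J, ∀ e ∈ charts n M, ∀ x ∈ e.source,
      adjointHeatIn g γ φ α e (kernelOf n T l) t x = 0)
    (he : e ∈ charts n M) {t : ℝ} (ht : t ∈ J) {u : EuclideanSpace ℝ (Fin n)}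
    (hu : u ∈ e.target)
    (hw : DifferentiableAt ℝ
      (fun s => harnackIn T (g s) γ (φ s) (taylor α t s) l e s u) t)
    (hE : DifferentiableAt ℝ (fun s => (T - s) * traceWith (metricIn (g s) e u)
      (pullbackIn γ (φ s) e u) * kernelOf n T l s (e.symm u)) t) :
    deriv (fun s => harnackOf T g γ φ α l s (e.symm u)) t =
      deriv (fun s => harnackIn T (g s) γ (φ s) (taylor α t s) l e s u) t := by
  -- The Taylor remainder and its derivative vanish at `t`, so by the product rule the correction in
  -- `harnackIn_sub` has derivative zero there.
  have hr : HasDerivAt (fun s => α s - taylor α t s) 0 t := by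
    have h := ((hflow.coupling_differentiable t ht).differentiableAt
      (hJ.mem_nhds ht)).hasDerivAt.sub (hasDerivAt_taylor α t t)
    rwa [sub_self] at h
  have h := hw.hasDerivAt.sub (hr.mul hE.hasDerivAt)
  rw [taylor_self, sub_self, zero_mul, zero_mul, add_zero, sub_zero] at h
  refine (h.congr_of_eventuallyEq ?_).deriv
  filter_upwards [hJ.mem_nhds ht] with s hs
  rw [harnackOf_eq hJ hJT hflow hl hv he hs hu, harnackIn_sub (b := taylor α t s)]
  rfl

theorem laplacianIn_harnackOf (hJ : IsOpen J) (hJT : J ⊆ Set.Iio T)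
    (hflow : IsHarmonicRicciFlow J g γ φ α)
    (hl : ContMDiffOn (𝓘(ℝ, ℝ).prod (𝓡 n)) 𝓘(ℝ, ℝ) ∞ (fun p : ℝ × M => l p.1 p.2)
      (J ×ˢ Set.univ))
    (hv : ∀ t ∈ J, ∀ e ∈ charts n M, ∀ x ∈ e.source,
      adjointHeatIn g γ φ α e (kernelOf n T l) t x = 0)
    (he : e ∈ charts n M) {t : ℝ} (ht : t ∈ J) {x : M} (hx : x ∈ e.source) :
    laplacianIn (g t) e (harnackOf T g γ φ α l t) x =
      traceWith (metricIn (g t) e (e x)) (hessian (metricIn (g t) e)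
        (harnackIn T (g t) γ (φ t) (α t) l e t) (e x)) := by
  rw [laplacianIn, hessian_congr]
  filter_upwards [e.open_target.mem_nhds (e.map_source hx)] with u hu
  exact harnackOf_eq hJ hJT hflow hl hv he ht hu

end FlowOnDomain
end HarmonicRicci

/-! ### Evaluation of the abstract identity at a point -/

theorem mainTheorem10 {n k : ℕ}
    {M : Type*} [TopologicalSpace M] [ChartedSpace (EuclideanSpace ℝ (Fin n)) M]
    [IsManifold (𝓡 n) ∞ M]
    {N : Type*} [TopologicalSpace N] [ChartedSpace (EuclideanSpace ℝ (Fin k)) N]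
    [IsManifold (𝓡 k) ∞ N]
    (T : ℝ) (J : Set ℝ) (hJ : IsOpen J) (hJT : J ⊆ Set.Iio T)
    (g : ℝ → RMetric n M) (γ : RMetric k N) (φ : ℝ → M → N) (α : ℝ → ℝ)
    (hflow : IsHarmonicRicciFlow J g γ φ α)
    (l : ℝ → M → ℝ)
    (hl : ContMDiffOn (𝓘(ℝ, ℝ).prod (𝓡 n)) 𝓘(ℝ, ℝ) ∞ (fun p : ℝ × M => l p.1 p.2)
      (J ×ˢ Set.univ))
    (hv : ∀ t ∈ J, ∀ e ∈ charts n M, ∀ x ∈ e.source,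
      adjointHeatIn g γ φ α e (kernelOf n T l) t x = 0) :
    ∀ t ∈ J, ∀ e ∈ charts n M, ∀ e' ∈ charts k N, ∀ x ∈ e.source, φ t x ∈ e'.source →
      adjointHeatIn g γ φ α e (harnackOf T g γ φ α l) t x =
        -2 * (T - t) *
          (solitonTensorSq (g t) γ (φ t) (α t) (l t) (T - t) e x
            + α t * solitonMapSq (g t) γ (φ t) (l t) e e' x
            - (1 / 2) * deriv α t * energyIn (g t) γ (φ t) e x) *
          kernelOf n T l t x := by
  intro t ht e he e' he' x hx hφx
  have hΩ : IsOpen (flowDomain J φ e e') := isOpen_flowDomain hJ hflow he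
  have hsub : flowDomain J φ e e' ⊆ J ×ˢ e.target := flowDomain_subset
  have hG := isMetricFamily_metricIn hflow he hΩ hsub
  have hφ := isMapFamily_flowDomain hflow he he'
  have hF := isFlow hJ hflow he he' ht hG hφ
  have hT : ∀ q ∈ flowDomain J φ e e', q.1 < T := fun q hq => hJT (hsub hq).1
  have hTne : ∀ q ∈ flowDomain J φ e e', 2 * (T - q.1) ≠ 0 := fun q hq => by
    have := sub_pos.2 (hT q hq)
    positivity
  have hp₀ : (t, e x) ∈ flowDomain J φ e e' := ⟨⟨ht, e.map_source hx⟩, by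
    simpa [e.left_inv hx] using hφx⟩
  have hex := e.map_source hx
  have hd : ∀ q ∈ flowDomain J φ e e', MDifferentiableAt (𝓡 n) (𝓡 k) (φ q.1 ∘ e.symm) q.2 :=
    fun q hq => mdifferentiableAt_flow hJ hflow he (hsub hq)
  -- the ingredients as smooth functions
  have hβ := rep_ofTime (Ω := flowDomain J φ e e') (taylor α t) (taylor_contDiffOn α t)
  generalize ofTime (taylor α t) (taylor_contDiffOn α t) = β at hβ hF
  obtain ⟨σ, hσ⟩ : ∃ σ : SmoothFun (flowDomain J φ e e'), Rep σ fun s _ => T - s :=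
    ⟨_, rep_ofTime (fun s => T - s) (by fun_prop)⟩
  obtain ⟨ν, hν⟩ : ∃ ν : SmoothFun (flowDomain J φ e e'), Rep ν fun s _ => n / (2 * (T - s)) :=
    ⟨_, rep_ofTime (fun s => n / (2 * (T - s)))
      (contDiffOn_const.div (by fun_prop) hTne)⟩
  -- The coefficient of `g` in the soliton tensor; `hsq` below uses it to complete the square.
  obtain ⟨c, hc⟩ : ∃ c : SmoothFun (flowDomain J φ e e'), Rep c fun s _ => 1 / (2 * (T - s)) :=
    ⟨_, rep_ofTime (fun s => 1 / (2 * (T - s)))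
      (contDiffOn_const.div (by fun_prop) hTne)⟩
  obtain ⟨m, hm⟩ : ∃ m : SmoothFun (flowDomain J φ e e'), Rep m fun _ _ => (n : ℝ) :=
    ⟨_, rep_ofTime (fun _ => (n : ℝ)) contDiffOn_const⟩
  obtain ⟨L, hL⟩ : ∃ L : SmoothFun (flowDomain J φ e e'), Rep L fun s u => l s (e.symm u) :=
    ⟨_, rep_mk (F := fun s u => l s (e.symm u)) ((contDiffOn_inChart hl he).mono hsub)⟩
  obtain ⟨v, hvr⟩ : ∃ v : SmoothFun (flowDomain J φ e e'),
      Rep v fun s u => kernelOf n T l s (e.symm u) :=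
    ⟨_, rep_mk (F := fun s u => kernelOf n T l s (e.symm u))
      ((kernelOf_contDiffOn hJT hl he).mono hsub)⟩
  have hσd : Dt hG.isOpen σ = -1 := Subtype.ext <| funext fun p =>
    (hσ.dt hG.isOpen p).trans (((hasDerivAt_id p.1.1).const_sub T).deriv)
  have hmd : Dt hG.isOpen m = 0 := Subtype.ext <| funext fun p =>
    (hm.dt hG.isOpen p).trans (deriv_const _ _)
  have hvd := dt_kernelOf hG.isOpen hT hL hvr hν
  have hS := fun i j => rep_tensS (γ := γ) hφ hG hd hβ i j
  have htrS := hG.rep_tr hS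
  have hlap := hG.rep_lap hL
  have hpair := hG.rep_pair hL hL
  have hE := hG.rep_tr fun i j => hφ.rep_pb γ hG hd i j
  have hl' : slice _ t (Dt hG.isOpen L) = slice _ t (-hG.calculus.lap L
      + hG.calculus.pair (fun i => hG.calculus.D i L) (fun i => hG.calculus.D i L)
      - hG.calculus.tr (hG.calculus.tensS (hφ.calculus γ) β) + ν) := by
    funext u
    have h1 := hvr.dt hG.isOpen ⟨(t, u.1), u.2⟩
    rw [hvd] at h1
    have h2 := (((hlap.neg.add hpair).sub htrS).add hν) ⟨(t, u.1), u.2⟩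
    simp only [taylor_self] at h2
    exact ((hL.dt hG.isOpen ⟨(t, u.1), u.2⟩).trans
      (deriv_l_eq hJ hJT hflow hl hv he ht (hsub u.2).2 (h1.symm.trans
        ((hvr.mul (hν.sub (hL.dt hG.isOpen))) ⟨(t, u.1), u.2⟩)))).trans h2.symm
  -- Taking `rfl` for the equation of `P` makes `P` the bracket of `w` in this chart, with the
  -- Taylor polynomial as coupling.
  have key := hF.map_adjointHeat (dx_eq_zero hG.isOpen hσ) hσd (dx_eq_zero hG.isOpen hm) hmd
    (dx_eq_zero hG.isOpen hν) hl' rfl (dx_kernelOf hG.isOpen hL hvr) hvd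
  -- evaluation at the point
  have htwo : Rep (2 : SmoothFun (flowDomain J φ e e')) fun _ _ => 2 := fun _ => rfl
  have hW : Rep _ fun s u => harnackIn T (g s) γ (φ s) (taylor α t s) l e s u :=
    (((hσ.mul (((htwo.mul hlap).sub hpair).add htrS)).add hL).sub hm).mul hvr
  have hSH := fun i j => (hS i j).add (hG.rep_hess hL i j)
  have hSHc := fun i j => (hSH i j).sub (hc.mul (hG.rep_g i j))
  have htens := fun a => (hφ.rep_tens γ hG (fun q hq => (hsub hq).2) a).sub
    (hG.rep_pair (hφ.rep_φ γ a) hL)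
  have hleft := (((hW.dt hG.isOpen).neg.sub (hG.rep_lap hW)).add (htrS.mul hW)) ⟨(t, e x), hp₀⟩
  have hright := (((((((htwo.mul hσ).mul ((hG.rep_pair2 (T' := fun s u =>
      tensorSIn (g s) γ (φ s) (taylor α t s) e u
        + hessian (metricIn (g s) e) (fun z => l s (e.symm z)) u) hSH).add
    (hβ.mul (hφ.rep_ip γ htens htens)))).sub (hσ.mul ((hβ.dt hG.isOpen).mul hE))).sub
      (htwo.mul (hG.rep_tr (T' := fun s u => tensorSIn (g s) γ (φ s) (taylor α t s) e u
        + hessian (metricIn (g s) e) (fun z => l s (e.symm z)) u) hSH))).add hν).neg).mul hvr)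
    ⟨(t, e x), hp₀⟩
  have hkey := hleft.symm.trans ((congrFun key ⟨e x, hp₀⟩).trans hright)
  have hcard : Rep (c ^ 2 * (Fintype.card (Fin n) : SmoothFun (flowDomain J φ e e')))
      fun s _ => (1 / (2 * (T - s))) * (1 / (2 * (T - s))) * n := by
    rw [sq]
    exact (hc.mul hc).mul fun p => (map_natCast (SmoothFun.ev p) _).trans (by simp)
  have hsq := congrFun (congrArg Subtype.val (MetricCalculus.pair2_sub_mul_g (X := hG.calculus)
    (fun i j => hG.calculus.tensS (hφ.calculus γ) β i j + hG.calculus.hess L i j) c))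
      ⟨(t, e x), hp₀⟩
  have hsq := ((hG.rep_pair2 (T' := fun s u => tensorSIn (g s) γ (φ s) (taylor α t s) e u
        + hessian (metricIn (g s) e) (fun z => l s (e.symm z)) u
        - (1 / (2 * (T - s))) • metricIn (g s) e u) hSHc ⟨(t, e x), hp₀⟩).symm.trans hsq).trans
    ((((hG.rep_pair2 (T' := fun s u => tensorSIn (g s) γ (φ s) (taylor α t s) e u
        + hessian (metricIn (g s) e) (fun z => l s (e.symm z)) u) hSH).sub
      ((htwo.mul hc).mul (hG.rep_tr (T' := fun s u => tensorSIn (g s) γ (φ s) (taylor α t s) e u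
        + hessian (metricIn (g s) e) (fun z => l s (e.symm z)) u) hSH))).add
      hcard) ⟨(t, e x), hp₀⟩)
  -- Differentiability in time comes from membership in the ring of smooth functions; `α` itself
  -- would not supply it in this form.
  have hdW := (hW.hasDerivAt hG.isOpen ⟨(t, e x), hp₀⟩).differentiableAt
  have hdE := (((hσ.mul hE).mul hvr).hasDerivAt hG.isOpen ⟨(t, e x), hp₀⟩).differentiableAt
  have hderiv := deriv_harnackOf_eq hJ hJT hflow hl hv he ht hex hdW hdE
  have hval := harnackOf_eq hJ hJT hflow hl hv he ht hex
  have hdα : deriv (fun s => taylor α t s) t = deriv α t := (hasDerivAt_taylor α t t).deriv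
  simp only [taylor_self, e.left_inv hx, hdα] at hkey hsq hderiv hval
  rw [adjointHeatIn, hderiv, laplacianIn_harnackOf hJ hJT hflow hl hv he ht hx,
    traceS_eq hJ hflow he ht hx, hval]
  refine hkey.trans ?_
  rw [solitonTensorSq]
  change _ = -2 * (T - t) * (tensorNormSq (metricIn (g t) e (e x))
    (tensorSIn (g t) γ (φ t) (α t) e (e x)
      + hessian (metricIn (g t) e) (fun z => l t (e.symm z)) (e x) - _) + _ - _) * _
  rw [hsq, solitonMapSq, energyIn]
  have hTt : T - t ≠ 0 := (sub_pos.2 (hJT ht)).ne'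
  simp only [Function.comp_def]
  -- With `σ = T - t` and `c = 1/(2σ)`, one has `2σ · 2c = 2` and `2σ · c² n = n/(2σ)`: the cross
  -- term and the constant of the square match the trace term and `ν`.
  field_simp
  ring
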